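/- Proposition 4.1 (anyonic double-bosonisation). Let $k$ be a field, $n\ge 1$, and $q\in k$ with $q^n=1$. Let $H=\mathbb Z'_{/n}$ be the group Hopf algebra of $\mathbb Z/n\mathbb Z$, with generator $g$, $g^n=1$, $\Delta g=g\otimes g$; when $q$ is a primitive $n$-th root of unity it carries $\mathcal R_g=n^{-1}\sum_{a,b=0}^{n-1}q^{-ab}g^a\otimes g^b$. An anyonic braided group is a $\mathbb Z/n\mathbb Z$-graded algebra $B$ that is also a coalgebra (coproduct written $b\mapsto b_{(1)}\otimes b_{(2)}$), with an antipode $S$, such that all structure maps preserve degrees, the counit is an algebra map, the coproduct is an algebra map to $B\otimes B$ with the product $(b\otimes d)(c\otimes e)=q^{|d||c|}\,bc\otimes de$ on homogeneous elements, and $S(b_{(1)})b_{(2)}=\epsilon(b)1=b_{(1)}S(b_{(2)})$. The grading corresponds to the right action $b\triangleleft g=q^{|b|}b$. Let $B$ and $B^\star$ be anyonic braided groups, the antipode of $B^\star$ being bijective, which are dual through a (possibly degenerate) bilinear map $\mathrm{ev}:B^\star\otimes B\to k$: $\mathrm{ev}(c,b)=0$ for homogeneous $c,b$ unless $|c|+|b|=0$,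 $\mathrm{ev}(1,b)=\epsilon(b)$, $\mathrm{ev}(c,1)=\epsilon(c)$, $$\mathrm{ev}(dc,b)=\mathrm{ev}(c,b_{(1)})\,\mathrm{ev}(d,b_{(2)}),\qquad \mathrm{ev}(c,ba)=\mathrm{ev}(c_{(1)},a)\,\mathrm{ev}(c_{(2)},b).$$ Let $B^{\star\mathrm{op}}$ be $B^\star$ with the opposite product. Then there is a Hopf algebra $B^{\star\mathrm{op}}\rtimes\mathbb Z'_{/n}\ltimes B$, unique up to a unique isomorphism of Hopf algebras compatible with the inclusions, that contains $B^{\star\mathrm{op}}$ and $B$ as subalgebras and $\mathbb Z'_{/n}$ as a sub-Hopf algebra, for which $c\otimes h\otimes b\mapsto chb$ is a linear isomorphism from $B^\star\otimes H\otimes B$, and in which, for all $b\in B$ and $c\in B^\star$ (expressions with degrees being extended linearly from homogeneous elements), $$bg=gb\,q^{|b|},\qquad cg=gc\,q^{|c|},$$ $$b_{(1)}g^{|c_{(2)}|}c_{(1)}\,\mathrm{ev}(c_{(2)},b_{(2)})=\mathrm{ev}(c_{(1)},b_{(1)})\,c_{(2)}g^{|b_{(1)}|}b_{(2)},$$ $$\Delta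 b=b_{(1)}\otimes g^{|b_{(1)}|}b_{(2)},\qquad \Delta c=g^{|c_{(2)}|}c_{(1)}\otimes c_{(2)}.$$ If $q$ is a primitive $n$-th root of unity, this is the double-bosonisation for $(H,\mathcal R_g)$ with the actions above. That is, among Hopf algebras which contain $B^{\star\mathrm{op}}$, $H$, $B$ and have $B^\star\otimes H\otimes B$ as underlying space in the way just described, the displayed relations and coproducts are equivalent to the following ones, for all $h\in H$, $b\in B$, $c\in B^\star$, with $\mathcal R_g=\mathcal R^{(1)}\otimes\mathcal R^{(2)}$: $$bh=h_{(1)}(b\triangleleft h_{(2)}),\qquad ch=h_{(2)}(c\triangleleft h_{(1)}),$$ $$b_{(1)}\mathcal R^{(1)}c_{(1)}\,\mathrm{ev}(c_{(2)}\triangleleft\mathcal R^{(2)},b_{(2)})=\mathrm{ev}(c_{(1)},b_{(1)}\triangleleft\mathcal R^{(1)})\,c_{(2)}\mathcal R^{(2)}b_{(2)},$$ $$\Delta b=b_{(1)}\triangleleft\mathcal R^{(1)}\otimes\mathcal R^{(2)}b_{(2)},\qquad \Delta c=\mathcal R^{(1)}c_{(1)}\otimes c_{(2)}\triangleleft\mathcal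 R^{(2)}.$$ -/

import Mathlib

open scoped TensorProduct

universe u v w x

noncomputable section

namespace Anyonic

/-- The anyon-generating Hopf algebra: the group algebra of `ℤ/nℤ`, with generator `g`, `g ^ n = 1`
and `Δ g = g ⊗ g` (Mathlib's Hopf algebra structure on the group algebra). -/
abbrev AnyonGen (k : Type u) [Field k] (n : ℕ) : Type u := AddMonoidAlgebra k (ZMod n)

/-- The element `g ^ a` for `a ∈ ℤ/nℤ`. -/
def gpow (k : Type u) [Field k] {n : ℕ} (a : ZMod n) : AnyonGen k n := AddMonoidAlgebra.single a 1

/-- The scalar `q ^ a` for `a ∈ ℤ/nℤ`; meaningful when `q ^ n = 1`. -/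
def qpow {k : Type u} [Field k] {n : ℕ} (q : k) (a : ZMod n) : k := q ^ a.val

section Sweedler

variable {k : Type u} [Field k] {B : Type v} [AddCommGroup B] [Module k B] [Coalgebra k B]

/-- Sweedler notation: `sweedler k b F` is `∑ F(b₍₁₎, b₍₂₎)` for `Δ b = ∑ b₍₁₎ ⊗ b₍₂₎`. It is used
only for bilinear `F`, where it does not depend on the chosen expression of `Δ b`. -/
def sweedler (k : Type u) [Field k] {B : Type v} [AddCommGroup B] [Module k B] [Coalgebra k B]
    {M : Type x} [AddCommMonoid M] (b : B) (F : B → B → M) : M :=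
  ∑ i ∈ (Coalgebra.Repr.arbitrary k b).index,
    F ((Coalgebra.Repr.arbitrary k b).left i) ((Coalgebra.Repr.arbitrary k b).right i)

theorem sweedler_eq_lift {M : Type x} [AddCommGroup M] [Module k M] (b : B)
    (F : B →ₗ[k] B →ₗ[k] M) :
    sweedler k b (fun x y => F x y) = TensorProduct.lift F (Coalgebra.comul (R := k) b) := by
  rw [← (Coalgebra.Repr.arbitrary k b).eq]
  simp [sweedler]

end Sweedler

section Braided

variable {k : Type u} [Field k] {n : ℕ} (q : k)
  {B : Type v} [Ring B] [Algebra k B] (𝒜 : ZMod n → Submodule k B) [GradedAlgebra 𝒜]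

theorem proj_of_mem {i j : ZMod n} {b : B} (hb : b ∈ 𝒜 i) :
    GradedAlgebra.proj 𝒜 j b = if j = i then b else 0 := by
  rw [GradedAlgebra.proj_apply]
  split_ifs with h
  · subst h; exact DirectSum.decompose_of_mem_same 𝒜 hb
  · exact DirectSum.decompose_of_mem_ne 𝒜 hb (Ne.symm h)

variable [NeZero n]

/-- The right action of the anyon-generating Hopf algebra that corresponds to the grading, namely
`b ◁ g = q ^ |b| b` for homogeneous `b`, extended linearly to all elements. -/
def act : B →ₗ[k] AnyonGen k n →ₗ[k] B :=
  LinearMap.mk₂ k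
    (fun b h => ∑ a : ZMod n, ∑ i : ZMod n, (h.coeff a * qpow q (a * i)) • GradedAlgebra.proj 𝒜 i b)
    (by intro b c h; simp only [map_add, smul_add, Finset.sum_add_distrib])
    (by
      intro r b h
      simp only [map_smul, Finset.smul_sum]
      exact Finset.sum_congr rfl fun a _ => Finset.sum_congr rfl fun i _ => smul_comm _ _ _)
    (by
      intro b h h'
      simp only [AddMonoidAlgebra.coeff_add, Finsupp.add_apply, add_mul, add_smul,
        Finset.sum_add_distrib])
    (by
      intro r b h
      simp only [AddMonoidAlgebra.coeff_smul, Finsupp.smul_apply, smul_eq_mul, Finset.smul_sum,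
        mul_assoc, mul_smul])

theorem act_gpow {i : ZMod n} {b : B} (hb : b ∈ 𝒜 i) (a : ZMod n) :
    act q 𝒜 b (gpow k a) = qpow q (a * i) • b := by
  simp [act, gpow, proj_of_mem 𝒜 hb, Finsupp.single_apply, -GradedAlgebra.proj_apply]

/-- The braiding `Ψ (b ⊗ c) = q ^ (|c| |b|) c ⊗ b` for homogeneous `b`, `c`, extended linearly. -/
def braiding : B ⊗[k] B →ₗ[k] B ⊗[k] B :=
  ∑ i : ZMod n, ∑ j : ZMod n, qpow q (j * i) •
    (TensorProduct.map (GradedAlgebra.proj 𝒜 j) (GradedAlgebra.proj 𝒜 i)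
      ∘ₗ (TensorProduct.comm k B B).toLinearMap)

theorem braiding_tmul {i j : ZMod n} {b c : B} (hb : b ∈ 𝒜 i) (hc : c ∈ 𝒜 j) :
    braiding q 𝒜 (b ⊗ₜ c) = qpow q (j * i) • (c ⊗ₜ[k] b) := by
  rw [braiding, LinearMap.sum_apply, Finset.sum_eq_single i]
  · rw [LinearMap.sum_apply, Finset.sum_eq_single j]
    · simp [proj_of_mem 𝒜 hb, proj_of_mem 𝒜 hc]
    · intro j' _ h
      simp [proj_of_mem 𝒜 hc, h]
    · simp
  · intro i' _ h
    simp [proj_of_mem 𝒜 hb, h]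
  · simp

/-- The product of the braided tensor product algebra: `(b ⊗ d)(c ⊗ e) = b Ψ(d ⊗ c) e`. -/
def braidedMul : (B ⊗[k] B) ⊗[k] (B ⊗[k] B) →ₗ[k] B ⊗[k] B :=
  TensorProduct.map (LinearMap.mul' k B) (LinearMap.mul' k B)
    ∘ₗ (TensorProduct.assoc k B B (B ⊗[k] B)).symm.toLinearMap
    ∘ₗ LinearMap.lTensor B (TensorProduct.assoc k B B B).toLinearMap
    ∘ₗ LinearMap.lTensor B (LinearMap.rTensor B (braiding q 𝒜))
    ∘ₗ LinearMap.lTensor B (TensorProduct.assoc k B B B).symm.toLinearMap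
    ∘ₗ (TensorProduct.assoc k B B (B ⊗[k] B)).toLinearMap

theorem braidedMul_tmul {i j : ZMod n} {b c d e : B} (hd : d ∈ 𝒜 i) (hc : c ∈ 𝒜 j) :
    braidedMul q 𝒜 ((b ⊗ₜ d) ⊗ₜ (c ⊗ₜ e)) = qpow q (j * i) • ((b * c) ⊗ₜ[k] (d * e)) := by
  simp [braidedMul, braiding_tmul q 𝒜 hd hc, TensorProduct.smul_tmul']

/-- The part of degree `i` of `B ⊗ B`. -/
def tensorDegree (i : ZMod n) : Submodule k (B ⊗[k] B) :=
  ⨆ j : ZMod n, LinearMap.range (TensorProduct.map (𝒜 j).subtype (𝒜 (i - j)).subtype)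

/-- `B`, a `ℤ/nℤ`-graded algebra and a coalgebra, is an anyonic braided group with braided
antipode `S`: all structure maps preserve degrees, the coproduct is an algebra homomorphism into
the braided tensor product algebra `B ⊗ B`, the counit is an algebra homomorphism, and `S` is
the convolution inverse of the identity. -/
structure IsAnyonicBraidedGroup [Coalgebra k B] (S : B →ₗ[k] B) : Prop where
  comul_mem : ∀ (i : ZMod n) (b : B), b ∈ 𝒜 i → Coalgebra.comul (R := k) b ∈ tensorDegree 𝒜 i
  counit_of_mem : ∀ (i : ZMod n) (b : B), b ∈ 𝒜 i → i ≠ 0 → Coalgebra.counit (R := k) b = 0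
  antipode_mem : ∀ (i : ZMod n) (b : B), b ∈ 𝒜 i → S b ∈ 𝒜 i
  comul_one : Coalgebra.comul (R := k) (1 : B) = 1 ⊗ₜ 1
  comul_mul : ∀ b c : B, Coalgebra.comul (R := k) (b * c) =
    braidedMul q 𝒜 (Coalgebra.comul (R := k) b ⊗ₜ Coalgebra.comul (R := k) c)
  counit_one : Coalgebra.counit (R := k) (1 : B) = 1
  counit_mul : ∀ b c : B, Coalgebra.counit (R := k) (b * c) =
    Coalgebra.counit (R := k) b * Coalgebra.counit (R := k) c
  antipode_left : ∀ b : B, sweedler k b (fun b₁ b₂ => S b₁ * b₂) =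
    algebraMap k B (Coalgebra.counit (R := k) b)
  antipode_right : ∀ b : B, sweedler k b (fun b₁ b₂ => b₁ * S b₂) =
    algebraMap k B (Coalgebra.counit (R := k) b)

end Braided

/-- `ev : C ⊗ B → k` is a duality pairing between the anyonic braided groups `C = B⋆` and `B`: it
preserves degrees and relates the opposite product of each to the coproduct of the other. It may
be degenerate. -/
structure IsDualPairing {k : Type u} [Field k] {n : ℕ}
    {B : Type v} [Ring B] [Algebra k B] [Coalgebra k B] (𝒜 : ZMod n → Submodule k B)
    {C : Type w} [Ring C] [Algebra k C] [Coalgebra k C] (𝒞 : ZMod n → Submodule k C)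
    (ev : C →ₗ[k] B →ₗ[k] k) : Prop where
  ev_of_mem : ∀ (i j : ZMod n) (c : C) (b : B), c ∈ 𝒞 i → b ∈ 𝒜 j → i + j ≠ 0 → ev c b = 0
  ev_one_left : ∀ b : B, ev 1 b = Coalgebra.counit (R := k) b
  ev_one_right : ∀ c : C, ev c 1 = Coalgebra.counit (R := k) c
  ev_mul_left : ∀ (c d : C) (b : B),
    ev (d * c) b = sweedler k b (fun b₁ b₂ => ev c b₁ * ev d b₂)
  ev_mul_right : ∀ (c : C) (a b : B),
    ev c (b * a) = sweedler k c (fun c₁ c₂ => ev c₁ a * ev c₂ b)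

section DoubleBosonisation

variable {k : Type u} [Field k]
  {H : Type x} [Ring H] [Bialgebra k H]
  {B : Type v} [Ring B] [Algebra k B]
  {C : Type w} [Ring C] [Algebra k C]
  {A : Type*} [Ring A] [Bialgebra k A]

/-- The linear map `C ⊗ H ⊗ B → A`, `c ⊗ h ⊗ b ↦ c h b`, defined by algebra maps from `Cᵒᵖ`, `H`
and `B` to `A`. -/
def tripleMul (jC : Cᵐᵒᵖ →ₐ[k] A) (jH : H →ₐc[k] A) (jB : B →ₐ[k] A) :
    (C ⊗[k] H) ⊗[k] B →ₗ[k] A :=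
  LinearMap.mul' k A ∘ₗ TensorProduct.map
    (LinearMap.mul' k A ∘ₗ TensorProduct.map
      (jC.toLinearMap ∘ₗ (MulOpposite.opLinearEquiv k : C ≃ₗ[k] Cᵐᵒᵖ).toLinearMap)
      (jH : H →ₐ[k] A).toLinearMap)
    jB.toLinearMap

theorem tripleMul_tmul (jC : Cᵐᵒᵖ →ₐ[k] A) (jH : H →ₐc[k] A) (jB : B →ₐ[k] A)
    (c : C) (h : H) (b : B) :
    tripleMul jC jH jB ((c ⊗ₜ h) ⊗ₜ b) = jC (MulOpposite.op c) * jH h * jB b := by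
  simp [tripleMul]

variable [Coalgebra k B] [Coalgebra k C]

/-- `A`, with the maps `jC`, `jH`, `jB`, is a double-bosonisation `Cᵒᵖ ⋊ H ⋉ B`, for
a background quantum group `H` with universal R-matrix `∑ r, R₁ r ⊗ R₂ r` that acts from the right
on the mutually dual braided groups `B` and `C = B⋆` by `actB` and `actC`.
It is built on `C ⊗ H ⊗ B` (so that the three maps are injective), contains `Cᵒᵖ`, `H`, `B` as
subalgebras and `H` as a sub-bialgebra, and has the stated cross relations and coproducts. -/
structure IsDoubleBosonisation {ι : Type*} [Fintype ι] (R₁ R₂ : ι → H)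
    (actB : B →ₗ[k] H →ₗ[k] B) (actC : C →ₗ[k] H →ₗ[k] C) (ev : C →ₗ[k] B →ₗ[k] k)
    (jC : Cᵐᵒᵖ →ₐ[k] A) (jH : H →ₐc[k] A) (jB : B →ₐ[k] A) : Prop where
  bijective : Function.Bijective (tripleMul jC jH jB)
  /-- `b h = h₍₁₎ (b ◁ h₍₂₎)` -/
  cross_B_H : ∀ (b : B) (h : H),
    jB b * jH h = sweedler k h (fun h₁ h₂ => jH h₁ * jB (actB b h₂))
  /-- `c h = h₍₂₎ (c ◁ h₍₁₎)` -/
  cross_C_H : ∀ (c : C) (h : H),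
    jC (MulOpposite.op c) * jH h =
      sweedler k h (fun h₁ h₂ => jH h₂ * jC (MulOpposite.op (actC c h₁)))
  /-- `b₍₁₎ R⁽¹⁾ c₍₁₎ ev(c₍₂₎ ◁ R⁽²⁾, b₍₂₎) = ev(c₍₁₎, b₍₁₎ ◁ R⁽¹⁾) c₍₂₎ R⁽²⁾ b₍₂₎` -/
  cross_B_C : ∀ (b : B) (c : C),
    sweedler k b (fun b₁ b₂ => sweedler k c (fun c₁ c₂ => ∑ r : ι,
      ev (actC c₂ (R₂ r)) b₂ • (jB b₁ * jH (R₁ r) * jC (MulOpposite.op c₁)))) =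
    sweedler k b (fun b₁ b₂ => sweedler k c (fun c₁ c₂ => ∑ r : ι,
      ev c₁ (actB b₁ (R₁ r)) • (jC (MulOpposite.op c₂) * jH (R₂ r) * jB b₂)))
  /-- `Δ b = b₍₁₎ ◁ R⁽¹⁾ ⊗ R⁽²⁾ b₍₂₎` -/
  comul_B : ∀ b : B, Coalgebra.comul (R := k) (jB b) =
    sweedler k b (fun b₁ b₂ => ∑ r : ι, jB (actB b₁ (R₁ r)) ⊗ₜ[k] (jH (R₂ r) * jB b₂))
  /-- `Δ c = R⁽¹⁾ c₍₁₎ ⊗ c₍₂₎ ◁ R⁽²⁾` -/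
  comul_C : ∀ c : C, Coalgebra.comul (R := k) (jC (MulOpposite.op c)) =
    sweedler k c (fun c₁ c₂ => ∑ r : ι,
      (jH (R₁ r) * jC (MulOpposite.op c₁)) ⊗ₜ[k] jC (MulOpposite.op (actC c₂ (R₂ r))))

end DoubleBosonisation

section Explicit

variable {k : Type u} [Field k] {n : ℕ} [NeZero n] (q : k)

/-- The first legs of the universal R-matrix `n⁻¹ ∑_{a,b} q ^ (-ab) g ^ a ⊗ g ^ b`. -/
def anyonR₁ (r : ZMod n × ZMod n) : AnyonGen k n :=
  ((n : k)⁻¹ * qpow q (-(r.1 * r.2))) • gpow k r.1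

/-- The second legs of the universal R-matrix `n⁻¹ ∑_{a,b} q ^ (-ab) g ^ a ⊗ g ^ b`. -/
def anyonR₂ (r : ZMod n × ZMod n) : AnyonGen k n := gpow k r.2

variable {B : Type v} [Ring B] [Algebra k B] [Coalgebra k B]
  (𝒜 : ZMod n → Submodule k B) [GradedAlgebra 𝒜]
  {C : Type w} [Ring C] [Algebra k C] [Coalgebra k C]
  (𝒞 : ZMod n → Submodule k C) [GradedAlgebra 𝒞]
  {A : Type*} [Ring A] [Bialgebra k A]

/-- `A`, with the maps `jC`, `jH`, `jB`, is built on `C ⊗ H ⊗ B` for `H` the anyon-generating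
Hopf algebra (so that the three maps are injective), contains `Cᵒᵖ`, `H`, `B` as subalgebras and `H`
as a sub-bialgebra, and has the explicit cross relations and coproducts stated below.
An inner expression that involves the degree `|x|` of a factor `x` is extended linearly
from homogeneous `x`, by summing over the homogeneous components of `x`. -/
structure IsAnyonicDoubleBosonisation (ev : C →ₗ[k] B →ₗ[k] k)
    (jC : Cᵐᵒᵖ →ₐ[k] A) (jH : AnyonGen k n →ₐc[k] A) (jB : B →ₐ[k] A) : Prop where
  bijective : Function.Bijective (tripleMul jC jH jB)
  /-- `b g = g b q ^ |b|` -/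
  cross_B_g : ∀ (i : ZMod n) (b : B), b ∈ 𝒜 i →
    jB b * jH (gpow k 1) = qpow q i • (jH (gpow k 1) * jB b)
  /-- `c g = g c q ^ |c|` -/
  cross_C_g : ∀ (i : ZMod n) (c : C), c ∈ 𝒞 i →
    jC (MulOpposite.op c) * jH (gpow k 1) =
      qpow q i • (jH (gpow k 1) * jC (MulOpposite.op c))
  /-- `b₍₁₎ g ^ |c₍₂₎| c₍₁₎ ev(c₍₂₎, b₍₂₎) = ev(c₍₁₎, b₍₁₎) c₍₂₎ g ^ |b₍₁₎| b₍₂₎` -/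
  cross_B_C : ∀ (b : B) (c : C),
    sweedler k b (fun b₁ b₂ => sweedler k c (fun c₁ c₂ => ∑ i : ZMod n,
      ev (GradedAlgebra.proj 𝒞 i c₂) b₂ •
        (jB b₁ * jH (gpow k i) * jC (MulOpposite.op c₁)))) =
    sweedler k b (fun b₁ b₂ => sweedler k c (fun c₁ c₂ => ∑ i : ZMod n,
      ev c₁ (GradedAlgebra.proj 𝒜 i b₁) •
        (jC (MulOpposite.op c₂) * jH (gpow k i) * jB b₂)))
  /-- `Δ b = b₍₁₎ ⊗ g ^ |b₍₁₎| b₍₂₎` -/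
  comul_B : ∀ b : B, Coalgebra.comul (R := k) (jB b) =
    sweedler k b (fun b₁ b₂ => ∑ i : ZMod n,
      jB (GradedAlgebra.proj 𝒜 i b₁) ⊗ₜ[k] (jH (gpow k i) * jB b₂))
  /-- `Δ c = g ^ |c₍₂₎| c₍₁₎ ⊗ c₍₂₎` -/
  comul_C : ∀ c : C, Coalgebra.comul (R := k) (jC (MulOpposite.op c)) =
    sweedler k c (fun c₁ c₂ => ∑ i : ZMod n,
      (jH (gpow k i) * jC (MulOpposite.op c₁)) ⊗ₜ[k]
        jC (MulOpposite.op (GradedAlgebra.proj 𝒞 i c₂)))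

end Explicit

end Anyonic

end

/-! The whole argument rests on one device. By local finiteness of coalgebras, in graded form, each
of the braided groups is spanned by entries of comatrices: square matrices `t` of homogeneous
elements with `Δ t i j = ∑ l, t i l ⊗ t l j`, `ε (t i j) = δ i j` and `|t i j| = p j - p i`
(`exists_comatrix`, `comatrix_induction`). On such entries every Sweedler expression is a finite
matrix sum whose factors have known degrees, and a braided identity becomes a matrix identity plus a
computation with exponents of `q`.

Let `T` be the inverse of the antipode of `C = B⋆`. The functional `ev (T c) b` is the inverse of
`ev c b` for a convolution twisted by powers of `q`, so the cross relation can be solved for `b c`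
(`IsCrossRep.B_mul_C`). Hence in any algebra where the relations hold the ordered products `c h b`
span a subalgebra (`IsCrossRep.range_mul_range_le`). Applied to a product of two representations,
this closure gives a universal property for any algebra in which the ordered products are in
bijection with `C ⊗ H ⊗ B` (`IsCrossRep.exists_lift`): the closed subspace is the graph of the
desired homomorphism.

For existence of the algebra it remains to find a representation in which the ordered products are
independent. It is modelled on left multiplication on `C ⊗ (H ⋉ B)`: `c` multiplies the first factor
and `b` acts by `ev(c₍₁₎, b₍₁₎)` on the left leg of `C`, by multiplication with `b₍₂₎` on the smash
product, and by `ev(S⁻¹ c₍₃₎, b₍₃₎)` on the right leg, with suitable powers of `g` and `q`. Each of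
these three actions is an algebra map by itself; they commute up to the braiding, so their
convolution product is again an algebra map (`convHom`), and the outer two each carry one half of
the cross relation (`isCrossRep_fullAction`). Evaluation at `1` shows independence, and the span of
the ordered products is the required algebra.

The coproduct and the counit come from the universal property, once the stated formulas are known to
respect the relations (`IsCrossRep.isCrossRep_comul`, `isCrossRep_counit`). The antipode is written
down on ordered products and checked there. Uniqueness is again the universal property. For a
primitive root, Fourier inversion on `ℤ/nℤ` collapses each sum over the R-matrix to the sum over
degrees, which identifies the two presentations (`isDoubleBosonisation_iff`). -/

noncomputable section

set_option linter.unusedSectionVars false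

namespace Anyonic

/-! ### Sweedler sums of bilinear functions -/

section Sweedler

variable {k : Type u} [Field k] {B : Type v} [AddCommGroup B] [Module k B]
  {M : Type w} [AddCommGroup M] [Module k M]

/-- A function of two variables that is linear in each of them. -/
structure IsBilin (k : Type u) [Field k] {B : Type v} [AddCommGroup B] [Module k B]
    {M : Type w} [AddCommGroup M] [Module k M] (F : B → B → M) : Prop where
  add_left : ∀ x x' y, F (x + x') y = F x y + F x' y
  smul_left : ∀ (r : k) x y, F (r • x) y = r • F x y
  add_right : ∀ x y y', F x (y + y') = F x y + F x y'
  smul_right : ∀ (r : k) x y, F x (r • y) = r • F x y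

/-- The bilinear map underlying a function that is linear in each variable. -/
def IsBilin.toLin {F : B → B → M} (hF : IsBilin k F) : B →ₗ[k] B →ₗ[k] M :=
  LinearMap.mk₂ k F hF.add_left hF.smul_left hF.add_right hF.smul_right

variable [Coalgebra k B]

theorem IsBilin.sweedler_eq {F : B → B → M} (hF : IsBilin k F) (b : B) :
    sweedler k b F = TensorProduct.lift hF.toLin (Coalgebra.comul (R := k) b) :=
  sweedler_eq_lift b hF.toLin

/-- Bilinearity makes the Sweedler sum depend only on `Δ b`, so any expression of `Δ b` may replace
the chosen one. -/
theorem IsBilin.sweedler_of_comul {F : B → B → M} (hF : IsBilin k F) {b : B} {ι : Type*}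
    [Fintype ι] {x y : ι → B} (h : Coalgebra.comul (R := k) b = ∑ i, x i ⊗ₜ[k] y i) :
    sweedler k b F = ∑ i, F (x i) (y i) := by
  rw [hF.sweedler_eq, h]
  simp [IsBilin.toLin]

theorem IsBilin.sweedler_add_left {F : B → B → M} (hF : IsBilin k F) (b b' : B) :
    sweedler k (b + b') F = sweedler k b F + sweedler k b' F := by
  simp [hF.sweedler_eq]

theorem IsBilin.sweedler_smul_left {F : B → B → M} (hF : IsBilin k F) (r : k) (b : B) :
    sweedler k (r • b) F = r • sweedler k b F := by
  simp [hF.sweedler_eq]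

theorem sweedler_add (b : B) (F G : B → B → M) :
    sweedler k b (fun x y => F x y + G x y) = sweedler k b F + sweedler k b G :=
  Finset.sum_add_distrib

theorem sweedler_smul (r : k) (b : B) (F : B → B → M) :
    sweedler k b (fun x y => r • F x y) = r • sweedler k b F :=
  Finset.smul_sum.symm

end Sweedler

/-! ### Powers of `q` and of `g` with exponents in `ℤ/nℤ` -/

section Power

variable {k : Type u} [Field k] {n : ℕ} [NeZero n] {q : k}

@[simp] theorem qpow_zero (q : k) : qpow q (0 : ZMod n) = 1 := by simp [qpow]

theorem qpow_natCast (hq : q ^ n = 1) (m : ℕ) : qpow q (m : ZMod n) = q ^ m := by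
  rw [qpow, ZMod.val_natCast]
  conv_rhs => rw [← Nat.mod_add_div m n, pow_add, pow_mul, hq, one_pow, mul_one]

theorem qpow_add (hq : q ^ n = 1) (a b : ZMod n) : qpow q (a + b) = qpow q a * qpow q b := by
  obtain ⟨a, rfl⟩ := ZMod.natCast_zmod_surjective a
  obtain ⟨b, rfl⟩ := ZMod.natCast_zmod_surjective b
  rw [← Nat.cast_add, qpow_natCast hq, qpow_natCast hq, qpow_natCast hq, pow_add]

theorem qpow_mul_qpow_neg (hq : q ^ n = 1) (a : ZMod n) : qpow q a * qpow q (-a) = 1 := by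
  rw [← qpow_add hq, add_neg_cancel, qpow_zero]

theorem qpow_neg_mul_qpow (hq : q ^ n = 1) (a : ZMod n) : qpow q (-a) * qpow q a = 1 := by
  rw [← qpow_add hq, neg_add_cancel, qpow_zero]

theorem qpow_ne_zero (hq : q ^ n = 1) (a : ZMod n) : qpow q a ≠ 0 :=
  left_ne_zero_of_mul_eq_one (qpow_mul_qpow_neg hq a)

theorem gpow_add (a b : ZMod n) : gpow k (a + b) = gpow k a * gpow k b := by
  simp [gpow, AddMonoidAlgebra.single_mul_single]

@[simp] theorem gpow_zero : gpow k (0 : ZMod n) = 1 := rfl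

theorem gpow_mul_gpow_neg (a : ZMod n) : gpow k a * gpow k (-a) = 1 := by
  rw [← gpow_add, add_neg_cancel, gpow_zero]

theorem gpow_neg_mul_gpow (a : ZMod n) : gpow k (-a) * gpow k a = 1 := by
  rw [← gpow_add, neg_add_cancel, gpow_zero]

theorem gpow_commute (a b : ZMod n) : gpow k a * gpow k b = gpow k b * gpow k a := by
  rw [← gpow_add, add_comm, gpow_add]

theorem comul_gpow (a : ZMod n) :
    Coalgebra.comul (R := k) (gpow k a) = gpow k a ⊗ₜ[k] gpow k a := by
  simp [gpow]

theorem counit_gpow (a : ZMod n) : Coalgebra.counit (R := k) (gpow k a) = 1 := by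
  simp [gpow]

theorem anyonGen_induction {P : AnyonGen k n → Prop} (hadd : ∀ x y, P x → P y → P (x + y))
    (hsmul : ∀ (r : k) x, P x → P (r • x)) (hg : ∀ a, P (gpow k a)) (h : AnyonGen k n) : P h := by
  induction h using AddMonoidAlgebra.induction_linear with
  | zero => simpa using hsmul 0 _ (hg 0)
  | add x y hx hy => exact hadd x y hx hy
  | single a r =>
    have := hsmul r _ (hg a)
    rwa [gpow, AddMonoidAlgebra.smul_single, smul_eq_mul, mul_one] at this

theorem anyonGen_linearMap_ext {M : Type*} [AddCommMonoid M] [Module k M]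
    {f f' : AnyonGen k n →ₗ[k] M} (h : ∀ a, f (gpow k a) = f' (gpow k a)) : f = f' := by
  ext x
  exact h x

end Power

/-! ### Homogeneous components -/

section Graded

variable {k : Type u} [Field k] {n : ℕ} {B : Type v} [Ring B] [Algebra k B]
  (𝒜 : ZMod n → Submodule k B) [GradedAlgebra 𝒜]

theorem proj_mem (i : ZMod n) (b : B) : GradedAlgebra.proj 𝒜 i b ∈ 𝒜 i := by
  rw [GradedAlgebra.proj_apply]
  exact SetLike.coe_mem _

theorem sum_proj [NeZero n] (b : B) : ∑ i, GradedAlgebra.proj 𝒜 i b = b := by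
  classical
  simp only [GradedAlgebra.proj_apply]
  conv_rhs => rw [← DirectSum.sum_support_decompose 𝒜 b]
  refine (Finset.sum_subset (Finset.subset_univ _) fun i _ hi => ?_).symm
  simpa using hi

theorem homogeneous_induction [NeZero n] {P : B → Prop} (hadd : ∀ x y, P x → P y → P (x + y))
    (hmem : ∀ i, ∀ x ∈ 𝒜 i, P x) (b : B) : P b := by
  rw [← sum_proj 𝒜 b]
  exact Finset.sum_induction _ P hadd (hmem 0 0 (zero_mem _)) fun i _ => hmem i _ (proj_mem 𝒜 i b)

end Graded

/-! ### Local finiteness: comatrices of homogeneous elements -/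

section Comatrix

variable {k : Type u} [Field k] {n : ℕ} {B : Type v} [Ring B] [Algebra k B] [Coalgebra k B]
  (𝒜 : ZMod n → Submodule k B)

/-- A square matrix of homogeneous elements that is the matrix of coefficients of a graded
finite-dimensional comodule whose basis vectors have the degrees `p`. -/
structure IsComatrix {I : Type*} [Fintype I] [DecidableEq I] (p : I → ZMod n) (t : I → I → B) :
    Prop where
  mem : ∀ i j, t i j ∈ 𝒜 (p j - p i)
  comul : ∀ i j, Coalgebra.comul (R := k) (t i j) = ∑ l, t i l ⊗ₜ[k] t l j
  counit : ∀ i j, Coalgebra.counit (R := k) (t i j) = if i = j then 1 else 0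

theorem IsComatrix.sweedler_eq_sum {𝒜 : ZMod n → Submodule k B}
    {I : Type*} [Fintype I] [DecidableEq I] {p : I → ZMod n}
    {t : I → I → B} (ht : IsComatrix 𝒜 p t) {M : Type*} [AddCommGroup M] [Module k M]
    {F : B → B → M} (hF : IsBilin k F) (i j : I) :
    Anyonic.sweedler k (t i j) F = ∑ l, F (t i l) (t l j) :=
  hF.sweedler_of_comul (ht.comul i j)

/-- The contraction of the second tensor factor with a functional. -/
def contractRight (k : Type u) [Field k] {B : Type v} [Ring B] [Algebra k B]
    (f : B →ₗ[k] k) : B ⊗[k] B →ₗ[k] B :=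
  (TensorProduct.rid k B).toLinearMap ∘ₗ LinearMap.lTensor B f

theorem contractRight_tmul (f : B →ₗ[k] k) (x y : B) :
    contractRight k f (x ⊗ₜ y) = f y • x := by simp [contractRight]

/-- Over a field, the coordinate functionals of a basis of the second factor separate tensors. -/
theorem eq_of_contractRight {z z' : B ⊗[k] B}
    (h : ∀ f : B →ₗ[k] k, contractRight k f z = contractRight k f z') : z = z' := by
  classical
  apply (TensorProduct.equivFinsuppOfBasisRight (Module.Basis.ofVectorSpace k B)).injective
  ext i
  rw [TensorProduct.equivFinsuppOfBasisRight_apply, TensorProduct.equivFinsuppOfBasisRight_apply]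
  exact h _

/-- Coassociativity: contracting twice is contracting once with the convolution of the two
functionals. This is what makes the span of all contractions of `Δ b` stable under further
contraction. -/
theorem contractRight_comul_contractRight_comul (f f' : B →ₗ[k] k) (b : B) :
    contractRight k f (Coalgebra.comul (R := k)
      (contractRight k f' (Coalgebra.comul (R := k) b))) =
    contractRight k (LinearMap.mul' k k ∘ₗ TensorProduct.map f f' ∘ₗ Coalgebra.comul)
      (Coalgebra.comul (R := k) b) := by
  set Φ : B ⊗[k] (B ⊗[k] B) →ₗ[k] B := (TensorProduct.rid k B).toLinearMap ∘ₗ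
    LinearMap.lTensor B (LinearMap.mul' k k ∘ₗ TensorProduct.map f f') with hΦ
  have h1 : ∀ z : B ⊗[k] B, contractRight k f (Coalgebra.comul (R := k) (contractRight k f' z)) =
      Φ (TensorProduct.assoc k B B B (LinearMap.rTensor B Coalgebra.comul z)) := by
    intro z
    induction z with
    | zero => simp
    | add x y hx hy => simp only [map_add, hx, hy]
    | tmul x y =>
      rw [contractRight_tmul, LinearMap.rTensor_tmul, map_smul, map_smul]
      generalize Coalgebra.comul (R := k) x = w
      induction w with
      | zero => simp
      | add x y hx hy => simp only [map_add, hx, hy, TensorProduct.add_tmul, smul_add]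
      | tmul a c => simp [contractRight_tmul, hΦ, smul_smul, mul_comm]
  have h2 : ∀ z : B ⊗[k] B, contractRight k (LinearMap.mul' k k ∘ₗ TensorProduct.map f f' ∘ₗ
      Coalgebra.comul) z = Φ (LinearMap.lTensor B Coalgebra.comul z) := by
    intro z
    induction z with
    | zero => simp
    | add x y hx hy => simp only [map_add, hx, hy]
    | tmul x y => simp [contractRight_tmul, hΦ]
  rw [h1, h2, Coalgebra.coassoc_apply]

variable [GradedAlgebra 𝒜] {𝒜}

theorem contractRight_comp_proj_mem {i : ZMod n} {z : B ⊗[k] B} (hz : z ∈ tensorDegree 𝒜 i)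
    (f : B →ₗ[k] k) (l : ZMod n) :
    contractRight k (f ∘ₗ GradedAlgebra.proj 𝒜 l) z ∈ 𝒜 (i - l) := by
  suffices h : tensorDegree 𝒜 i ≤
      (𝒜 (i - l)).comap (contractRight k (f ∘ₗ GradedAlgebra.proj 𝒜 l)) from h hz
  refine iSup_le fun j => ?_
  rintro _ ⟨y, rfl⟩
  induction y with
  | zero => simp
  | add x y hx hy => rw [map_add]; exact add_mem hx hy
  | tmul x y =>
    simp only [Submodule.mem_comap, TensorProduct.map_tmul, contractRight_tmul,
      LinearMap.comp_apply, Submodule.subtype_apply, proj_of_mem 𝒜 y.2]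
    split_ifs with h
    · refine Submodule.smul_mem _ _ ?_
      rw [h, sub_sub_cancel]
      exact x.2
    · simp

/-- Contraction of the first tensor factor of `Δ b` with a functional that sees only one degree. -/
theorem contractLeft_comp_proj_mem {i : ZMod n} {z : B ⊗[k] B} (hz : z ∈ tensorDegree 𝒜 i)
    (f : B →ₗ[k] k) (l : ZMod n) :
    TensorProduct.lid k B (LinearMap.rTensor B (f ∘ₗ GradedAlgebra.proj 𝒜 l) z) ∈ 𝒜 (i - l) := by
  suffices h : tensorDegree 𝒜 i ≤ (𝒜 (i - l)).comap ((TensorProduct.lid k B).toLinearMap ∘ₗ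
      LinearMap.rTensor B (f ∘ₗ GradedAlgebra.proj 𝒜 l)) from h hz
  refine iSup_le fun j => ?_
  rintro _ ⟨y, rfl⟩
  induction y with
  | zero => simp
  | add x y hx hy => rw [map_add]; exact add_mem hx hy
  | tmul x y =>
    simp only [Submodule.mem_comap, TensorProduct.map_tmul, LinearMap.comp_apply,
      Submodule.subtype_apply, LinearMap.rTensor_tmul, proj_of_mem 𝒜 x.2, LinearEquiv.coe_coe,
      TensorProduct.lid_tmul]
    split_ifs with h
    · refine Submodule.smul_mem _ _ ?_
      rw [h]
      exact y.2
    · simp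

/-- The span is the subcomodule generated by `b`, consisting of all contractions of `Δ b` in its
second leg. It contains `b` by the counit axiom, is stable by coassociativity, and is
finite-dimensional because `Δ b` is a finite sum of pure tensors. -/
theorem exists_homogeneous_family [NeZero n]
    (hcomul : ∀ (i : ZMod n) (b : B), b ∈ 𝒜 i → Coalgebra.comul (R := k) b ∈ tensorDegree 𝒜 i)
    {i : ZMod n} {b : B} (hb : b ∈ 𝒜 i) :
    ∃ (m : ℕ) (p : Fin m → ZMod n) (e : Fin m → B), LinearIndependent k e ∧
      (∀ j, e j ∈ 𝒜 (p j)) ∧ b ∈ Submodule.span k (Set.range e) ∧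
      ∀ j (f : B →ₗ[k] k), contractRight k f (Coalgebra.comul (R := k) (e j)) ∈
        Submodule.span k (Set.range e) := by
  -- Only functionals supported in a single degree are used, so that every generator, and hence the
  -- basis extracted from them, is homogeneous.
  set g : (B →ₗ[k] k) × ZMod n → B := fun fl =>
    contractRight k (fl.1 ∘ₗ GradedAlgebra.proj 𝒜 fl.2) (Coalgebra.comul (R := k) b) with hg
  obtain ⟨s, hs, hspan, hli⟩ := exists_linearIndependent k (Set.range g)
  have key : ∀ f : B →ₗ[k] k, contractRight k f (Coalgebra.comul (R := k) b) ∈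
      Submodule.span k (Set.range g) := by
    intro f
    have : f = ∑ l, f ∘ₗ GradedAlgebra.proj 𝒜 l := by
      ext x
      conv_lhs => rw [← sum_proj 𝒜 x]
      simp only [map_sum, LinearMap.sum_apply, LinearMap.comp_apply]
    have h2 : contractRight k f (Coalgebra.comul (R := k) b) = ∑ l, g (f, l) := by
      rw [hg]
      conv_lhs => rw [this]
      generalize Coalgebra.comul (R := k) b = z
      induction z with
      | zero => simp
      | add x y hx hy => simp only [map_add, hx, hy, Finset.sum_add_distrib]
      | tmul x y => simp only [contractRight_tmul, LinearMap.sum_apply, Finset.sum_smul]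
    rw [h2]
    exact Submodule.sum_mem _ fun l _ => Submodule.subset_span ⟨_, rfl⟩
  have hfin : s.Finite := by
    obtain ⟨S, hS⟩ := TensorProduct.exists_finset (Coalgebra.comul (R := k) b)
    classical
    have hle : Submodule.span k (Set.range g) ≤
        Submodule.span k ((S.image Prod.fst : Finset B) : Set B) := by
      rw [Submodule.span_le]
      rintro _ ⟨fl, rfl⟩
      rw [hg]
      simp only [hS, map_sum, contractRight_tmul]
      refine Submodule.sum_mem _ fun x hx => Submodule.smul_mem _ _ (Submodule.subset_span ?_)
      exact Finset.mem_coe.2 (Finset.mem_image_of_mem _ hx)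
    have : FiniteDimensional k (Submodule.span k ((S.image Prod.fst : Finset B) : Set B)) :=
      FiniteDimensional.span_finset k _
    have : FiniteDimensional k (Submodule.span k s) :=
      hspan ▸ Submodule.finiteDimensional_of_le hle
    have hli' : LinearIndependent k (fun x : s => (⟨x, Submodule.subset_span x.2⟩ :
        Submodule.span k s)) := by
      refine LinearIndependent.of_comp (Submodule.span k s).subtype ?_
      exact hli
    exact Set.finite_coe_iff.1 (LinearIndependent.finite hli')
  have := hfin.fintype
  let eq := (Fintype.equivFin s).symm
  have hrange : Set.range (fun j => (eq j : B)) = s := by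
    ext x
    constructor
    · rintro ⟨j, rfl⟩; exact (eq j).2
    · intro hx; exact ⟨eq.symm ⟨x, hx⟩, by simp⟩
  choose φ hφ using fun x (hx : x ∈ s) => hs hx
  refine ⟨_, fun j => i - (φ _ (eq j).2).2, fun j => eq j, hli.comp _ eq.injective, ?_, ?_, ?_⟩
  · intro j
    have := contractRight_comp_proj_mem (hcomul i b hb) (φ _ (eq j).2).1 (φ _ (eq j).2).2
    rwa [show contractRight k _ _ = ((eq j : s) : B) from hφ _ (eq j).2] at this
  · rw [hrange, hspan]
    have := key Coalgebra.counit
    rwa [contractRight, LinearMap.comp_apply, Coalgebra.lTensor_counit_comul, LinearEquiv.coe_coe,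
      TensorProduct.rid_tmul, one_smul] at this
  · intro j f
    rw [hrange, hspan]
    show contractRight k f (Coalgebra.comul (R := k) ((eq j : s) : B)) ∈ _
    rw [← hφ _ (eq j).2, hg]
    simp only [contractRight_comul_contractRight_comul]
    exact key _

/-- For a homogeneous basis `e` of the subcomodule generated by `b`, write `Δ (e j) = ∑ i, e i ⊗ t i
j`. Coassociativity makes `t` a comatrix, and the counit axiom puts each `e j`, hence `b`, in the
span of its entries. -/
theorem exists_comatrix [NeZero n]
    (hcomul : ∀ (i : ZMod n) (b : B), b ∈ 𝒜 i → Coalgebra.comul (R := k) b ∈ tensorDegree 𝒜 i)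
    {i : ZMod n} {b : B} (hb : b ∈ 𝒜 i) :
    ∃ (m : ℕ) (p : Fin m → ZMod n) (t : Fin m → Fin m → B), IsComatrix 𝒜 p t ∧
      b ∈ Submodule.span k (Set.range fun x : Fin m × Fin m => t x.1 x.2) := by
  obtain ⟨m, p, e, hli, hmem, hbe, hstab⟩ := exists_homogeneous_family hcomul hb
  obtain ⟨φ, hφ⟩ : ∃ φ : Fin m → B →ₗ[k] k, ∀ i j, φ i (e j) = if i = j then 1 else 0 := by
    obtain ⟨g, hg⟩ := LinearMap.exists_leftInverse_of_injective
      (Finsupp.linearCombination k e) (LinearMap.ker_eq_bot.2 hli)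
    refine ⟨fun i => Finsupp.lapply i ∘ₗ g, fun i j => ?_⟩
    have h := LinearMap.congr_fun hg (Finsupp.single j 1)
    rw [LinearMap.comp_apply, Finsupp.linearCombination_single, one_smul] at h
    simp [h, Finsupp.single_apply, eq_comm]
  -- The dual functional is cut down to degree `p i`; it still is dual to `e`, and now the
  -- coefficients it produces are homogeneous.
  set ψ : Fin m → B →ₗ[k] k := fun i => φ i ∘ₗ GradedAlgebra.proj 𝒜 (p i) with hψ
  have hψe : ∀ i j, ψ i (e j) = if i = j then 1 else 0 := by
    intro i j
    simp only [hψ, LinearMap.comp_apply, proj_of_mem 𝒜 (hmem j)]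
    split_ifs with h1 h2 h2
    · simp [hφ, h2]
    · simp [hφ, h2]
    · exact absurd (by rw [h2]) h1
    · simp
  have hspan : ∀ x ∈ Submodule.span k (Set.range e), ∑ j, ψ j x • e j = x := by
    intro x hx
    induction hx using Submodule.span_induction with
    | mem x h =>
      obtain ⟨j, rfl⟩ := h
      simp [hψe]
    | zero => simp
    | add x y _ _ hx hy => simp only [map_add, add_smul, Finset.sum_add_distrib, hx, hy]
    | smul r x _ hx =>
      simp only [map_smul, smul_eq_mul, mul_smul, ← Finset.smul_sum, hx]
  set t : Fin m → Fin m → B := fun i j =>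
    TensorProduct.lid k B (LinearMap.rTensor B (ψ i) (Coalgebra.comul (R := k) (e j))) with ht
  have hcontract : ∀ (i : Fin m) (f : B →ₗ[k] k) (z : B ⊗[k] B),
      f (TensorProduct.lid k B (LinearMap.rTensor B (ψ i) z)) = ψ i (contractRight k f z) := by
    intro i f z
    induction z with
    | zero => simp
    | add x y hx hy => simp only [map_add, hx, hy]
    | tmul x y => simp [contractRight_tmul, mul_comm]
  have hcomul_e : ∀ j, Coalgebra.comul (R := k) (e j) = ∑ i, e i ⊗ₜ[k] t i j := by
    intro j
    refine eq_of_contractRight fun f => ?_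
    rw [← hspan _ (hstab j f), map_sum]
    simp only [contractRight_tmul, ht, hcontract]
  refine ⟨m, p, t, ⟨fun i j => contractLeft_comp_proj_mem (hcomul _ _ (hmem j)) (φ i) (p i),
    fun i j => ?_, fun i j => ?_⟩, ?_⟩
  · have h1 : ∀ z : B ⊗[k] B, Coalgebra.comul (R := k)
        (TensorProduct.lid k B (LinearMap.rTensor B (ψ i) z)) =
        TensorProduct.lid k (B ⊗[k] B) (LinearMap.rTensor (B ⊗[k] B) (ψ i)
          (LinearMap.lTensor B Coalgebra.comul z)) := by
      intro z
      induction z with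
      | zero => simp
      | add x y hx hy => simp only [map_add, hx, hy]
      | tmul x y => simp
    have h2 : ∀ (z : B ⊗[k] B) (y : B), TensorProduct.lid k (B ⊗[k] B)
        (LinearMap.rTensor (B ⊗[k] B) (ψ i) (TensorProduct.assoc k B B B (z ⊗ₜ y))) =
        TensorProduct.lid k B (LinearMap.rTensor B (ψ i) z) ⊗ₜ y := by
      intro z y
      induction z with
      | zero => simp
      | add x y hx hy => simp only [map_add, hx, hy, TensorProduct.add_tmul]
      | tmul a c => simp [TensorProduct.smul_tmul']
    show Coalgebra.comul (R := k) (TensorProduct.lid k B _) = _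
    rw [h1, ← Coalgebra.coassoc_apply, hcomul_e j]
    simp only [map_sum, LinearMap.rTensor_tmul, h2, ht]
  · show Coalgebra.counit (R := k) (TensorProduct.lid k B _) = _
    rw [hcontract, ← hψe i j]
    refine congrArg (ψ i) ?_
    rw [contractRight, LinearMap.comp_apply, Coalgebra.lTensor_counit_comul,
      LinearEquiv.coe_coe, TensorProduct.rid_tmul, one_smul]
  · have he : ∀ j, e j ∈ Submodule.span k (Set.range fun x : Fin m × Fin m => t x.1 x.2) := by
      intro j
      have := Coalgebra.rTensor_counit_comul (R := k) (e j)
      rw [hcomul_e, map_sum] at this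
      have h2 := congrArg (TensorProduct.lid k B) this
      simp only [LinearMap.rTensor_tmul, map_sum, TensorProduct.lid_tmul, one_smul] at h2
      rw [← h2]
      exact Submodule.sum_mem _ fun i _ => Submodule.smul_mem _ _
        (Submodule.subset_span ⟨(i, j), rfl⟩)
    exact Submodule.span_le.2 (by rintro _ ⟨j, rfl⟩; exact he j) hbe

/-- The main reduction: a linear statement has to be checked only on comatrix entries. -/
theorem comatrix_induction [NeZero n]
    (hcomul : ∀ (i : ZMod n) (b : B), b ∈ 𝒜 i → Coalgebra.comul (R := k) b ∈ tensorDegree 𝒜 i)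
    {P : B → Prop} (hzero : P 0) (hadd : ∀ x y, P x → P y → P (x + y))
    (hsmul : ∀ (r : k) x, P x → P (r • x))
    (ht : ∀ (m : ℕ) (p : Fin m → ZMod n) (t : Fin m → Fin m → B), IsComatrix 𝒜 p t →
      ∀ i j, P (t i j)) (b : B) : P b := by
  refine homogeneous_induction 𝒜 hadd (fun i x hx => ?_) b
  clear b
  obtain ⟨m, p, t, h, hxt⟩ := exists_comatrix hcomul hx
  clear hx
  induction hxt using Submodule.span_induction with
  | mem x h' =>
    obtain ⟨ij, rfl⟩ := h'
    exact ht m p t h _ _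
  | zero => exact hzero
  | add x y _ _ hx hy => exact hadd _ _ hx hy
  | smul r x _ hx => exact hsmul _ _ hx

end Comatrix

/-! ### Braided antimultiplicativity of the antipode and of its inverse -/

section Antipode

variable {k : Type u} [Field k] {n : ℕ} [NeZero n] {q : k}
  {B : Type v} [Ring B] [Algebra k B] [Coalgebra k B] {𝒜 : ZMod n → Submodule k B}
  [GradedAlgebra 𝒜]

theorem comatrix_induction_mem
    (hcomul : ∀ (i : ZMod n) (b : B), b ∈ 𝒜 i → Coalgebra.comul (R := k) b ∈ tensorDegree 𝒜 i)
    {P : ZMod n → B → Prop} (hzero : ∀ i, P i 0)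
    (hadd : ∀ i x y, P i x → P i y → P i (x + y))
    (hsmul : ∀ i (r : k) x, P i x → P i (r • x))
    (ht : ∀ (m : ℕ) (p : Fin m → ZMod n) (t : Fin m → Fin m → B), IsComatrix 𝒜 p t →
      ∀ i j, P (p j - p i) (t i j)) (i : ZMod n) (b : B) (hb : b ∈ 𝒜 i) : P i b := by
  -- A comatrix decomposition of `b` may involve entries of other degrees; the claim about all
  -- components is linear in `b` and can be tested on single entries.
  suffices h : ∀ b : B, ∀ i, P i (GradedAlgebra.proj 𝒜 i b) by
    simpa only [proj_of_mem 𝒜 hb, if_true] using h b i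
  clear hb
  intro b
  refine comatrix_induction (𝒜 := 𝒜) hcomul (P := fun b => ∀ i, P i (GradedAlgebra.proj 𝒜 i b))
    ?_ ?_ ?_ ?_ b
  · intro i; rw [map_zero]; exact hzero i
  · intro x y hx hy i; rw [map_add]; exact hadd _ _ _ (hx i) (hy i)
  · intro r x hx i; rw [map_smul]; exact hsmul _ _ _ (hx i)
  · intro m p t h a c i
    rw [proj_of_mem 𝒜 (h.mem a c)]
    split_ifs with hi
    · rw [hi]; exact ht m p t h a c
    · exact hzero i

variable {S : B →ₗ[k] B}

/-- Comatrices multiply, up to the scalars that come from the braiding. -/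
theorem IsComatrix.mul (hq : q ^ n = 1) (hB : IsAnyonicBraidedGroup q 𝒜 S)
    {I J : Type*} [Fintype I] [DecidableEq I] [Fintype J] [DecidableEq J]
    {p : I → ZMod n} {r : J → ZMod n} {t : I → I → B} {s : J → J → B}
    (ht : IsComatrix 𝒜 p t) (hs : IsComatrix 𝒜 r s) :
    IsComatrix 𝒜 (fun a : I × J => p a.1 + r a.2)
      (fun a b => qpow q ((p b.1 - p a.1) * r a.2) • (t a.1 b.1 * s a.2 b.2)) where
  mem a b := by
    refine Submodule.smul_mem _ _ ?_
    have := SetLike.mul_mem_graded (ht.mem a.1 b.1) (hs.mem a.2 b.2)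
    convert this using 2
    ring
  comul a b := by
    rw [map_smul, hB.comul_mul, ht.comul, hs.comul, TensorProduct.sum_tmul, map_sum,
      Fintype.sum_prod_type, Finset.smul_sum]
    refine Finset.sum_congr rfl fun c _ => ?_
    rw [TensorProduct.tmul_sum, map_sum, Finset.smul_sum]
    refine Finset.sum_congr rfl fun z _ => ?_
    -- The braiding contributes `q ^ ((r z - r x)(p b - p c))`, with `x` for `a.2` and the remaining
    -- indices those of the two factors. The normalising scalar has exactly this defect from being
    -- multiplicative along the path through `(c, z)`.
    rw [braidedMul_tmul q 𝒜 (ht.mem _ _) (hs.mem _ _), TensorProduct.smul_tmul_smul, smul_smul,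
      ← qpow_add hq, ← qpow_add hq]
    congr 2
    ring
  counit a b := by
    rw [map_smul, hB.counit_mul, ht.counit, hs.counit]
    by_cases h1 : a.1 = b.1 <;> by_cases h2 : a.2 = b.2 <;> simp [h1, h2, Prod.ext_iff]

theorem isBilin_mul_left (S : B →ₗ[k] B) : IsBilin k (fun b₁ b₂ : B => S b₁ * b₂) := by
  constructor <;> intros <;> simp [add_mul, mul_add]

theorem isBilin_mul_right (S : B →ₗ[k] B) : IsBilin k (fun b₁ b₂ : B => b₁ * S b₂) := by
  constructor <;> intros <;> simp [add_mul, mul_add]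

theorem IsAnyonicBraidedGroup.sum_antipode_mul (hB : IsAnyonicBraidedGroup q 𝒜 S)
    {I : Type*} [Fintype I] [DecidableEq I] {p : I → ZMod n} {t : I → I → B}
    (ht : IsComatrix 𝒜 p t) (i j : I) : ∑ l, S (t i l) * t l j = if i = j then 1 else 0 := by
  rw [← ht.sweedler_eq_sum (isBilin_mul_left S), hB.antipode_left, ht.counit]
  split_ifs <;> simp

theorem IsAnyonicBraidedGroup.sum_mul_antipode (hB : IsAnyonicBraidedGroup q 𝒜 S)
    {I : Type*} [Fintype I] [DecidableEq I] {p : I → ZMod n} {t : I → I → B}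
    (ht : IsComatrix 𝒜 p t) (i j : I) : ∑ l, t i l * S (t l j) = if i = j then 1 else 0 := by
  rw [← ht.sweedler_eq_sum (isBilin_mul_right S), hB.antipode_right, ht.counit]
  split_ifs <;> simp

theorem IsAnyonicBraidedGroup.antipode_one (hB : IsAnyonicBraidedGroup q 𝒜 S) : S 1 = 1 := by
  have h := hB.antipode_left 1
  rw [(isBilin_mul_left S).sweedler_of_comul (ι := Unit) (x := fun _ => 1) (y := fun _ => 1)
    (by simpa using hB.comul_one), hB.counit_one] at h
  simpa using h

/-- The products of entries of `t` and `s` form a comatrix `w`. Entrywise `S` of `w` is a left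
inverse of the matrix `w`, the suitably scaled reversed product of antipodes is a right inverse, and
the two agree. -/
theorem IsAnyonicBraidedGroup.antipode_comatrix_mul (hq : q ^ n = 1)
    (hB : IsAnyonicBraidedGroup q 𝒜 S)
    {I J : Type*} [Fintype I] [DecidableEq I] [Fintype J] [DecidableEq J]
    {p : I → ZMod n} {r : J → ZMod n} {t : I → I → B} {s : J → J → B}
    (ht : IsComatrix 𝒜 p t) (hs : IsComatrix 𝒜 r s) (a b : I) (x y : J) :
    S (t a b * s x y) = qpow q ((p b - p a) * (r y - r x)) • (S (s x y) * S (t a b)) := by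
  set w : Matrix (I × J) (I × J) B :=
    fun a b => qpow q ((p b.1 - p a.1) * r a.2) • (t a.1 b.1 * s a.2 b.2) with hw
  have hwc := ht.mul hq hB hs
  set L : Matrix (I × J) (I × J) B := fun a b => S (w a b) with hL
  -- The exponent uses the column degree `r b.2`, not the row degree: then the scalar in `w * R`
  -- does not depend on the index `z` of the inner sum, which can be collapsed by the antipode axiom
  -- for `s`.
  set R : Matrix (I × J) (I × J) B :=
    fun a b => qpow q ((p b.1 - p a.1) * r b.2) • (S (s a.2 b.2) * S (t a.1 b.1)) with hR
  have h1 : L * w = 1 := by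
    ext a b
    rw [Matrix.mul_apply, Matrix.one_apply]
    exact hB.sum_antipode_mul hwc a b
  have h2 : w * R = 1 := by
    ext ⟨a, x⟩ ⟨b, y⟩
    rw [Matrix.mul_apply, Matrix.one_apply, Fintype.sum_prod_type]
    have h3 : ∀ c, ∑ z, w (a, x) (c, z) * R (c, z) (b, y) =
        if x = y then qpow q ((p c - p a) * r x + (p b - p c) * r y) • (t a c * S (t c b))
        else 0 := by
      intro c
      have : ∀ z, w (a, x) (c, z) * R (c, z) (b, y) =
          qpow q ((p c - p a) * r x + (p b - p c) * r y) •
            (t a c * (s x z * S (s z y)) * S (t c b)) := by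
        intro z
        simp only [hw, hR]
        rw [smul_mul_smul_comm, ← qpow_add hq]
        simp only [mul_assoc]
      simp only [this, ← Finset.smul_sum, ← Finset.sum_mul, ← Finset.mul_sum,
        hB.sum_mul_antipode hs]
      split_ifs <;> simp
    simp only [h3]
    by_cases hxy : x = y
    · subst hxy
      simp only [if_true, Prod.mk.injEq, and_true]
      have : ∀ c, qpow q ((p c - p a) * r x + (p b - p c) * r x) • (t a c * S (t c b)) =
          qpow q ((p b - p a) * r x) • (t a c * S (t c b)) := by
        intro c; congr 2; ring
      simp only [this, ← Finset.smul_sum, hB.sum_mul_antipode ht]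
      split_ifs with h
      · simp [h]
      · simp
    · simp [hxy]
  have hLR : L = R := left_inv_eq_right_inv h1 h2
  have h4 := congrFun (congrFun hLR (a, x)) (b, y)
  simp only [hL, hR, hw, map_smul] at h4
  have h5 := congrArg (fun v => qpow q (-((p b - p a) * r x)) • v) h4
  simp only [smul_smul, ← qpow_add hq] at h5
  rw [neg_add_cancel, qpow_zero, one_smul] at h5
  rw [h5]
  congr 2
  ring

theorem IsAnyonicBraidedGroup.antipode_mul (hq : q ^ n = 1)
    (hB : IsAnyonicBraidedGroup q 𝒜 S) {i j : ZMod n} {x y : B} (hx : x ∈ 𝒜 i) (hy : y ∈ 𝒜 j) :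
    S (x * y) = qpow q (i * j) • (S y * S x) := by
  refine comatrix_induction_mem (𝒜 := 𝒜) hB.comul_mem
    (P := fun i x => S (x * y) = qpow q (i * j) • (S y * S x)) ?_ ?_ ?_ ?_ i x hx
  · intro i; simp
  · intro i x x' h h'; simp [add_mul, mul_add, h, h']
  · intro i r x h; simp [h, smul_comm r]
  intro m p t ht a b
  refine comatrix_induction_mem (𝒜 := 𝒜) hB.comul_mem
    (P := fun j y => S (t a b * y) = qpow q ((p b - p a) * j) • (S y * S (t a b)))
    ?_ ?_ ?_ ?_ j y hy
  · intro i; simp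
  · intro i x x' h h'; simp [add_mul, mul_add, h, h']
  · intro i r x h; simp [h, smul_comm r]
  intro m' r s hs x y
  exact hB.antipode_comatrix_mul hq ht hs a b x y

theorem proj_comp_of_mem {T : B →ₗ[k] B} (hT : ∀ i, ∀ b ∈ 𝒜 i, T b ∈ 𝒜 i) (i : ZMod n) (b : B) :
    GradedAlgebra.proj 𝒜 i (T b) = T (GradedAlgebra.proj 𝒜 i b) := by
  refine homogeneous_induction 𝒜 (P := fun b => GradedAlgebra.proj 𝒜 i (T b) =
    T (GradedAlgebra.proj 𝒜 i b)) ?_ ?_ b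
  · intro x y hx hy; simp only [map_add, hx, hy]
  · intro j x hx
    rw [proj_of_mem 𝒜 hx, proj_of_mem 𝒜 (hT j x hx)]
    split_ifs <;> simp

variable {T : B →ₗ[k] B}

/-- A linear map that preserves degrees commutes with the homogeneous projections, and so does its
inverse. -/
theorem IsAnyonicBraidedGroup.inverse_mem (hB : IsAnyonicBraidedGroup q 𝒜 S)
    (hST : ∀ b, S (T b) = b) (hTS : ∀ b, T (S b) = b) (i : ZMod n) (b : B) (hb : b ∈ 𝒜 i) :
    T b ∈ 𝒜 i := by
  have h : T b = GradedAlgebra.proj 𝒜 i (T b) := by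
    have h1 := proj_comp_of_mem hB.antipode_mem i (T b)
    rw [hST, proj_of_mem 𝒜 hb, if_pos rfl] at h1
    rw [← hTS (GradedAlgebra.proj 𝒜 i (T b)), ← h1]
  rw [h]
  exact proj_mem 𝒜 i _

theorem IsAnyonicBraidedGroup.inverse_mul (hq : q ^ n = 1) (hB : IsAnyonicBraidedGroup q 𝒜 S)
    (hST : ∀ b, S (T b) = b) (hTS : ∀ b, T (S b) = b) {i j : ZMod n} {x y : B}
    (hx : x ∈ 𝒜 i) (hy : y ∈ 𝒜 j) : T (x * y) = qpow q (-(i * j)) • (T y * T x) := by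
  have h := hB.antipode_mul hq (hB.inverse_mem hST hTS j y hy) (hB.inverse_mem hST hTS i x hx)
  rw [hST, hST] at h
  have h2 := congrArg T h
  rw [hTS, map_smul] at h2
  rw [h2, smul_smul, ← qpow_add hq, mul_comm j i, neg_add_cancel, qpow_zero, one_smul]

theorem IsAnyonicBraidedGroup.inverse_one (hB : IsAnyonicBraidedGroup q 𝒜 S)
    (hTS : ∀ b, T (S b) = b) : T 1 = 1 := by
  rw [← hB.antipode_one, hTS, hB.antipode_one]

/-- Apply `T = S⁻¹` to the antipode axiom: `T` reverses the two factors, at the price of the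
braiding scalar. The same twist reappears in all convolution identities for `T`. -/
theorem IsAnyonicBraidedGroup.sum_inverse_mul (hq : q ^ n = 1)
    (hB : IsAnyonicBraidedGroup q 𝒜 S) (hST : ∀ b, S (T b) = b) (hTS : ∀ b, T (S b) = b)
    {I : Type*} [Fintype I] [DecidableEq I] {p : I → ZMod n} {t : I → I → B}
    (ht : IsComatrix 𝒜 p t) (i j : I) :
    ∑ l, qpow q (-((p l - p i) * (p j - p l))) • (T (t l j) * t i l) =
      if i = j then 1 else 0 := by
  have h := congrArg T (hB.sum_antipode_mul ht i j)
  rw [map_sum] at h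
  simp only [hB.inverse_mul hq hST hTS (hB.antipode_mem _ _ (ht.mem _ _)) (ht.mem _ _), hTS] at h
  rw [h]
  split_ifs <;> simp [hB.inverse_one hTS]

theorem IsAnyonicBraidedGroup.sum_mul_inverse (hq : q ^ n = 1)
    (hB : IsAnyonicBraidedGroup q 𝒜 S) (hST : ∀ b, S (T b) = b) (hTS : ∀ b, T (S b) = b)
    {I : Type*} [Fintype I] [DecidableEq I] {p : I → ZMod n} {t : I → I → B}
    (ht : IsComatrix 𝒜 p t) (i j : I) :
    ∑ l, qpow q (-((p l - p i) * (p j - p l))) • (t l j * T (t i l)) =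
      if i = j then 1 else 0 := by
  have h := congrArg T (hB.sum_mul_antipode ht i j)
  rw [map_sum] at h
  simp only [hB.inverse_mul hq hST hTS (ht.mem _ _) (hB.antipode_mem _ _ (ht.mem _ _)), hTS] at h
  rw [h]
  split_ifs <;> simp [hB.inverse_one hTS]

end Antipode

/-! ### Maps prescribed by degree and convolution of algebra maps -/

section ByDegree

variable {k : Type u} [Field k] {n : ℕ} [NeZero n] {q : k}
  {B : Type v} [Ring B] [Algebra k B] (𝒜 : ZMod n → Submodule k B) [GradedAlgebra 𝒜]

/-- The linear map that is given by `Φ i` in degree `i`. -/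
def byDegree {M : Type*} [AddCommGroup M] [Module k M] (Φ : ZMod n → B →ₗ[k] M) : B →ₗ[k] M :=
  ∑ i, Φ i ∘ₗ GradedAlgebra.proj 𝒜 i

variable {𝒜}

theorem byDegree_of_mem {M : Type*} [AddCommGroup M] [Module k M] (Φ : ZMod n → B →ₗ[k] M)
    {i : ZMod n} {b : B} (hb : b ∈ 𝒜 i) : byDegree 𝒜 Φ b = Φ i b := by
  rw [byDegree, LinearMap.sum_apply, Finset.sum_eq_single i]
  · simp only [LinearMap.comp_apply, proj_of_mem 𝒜 hb, if_true]
  · intro j _ hj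
    simp only [LinearMap.comp_apply, proj_of_mem 𝒜 hb, if_neg hj, map_zero]
  · simp

/-- The algebra homomorphism that is given by `Φ i` in degree `i`. -/
def byDegreeHom {X : Type*} [Ring X] [Algebra k X] (Φ : ZMod n → B →ₗ[k] X) (h1 : Φ 0 1 = 1)
    (hmul : ∀ i j, ∀ x ∈ 𝒜 i, ∀ y ∈ 𝒜 j, Φ (i + j) (x * y) = Φ i x * Φ j y) : B →ₐ[k] X :=
  AlgHom.ofLinearMap (byDegree 𝒜 Φ)
    (by rw [byDegree_of_mem Φ (SetLike.one_mem_graded 𝒜), h1])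
    (by
      intro x y
      refine homogeneous_induction 𝒜 (P := fun x => byDegree 𝒜 Φ (x * y) =
        byDegree 𝒜 Φ x * byDegree 𝒜 Φ y) ?_ (fun i x hx => ?_) x
      · intro x x' h h'; simp only [add_mul, map_add, h, h']
      refine homogeneous_induction 𝒜 (P := fun y => byDegree 𝒜 Φ (x * y) =
        byDegree 𝒜 Φ x * byDegree 𝒜 Φ y) ?_ (fun j y hy => ?_) y
      · intro x x' h h'; simp only [mul_add, map_add, h, h']
      rw [byDegree_of_mem Φ (SetLike.mul_mem_graded hx hy), byDegree_of_mem Φ hx,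
        byDegree_of_mem Φ hy, hmul i j x hx y hy])

variable [Coalgebra k B] {S : B →ₗ[k] B}

/-- The convolution product of two algebra homomorphisms that commute up to the braiding. -/
def convHom (hB : IsAnyonicBraidedGroup q 𝒜 S) {X : Type*} [Ring X] [Algebra k X]
    (f f' : B →ₐ[k] X)
    (h : ∀ i j, ∀ x ∈ 𝒜 i, ∀ y ∈ 𝒜 j, f' x * f y = qpow q (i * j) • (f y * f' x)) : B →ₐ[k] X :=
  AlgHom.ofLinearMap
    (LinearMap.mul' k X ∘ₗ TensorProduct.map f.toLinearMap f'.toLinearMap ∘ₗ Coalgebra.comul)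
    (by simp [hB.comul_one])
    (by
      intro x y
      refine comatrix_induction (𝒜 := 𝒜) hB.comul_mem (P := fun x =>
        (LinearMap.mul' k X ∘ₗ TensorProduct.map f.toLinearMap f'.toLinearMap ∘ₗ
          Coalgebra.comul) (x * y) = (LinearMap.mul' k X ∘ₗ TensorProduct.map f.toLinearMap
          f'.toLinearMap ∘ₗ Coalgebra.comul) x * (LinearMap.mul' k X ∘ₗ
          TensorProduct.map f.toLinearMap f'.toLinearMap ∘ₗ Coalgebra.comul) y) ?_ ?_ ?_ ?_ x
      · simp only [zero_mul, map_zero]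
      · intro x x' h h'; simp only [add_mul, map_add, h, h']
      · intro r x h; simp only [smul_mul_assoc, map_smul, h]
      intro m p t ht a b
      refine comatrix_induction (𝒜 := 𝒜) hB.comul_mem (P := fun y =>
        (LinearMap.mul' k X ∘ₗ TensorProduct.map f.toLinearMap f'.toLinearMap ∘ₗ
          Coalgebra.comul) (t a b * y) = (LinearMap.mul' k X ∘ₗ TensorProduct.map f.toLinearMap
          f'.toLinearMap ∘ₗ Coalgebra.comul) (t a b) * (LinearMap.mul' k X ∘ₗ
          TensorProduct.map f.toLinearMap f'.toLinearMap ∘ₗ Coalgebra.comul) y) ?_ ?_ ?_ ?_ y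
      · simp only [mul_zero, map_zero]
      · intro x x' h h'; simp only [mul_add, map_add, h, h']
      · intro r x h; simp only [mul_smul_comm, map_smul, h]
      intro m' r s hs x y
      simp only [LinearMap.comp_apply, hB.comul_mul, ht.comul, hs.comul, TensorProduct.sum_tmul,
        TensorProduct.tmul_sum, map_sum, Finset.sum_mul_sum]
      rw [Finset.sum_comm]
      refine Finset.sum_congr rfl fun c _ => ?_
      refine Finset.sum_congr rfl fun z _ => ?_
      rw [braidedMul_tmul q 𝒜 (ht.mem _ _) (hs.mem _ _)]
      simp only [map_smul, TensorProduct.map_tmul, LinearMap.mul'_apply, AlgHom.toLinearMap_apply,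
        map_mul]
      -- The only reordering needed is of the two middle factors; the scalar from the hypothesis is
      -- the one that the braided product puts into `Δ (xy)`.
      rw [mul_assoc (f (t a c)) (f' (t c b)), ← mul_assoc (f' (t c b)),
        h _ _ _ (ht.mem c b) _ (hs.mem x z), mul_comm (r z - r x)]
      simp only [smul_mul_assoc, mul_smul_comm, mul_assoc])

theorem convHom_comatrix (hB : IsAnyonicBraidedGroup q 𝒜 S)
    {X : Type*} [Ring X] [Algebra k X]
    (f f' : B →ₐ[k] X)
    (h : ∀ i j, ∀ x ∈ 𝒜 i, ∀ y ∈ 𝒜 j, f' x * f y = qpow q (i * j) • (f y * f' x))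
    {I : Type*} [Fintype I] [DecidableEq I] {p : I → ZMod n} {t : I → I → B}
    (ht : IsComatrix 𝒜 p t) (i j : I) :
    convHom hB f f' h (t i j) = ∑ l, f (t i l) * f' (t l j) := by
  simp [convHom, ht.comul]

end ByDegree

/-! ### The duality pairing and its twisted convolution inverse -/

section Pairing

variable {k : Type u} [Field k] {n : ℕ} [NeZero n] {q : k}
  {B : Type v} [Ring B] [Algebra k B] [Coalgebra k B] {𝒜 : ZMod n → Submodule k B}
  [GradedAlgebra 𝒜] {SB : B →ₗ[k] B}
  {C : Type w} [Ring C] [Algebra k C] [Coalgebra k C] {𝒞 : ZMod n → Submodule k C}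
  [GradedAlgebra 𝒞] {SC : C →ₗ[k] C} {ev : C →ₗ[k] B →ₗ[k] k}

theorem isBilin_ev_mul (ev : C →ₗ[k] B →ₗ[k] k) (c d : C) :
    IsBilin k (fun b₁ b₂ => ev c b₁ * ev d b₂) := by
  constructor <;> intros <;> simp [add_mul, mul_add, mul_assoc, mul_left_comm]

variable {I : Type*} [Fintype I] [DecidableEq I] {d : I → ZMod n} {t : I → I → C}
  {J : Type*} [Fintype J] [DecidableEq J] {p : J → ZMod n} {s : J → J → B}
  {L : Type*} [Fintype L] [DecidableEq L] {r : L → ZMod n} {v : L → L → B}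

theorem IsDualPairing.mul_comatrix (hev : IsDualPairing 𝒜 𝒞 ev) (hs : IsComatrix 𝒜 p s)
    (x y : C) (a b : J) : ev (y * x) (s a b) = ∑ c, ev x (s a c) * ev y (s c b) := by
  rw [hev.ev_mul_left, hs.sweedler_eq_sum (isBilin_ev_mul ev x y)]

theorem IsDualPairing.comatrix_mul (hev : IsDualPairing 𝒜 𝒞 ev) (ht : IsComatrix 𝒞 d t)
    (x y : B) (i j : I) : ev (t i j) (y * x) = ∑ l, ev (t i l) x * ev (t l j) y := by
  rw [hev.ev_mul_right]
  exact ht.sweedler_eq_sum (isBilin_ev_mul ev.flip x y) i j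

/-- Pairing the identity for `T` in `C` with a comatrix entry of `B` shows that `ev (T c) b` is an
inverse of `ev c b` for a twisted matrix product on pairs of indices. -/
theorem IsDualPairing.sum_inverse (hq : q ^ n = 1) (hC : IsAnyonicBraidedGroup q 𝒞 SC)
    (hev : IsDualPairing 𝒜 𝒞 ev) {T : C →ₗ[k] C} (hST : ∀ b, SC (T b) = b)
    (hTS : ∀ b, T (SC b) = b) (ht : IsComatrix 𝒞 d t) (hs : IsComatrix 𝒜 p s)
    (i j : I) (a b : J) :
    ∑ l, ∑ c, qpow q (-((d l - d i) * (d j - d l))) *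
      (ev (T (t i l)) (s a c) * ev (t l j) (s c b)) =
      if i = j ∧ a = b then 1 else 0 := by
  have h := congrArg (fun x => ev x (s a b)) (hC.sum_mul_inverse hq hST hTS ht i j)
  simp only [map_sum, map_smul, LinearMap.sum_apply, LinearMap.smul_apply,
    hev.mul_comatrix hs, smul_eq_mul, Finset.mul_sum] at h
  rw [h]
  by_cases hij : i = j <;> simp [hij, hev.ev_one_left, hs.counit]

theorem IsDualPairing.sum_inverse' (hq : q ^ n = 1) (hC : IsAnyonicBraidedGroup q 𝒞 SC)
    (hev : IsDualPairing 𝒜 𝒞 ev) {T : C →ₗ[k] C} (hST : ∀ b, SC (T b) = b)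
    (hTS : ∀ b, T (SC b) = b) (ht : IsComatrix 𝒞 d t) (hs : IsComatrix 𝒜 p s)
    (i j : I) (a b : J) :
    ∑ l, ∑ c, qpow q (-((d l - d i) * (d j - d l))) *
      (ev (t i l) (s a c) * ev (T (t l j)) (s c b)) =
      if i = j ∧ a = b then 1 else 0 := by
  have h := congrArg (fun x => ev x (s a b)) (hC.sum_inverse_mul hq hST hTS ht i j)
  simp only [map_sum, map_smul, LinearMap.sum_apply, LinearMap.smul_apply,
    hev.mul_comatrix hs, smul_eq_mul, Finset.mul_sum] at h
  rw [h]
  by_cases hij : i = j <;> simp [hij, hev.ev_one_left, hs.counit]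

/-- The twist is a coboundary: rescaling the entries by `q ^ ((d j - d i) d j)` turns the twisted
product into the ordinary product of matrices indexed by `I × J`, where a left inverse and a right
inverse coincide. -/
theorem unique_inverse (hq : q ^ n = 1) {E F G : I → I → J → J → k}
    (h1 : ∀ i j a b, ∑ l, ∑ c, qpow q (-((d l - d i) * (d j - d l))) *
      (E i l a c * F l j c b) = if i = j ∧ a = b then 1 else 0)
    (h2 : ∀ i j a b, ∑ l, ∑ c, qpow q (-((d l - d i) * (d j - d l))) *
      (F i l a c * G l j c b) = if i = j ∧ a = b then 1 else 0) (i j : I) (a b : J) :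
    E i j a b = G i j a b := by
  let W : (I → I → J → J → k) → Matrix (I × J) (I × J) k :=
    fun E x y => qpow q ((d y.1 - d x.1) * d y.1) * E x.1 y.1 x.2 y.2
  have key : ∀ {E F : I → I → J → J → k}, (∀ i j a b, ∑ l, ∑ c,
      qpow q (-((d l - d i) * (d j - d l))) * (E i l a c * F l j c b) =
      if i = j ∧ a = b then 1 else 0) → W E * W F = 1 := by
    intro E F h
    ext ⟨i, a⟩ ⟨j, b⟩
    have h2 : ∀ l c, W E (i, a) (l, c) * W F (l, c) (j, b) = qpow q ((d j - d i) * d j) *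
        (qpow q (-((d l - d i) * (d j - d l))) * (E i l a c * F l j c b)) := by
      intro l c
      have : qpow q ((d l - d i) * d l) * qpow q ((d j - d l) * d j) =
          qpow q ((d j - d i) * d j) * qpow q (-((d l - d i) * (d j - d l))) := by
        rw [← qpow_add hq, ← qpow_add hq]
        congr 1
        ring
      simp only [W]
      rw [mul_mul_mul_comm, this, mul_assoc]
    rw [Matrix.mul_apply, Matrix.one_apply, Fintype.sum_prod_type]
    have h4 : ∑ l, ∑ c, W E (i, a) (l, c) * W F (l, c) (j, b) = qpow q ((d j - d i) * d j) *
        ∑ l, ∑ c, qpow q (-((d l - d i) * (d j - d l))) * (E i l a c * F l j c b) := by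
      simp only [h2, Finset.mul_sum]
    rw [h4, h]
    simp only [Prod.mk.injEq]
    split_ifs with h3
    · simp [h3.1]
    · simp
  have hEG : W E = W G := left_inv_eq_right_inv (key h1) (key h2)
  have h := congrFun (congrFun hEG (i, a)) (j, b)
  exact mul_left_cancel₀ (qpow_ne_zero hq _) h

theorem IsDualPairing.ev_eq_zero (hev : IsDualPairing 𝒜 𝒞 ev) (ht : IsComatrix 𝒞 d t)
    (hs : IsComatrix 𝒜 p s) {i j : I} {a b : J} (h : (d j - d i) + (p b - p a) ≠ 0) :
    ev (t i j) (s a b) = 0 :=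
  hev.ev_of_mem _ _ _ _ (ht.mem i j) (hs.mem a b) h

theorem sum_reorder {R K₁ K₂ K₃ K₄ K₅ : Type*} [AddCommMonoid R] [Fintype K₁] [Fintype K₂]
    [Fintype K₃] [Fintype K₄] [Fintype K₅] (f : K₁ → K₂ → K₃ → K₄ → K₅ → R) :
    ∑ a, ∑ b, ∑ c, ∑ d, ∑ e, f a b c d e = ∑ d, ∑ e, ∑ c, ∑ a, ∑ b, f a b c d e := by
  simp only [← Fintype.sum_prod_type' (f := fun _ _ => _)]
  exact Fintype.sum_equiv ⟨fun x => (x.2.2.2.1, x.2.2.2.2, x.2.2.1, x.1, x.2.1),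
    fun x => (x.2.2.2.1, x.2.2.2.2, x.2.2.1, x.1, x.2.1), fun _ => rfl, fun _ => rfl⟩ _ _
    fun _ => rfl

/-- This is braided anticomultiplicativity of `T`, seen through the pairing. Both sides, normalised
to the comatrix of products in `B`, are twisted inverses of `ev (t i j) (s a b * v x y)`: the left
side by `sum_inverse`, the right side by cancelling the factors for `s` and for `v` one after the
other. -/
theorem IsDualPairing.inverse_comatrix_mul (hq : q ^ n = 1)
    (hB : IsAnyonicBraidedGroup q 𝒜 SB) (hC : IsAnyonicBraidedGroup q 𝒞 SC)
    (hev : IsDualPairing 𝒜 𝒞 ev) {T : C →ₗ[k] C} (hST : ∀ b, SC (T b) = b)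
    (hTS : ∀ b, T (SC b) = b) (ht : IsComatrix 𝒞 d t) (hs : IsComatrix 𝒜 p s)
    (hv : IsComatrix 𝒜 r v) (i j : I) (a b : J) (x y : L) :
    ev (T (t i j)) (s a b * v x y) = ∑ l, qpow q (-((d l - d i) * (d j - d l))) *
      (ev (T (t l j)) (v x y) * ev (T (t i l)) (s a b)) := by
  have hw := hs.mul hq hB hv
  have hT := hC.inverse_mem hST hTS
  have h := unique_inverse (d := d) hq (E := fun i j (α β : J × L) => ev (T (t i j))
      (qpow q ((p β.1 - p α.1) * r α.2) • (s α.1 β.1 * v α.2 β.2)))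
    (F := fun i j (α β : J × L) => ev (t i j)
      (qpow q ((p β.1 - p α.1) * r α.2) • (s α.1 β.1 * v α.2 β.2)))
    (G := fun i j (α β : J × L) => qpow q ((p β.1 - p α.1) * r α.2) *
      ∑ l, qpow q (-((d l - d i) * (d j - d l))) *
        (ev (T (t l j)) (v α.2 β.2) * ev (T (t i l)) (s α.1 β.1)))
    (hev.sum_inverse hq hC hST hTS ht hw) ?_ i j (a, x) (b, y)
  · simp only [map_smul, smul_eq_mul] at h
    exact mul_left_cancel₀ (qpow_ne_zero hq _) h
  clear i j a b x y
  rintro i j ⟨a, x⟩ ⟨b, y⟩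
  have key : ∀ (l : I) (c : J) (z : L) (m m' : I),
      qpow q (-((d l - d i) * (d j - d l))) * (qpow q ((p c - p a) * r x) *
        (ev (t i m) (v x z) * ev (t m l) (s a c)) * (qpow q ((p b - p c) * r z) *
        (qpow q (-((d m' - d l) * (d j - d m'))) *
          (ev (T (t m' j)) (v z y) * ev (T (t l m')) (s c b))))) =
      qpow q (-(d m - d i) * (d j - d m) - (d m' - d m) * r x + (d m' - d m) * (d m - d i) -
        (d m' - d m) * (d j - d m')) * (ev (t i m) (v x z) * ev (T (t m' j)) (v z y)) *
      (qpow q (-((d l - d m) * (d m' - d l))) * (ev (t m l) (s a c) * ev (T (t l m')) (s c b))) := by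
    intro l c z m m'
    -- The exponents agree only where the pairings can be nonzero. There the degrees in `B` are
    -- determined by those in `C`; elsewhere both sides vanish.
    by_cases h1 : (d m - d i) + (r z - r x) = 0
    swap; · simp [hev.ev_eq_zero ht hv h1]
    by_cases h2 : (d l - d m) + (p c - p a) = 0
    swap; · simp [hev.ev_eq_zero ht hs h2]
    by_cases h3 : (d m' - d l) + (p b - p c) = 0
    swap; · simp [hev.ev_of_mem _ _ _ _ (hT _ _ (ht.mem l m')) (hs.mem c b) h3]
    have hpow : qpow q (-((d l - d i) * (d j - d l))) * qpow q ((p c - p a) * r x) *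
        qpow q ((p b - p c) * r z) * qpow q (-((d m' - d l) * (d j - d m'))) =
        qpow q (-(d m - d i) * (d j - d m) - (d m' - d m) * r x + (d m' - d m) * (d m - d i) -
        (d m' - d m) * (d j - d m')) * qpow q (-((d l - d m) * (d m' - d l))) := by
      simp only [← qpow_add hq]
      congr 1
      have e1 : r z = r x - (d m - d i) := by linear_combination h1
      have e2 : p c - p a = -(d l - d m) := by linear_combination h2
      have e3 : p b - p c = -(d m' - d l) := by linear_combination h3
      rw [e1, e2, e3]
      ring
    linear_combination (ev (t i m) (v x z) * ev (t m l) (s a c) *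
      (ev (T (t m' j)) (v z y) * ev (T (t l m')) (s c b))) * hpow
  simp only [map_smul, smul_eq_mul, hev.comatrix_mul ht, Fintype.sum_prod_type, Finset.mul_sum,
    Finset.sum_mul, key]
  -- The sums over `l` and `c` become innermost and collapse by the inverse property for `s`; what
  -- then remains is the same property for `v`.
  rw [sum_reorder]
  have inner : ∀ (m m' : I) (X : k), ∑ l, ∑ c, X * (qpow q (-((d l - d m) * (d m' - d l))) *
      (ev (t m l) (s a c) * ev (T (t l m')) (s c b))) = if m = m' ∧ a = b then X else 0 := by
    intro m m' X
    simp only [← Finset.mul_sum (a := X)]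
    rw [hev.sum_inverse' hq hC hST hTS ht hs]
    split_ifs <;> simp
  simp only [inner]
  by_cases hab : a = b
  swap; · simp [hab]
  subst hab
  simp only [and_true, Prod.mk.injEq, true_and]
  rw [← hev.sum_inverse' hq hC hST hTS ht hv i j x y]
  refine Finset.sum_congr rfl fun m _ => ?_
  rw [Finset.sum_comm]
  refine Finset.sum_congr rfl fun z _ => ?_
  rw [Finset.sum_ite_eq' Finset.univ m, if_pos (Finset.mem_univ _)]
  congr 2
  ring

theorem IsDualPairing.inverse_mul_comatrix (hq : q ^ n = 1)
    (hC : IsAnyonicBraidedGroup q 𝒞 SC)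
    (hev : IsDualPairing 𝒜 𝒞 ev) {T : C →ₗ[k] C} (hST : ∀ b, SC (T b) = b)
    (hTS : ∀ b, T (SC b) = b) (hs : IsComatrix 𝒜 p s) {i j : ZMod n} {x y : C}
    (hx : x ∈ 𝒞 i) (hy : y ∈ 𝒞 j) (a b : J) :
    ev (T (x * y)) (s a b) =
      ∑ c, qpow q (-(i * j)) * (ev (T x) (s a c) * ev (T y) (s c b)) := by
  rw [hC.inverse_mul hq hST hTS hx hy, map_smul, LinearMap.smul_apply, hev.mul_comatrix hs,
    smul_eq_mul, Finset.mul_sum]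

end Pairing

/-! ### Operators on `C`: degree scaling and the two coregular actions -/

section Operators

variable {k : Type u} [Field k] {n : ℕ} [NeZero n] {q : k}
  {B : Type v} [Ring B] [Algebra k B] [Coalgebra k B] {𝒜 : ZMod n → Submodule k B}
  [GradedAlgebra 𝒜] {SB : B →ₗ[k] B}
  {C : Type w} [Ring C] [Algebra k C] [Coalgebra k C] {𝒞 : ZMod n → Submodule k C}
  [GradedAlgebra 𝒞] {SC : C →ₗ[k] C} {ev : C →ₗ[k] B →ₗ[k] k}

theorem IsAnyonicBraidedGroup.linearMap_ext (hC : IsAnyonicBraidedGroup q 𝒞 SC) {M : Type*}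
    [AddCommGroup M] [Module k M] {f f' : C →ₗ[k] M}
    (h : ∀ (m : ℕ) (d : Fin m → ZMod n) (t : Fin m → Fin m → C), IsComatrix 𝒞 d t →
      ∀ i j, f (t i j) = f' (t i j)) : f = f' := by
  ext c
  refine comatrix_induction (𝒜 := 𝒞) hC.comul_mem (P := fun c => f c = f' c) ?_ ?_ ?_ h c
  · simp
  · intro x y hx hy; simp [hx, hy]
  · intro r x hx; simp [hx]

variable (q 𝒞) in
/-- The operator that multiplies elements of degree `i` by `q ^ (a i)`. -/
def degreeScale (a : ZMod n) : Module.End k C :=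
  byDegree 𝒞 fun i => qpow q (a * i) • LinearMap.id

theorem degreeScale_of_mem (a : ZMod n) {i : ZMod n} {c : C} (hc : c ∈ 𝒞 i) :
    degreeScale q 𝒞 a c = qpow q (a * i) • c := by
  rw [degreeScale, byDegree_of_mem _ hc, LinearMap.smul_apply, LinearMap.id_apply]

theorem degreeScale_add (hq : q ^ n = 1) (a b : ZMod n) :
    degreeScale q 𝒞 (a + b) = degreeScale q 𝒞 a * degreeScale q 𝒞 b := by
  ext c
  refine homogeneous_induction 𝒞 (P := fun c => degreeScale q 𝒞 (a + b) c =
    (degreeScale q 𝒞 a * degreeScale q 𝒞 b) c) ?_ (fun i x hx => ?_) c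
  · intro x y hx hy; rw [map_add, map_add, hx, hy]
  · rw [Module.End.mul_apply, degreeScale_of_mem b hx, map_smul, degreeScale_of_mem a hx,
      degreeScale_of_mem _ hx, smul_smul, ← qpow_add hq]
    congr 2
    ring

@[simp] theorem degreeScale_zero : degreeScale q 𝒞 (0 : ZMod n) = 1 := by
  ext c
  refine homogeneous_induction 𝒞 (P := fun c => degreeScale q 𝒞 0 c = (1 : Module.End k C) c)
    ?_ (fun i x hx => ?_) c
  · intro x y hx hy; rw [map_add, map_add, hx, hy]
  · simp [degreeScale_of_mem _ hx]

/-- `c ↦ f(c₍₁₎) c₍₂₎` -/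
def leftCoaction : (C →ₗ[k] k) →ₗ[k] Module.End k C where
  toFun f := (TensorProduct.lid k C).toLinearMap ∘ₗ LinearMap.rTensor C f ∘ₗ Coalgebra.comul
  map_add' f f' := by ext; simp [LinearMap.rTensor_add]
  map_smul' r f := by ext; simp [LinearMap.rTensor_smul]

/-- `c ↦ f(c₍₂₎) c₍₁₎` -/
def rightCoaction : (C →ₗ[k] k) →ₗ[k] Module.End k C where
  toFun f := (TensorProduct.rid k C).toLinearMap ∘ₗ LinearMap.lTensor C f ∘ₗ Coalgebra.comul
  map_add' f f' := by ext; simp [LinearMap.lTensor_add]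
  map_smul' r f := by ext; simp [LinearMap.lTensor_smul]

section

variable {I : Type*} [Fintype I] [DecidableEq I] {d : I → ZMod n} {t : I → I → C}

theorem leftCoaction_comatrix (f : C →ₗ[k] k) (ht : IsComatrix 𝒞 d t) (i j : I) :
    leftCoaction f (t i j) = ∑ l, f (t i l) • t l j := by
  simp [leftCoaction, ht.comul]

theorem rightCoaction_comatrix (f : C →ₗ[k] k) (ht : IsComatrix 𝒞 d t) (i j : I) :
    rightCoaction f (t i j) = ∑ l, f (t l j) • t i l := by
  simp [rightCoaction, ht.comul]

end

theorem leftCoaction_one (hC : IsAnyonicBraidedGroup q 𝒞 SC) (f : C →ₗ[k] k) :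
    leftCoaction f (1 : C) = f 1 • 1 := by
  simp [leftCoaction, hC.comul_one]

theorem rightCoaction_one (hC : IsAnyonicBraidedGroup q 𝒞 SC) (f : C →ₗ[k] k) :
    rightCoaction f (1 : C) = f 1 • 1 := by
  simp [rightCoaction, hC.comul_one]

theorem leftCoaction_counit : leftCoaction (Coalgebra.counit : C →ₗ[k] k) = 1 := by
  ext c
  simp [leftCoaction, Coalgebra.rTensor_counit_comul]

theorem rightCoaction_counit : rightCoaction (Coalgebra.counit : C →ₗ[k] k) = 1 := by
  ext c
  simp [rightCoaction, Coalgebra.lTensor_counit_comul]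

/-- Since `ev c (b a)` pairs `a` with `c₍₁₎`, contraction of the left leg is multiplicative in `B`
in the given order, with no scalar. -/
theorem IsDualPairing.leftCoaction_mul (hC : IsAnyonicBraidedGroup q 𝒞 SC)
    (hev : IsDualPairing 𝒜 𝒞 ev) (x y : B) :
    leftCoaction (ev.flip (x * y)) = leftCoaction (ev.flip x) * leftCoaction (ev.flip y) := by
  refine hC.linearMap_ext fun m d t ht i j => ?_
  simp only [Module.End.mul_apply, leftCoaction_comatrix _ ht, map_sum, map_smul,
    LinearMap.flip_apply, hev.comatrix_mul ht, Finset.sum_smul, Finset.smul_sum, smul_smul]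
  rw [Finset.sum_comm]

/-- Contraction with an element of degree `i` raises degree in `C` by `i`, because the contracted
leg must have degree `-i`. -/
theorem IsDualPairing.degreeScale_mul_leftCoaction (hq : q ^ n = 1)
    (hC : IsAnyonicBraidedGroup q 𝒞 SC) (hev : IsDualPairing 𝒜 𝒞 ev) {i : ZMod n} {x : B}
    (hx : x ∈ 𝒜 i) (a : ZMod n) : degreeScale q 𝒞 a * leftCoaction (ev.flip x) =
      qpow q (a * i) • (leftCoaction (ev.flip x) * degreeScale q 𝒞 a) := by
  refine hC.linearMap_ext fun m d t ht e j => ?_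
  simp only [LinearMap.smul_apply, Module.End.mul_apply, leftCoaction_comatrix _ ht, map_sum,
    map_smul, degreeScale_of_mem a (ht.mem _ _), Finset.smul_sum, LinearMap.flip_apply, smul_smul]
  refine Finset.sum_congr rfl fun l _ => ?_
  by_cases h : (d l - d e) + i = 0
  · rw [← mul_assoc, ← qpow_add hq, mul_comm]
    congr 3
    linear_combination (-a) * h
  · simp [hev.ev_of_mem _ _ _ _ (ht.mem e l) hx h]

variable {T : C →ₗ[k] C}

theorem IsDualPairing.degreeScale_mul_rightCoaction (hq : q ^ n = 1)
    (hC : IsAnyonicBraidedGroup q 𝒞 SC) (hev : IsDualPairing 𝒜 𝒞 ev)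
    (hT : ∀ i, ∀ c ∈ 𝒞 i, T c ∈ 𝒞 i) {i : ZMod n} {x : B}
    (hx : x ∈ 𝒜 i) (a : ZMod n) : degreeScale q 𝒞 a * rightCoaction ((ev ∘ₗ T).flip x) =
      qpow q (a * i) • (rightCoaction ((ev ∘ₗ T).flip x) * degreeScale q 𝒞 a) := by
  refine hC.linearMap_ext fun m d t ht e j => ?_
  simp only [LinearMap.smul_apply, Module.End.mul_apply, rightCoaction_comatrix _ ht, map_sum,
    map_smul, degreeScale_of_mem a (ht.mem _ _), Finset.smul_sum, LinearMap.flip_apply, smul_smul,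
    LinearMap.comp_apply]
  refine Finset.sum_congr rfl fun l _ => ?_
  by_cases h : (d j - d l) + i = 0
  · rw [← mul_assoc, ← qpow_add hq, mul_comm]
    congr 3
    linear_combination (-a) * h
  · simp [hev.ev_of_mem _ _ _ _ (hT _ _ (ht.mem l j)) hx h]

/-- Contractions of the two outer legs commute by coassociativity. -/
theorem rightCoaction_mul_leftCoaction (hC : IsAnyonicBraidedGroup q 𝒞 SC) (f f' : C →ₗ[k] k) :
    rightCoaction f * leftCoaction f' = leftCoaction f' * rightCoaction f := by
  refine hC.linearMap_ext fun m d t ht i j => ?_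
  simp only [Module.End.mul_apply, leftCoaction_comatrix _ ht, rightCoaction_comatrix _ ht,
    map_sum, map_smul, Finset.smul_sum]
  rw [Finset.sum_comm]
  simp only [smul_comm (f _)]

theorem IsDualPairing.inverse_ev_mul (hq : q ^ n = 1)
    (hB : IsAnyonicBraidedGroup q 𝒜 SB) (hC : IsAnyonicBraidedGroup q 𝒞 SC)
    (hev : IsDualPairing 𝒜 𝒞 ev) (hST : ∀ b, SC (T b) = b) (hTS : ∀ b, T (SC b) = b)
    {m : ℕ} {d : Fin m → ZMod n} {t : Fin m → Fin m → C} (ht : IsComatrix 𝒞 d t) (i j : Fin m)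
    (x y : B) :
    ev (T (t i j)) (x * y) = ∑ l, qpow q (-((d l - d i) * (d j - d l))) *
      (ev (T (t l j)) y * ev (T (t i l)) x) := by
  refine comatrix_induction (𝒜 := 𝒜) hB.comul_mem (P := fun x => ev (T (t i j)) (x * y) =
    ∑ l, qpow q (-((d l - d i) * (d j - d l))) * (ev (T (t l j)) y * ev (T (t i l)) x))
    ?_ ?_ ?_ ?_ x
  · simp
  · intro x x' h h'; simp only [add_mul, map_add, h, h', mul_add, Finset.sum_add_distrib]
  · intro r x h
    simp only [smul_mul_assoc, map_smul, h, smul_eq_mul, Finset.mul_sum]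
    exact Finset.sum_congr rfl fun _ _ => by ring
  intro m p s hs a b
  refine comatrix_induction (𝒜 := 𝒜) hB.comul_mem (P := fun y => ev (T (t i j)) (s a b * y) =
    ∑ l, qpow q (-((d l - d i) * (d j - d l))) * (ev (T (t l j)) y * ev (T (t i l)) (s a b)))
    ?_ ?_ ?_ ?_ y
  · simp
  · intro x x' h h'; simp only [mul_add, map_add, h, h', add_mul, Finset.sum_add_distrib]
  · intro r x h
    simp only [mul_smul_comm, map_smul, h, smul_eq_mul, Finset.mul_sum]
    exact Finset.sum_congr rfl fun _ _ => by ring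
  intro m' r v hv a' b'
  exact hev.inverse_comatrix_mul hq hB hC hST hTS ht hs hv i j a b a' b'

/-- Contraction of the right leg through `T` is multiplicative only up to the twist in
`inverse_ev_mul`; composing with the scaling by the degree of the element absorbs this twist. -/
theorem IsDualPairing.rightCoaction_mul (hq : q ^ n = 1)
    (hB : IsAnyonicBraidedGroup q 𝒜 SB) (hC : IsAnyonicBraidedGroup q 𝒞 SC)
    (hev : IsDualPairing 𝒜 𝒞 ev) (hST : ∀ b, SC (T b) = b) (hTS : ∀ b, T (SC b) = b)
    {i j : ZMod n} {x y : B} (hx : x ∈ 𝒜 i) (hy : y ∈ 𝒜 j) :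
    degreeScale q 𝒞 (i + j) * rightCoaction ((ev ∘ₗ T).flip (x * y)) =
      (degreeScale q 𝒞 i * rightCoaction ((ev ∘ₗ T).flip x)) *
        (degreeScale q 𝒞 j * rightCoaction ((ev ∘ₗ T).flip y)) := by
  have hT := hC.inverse_mem hST hTS
  refine hC.linearMap_ext fun m d t ht a b => ?_
  simp only [Module.End.mul_apply, rightCoaction_comatrix _ ht, map_sum, map_smul,
    degreeScale_of_mem _ (ht.mem _ _), LinearMap.flip_apply, LinearMap.comp_apply,
    hev.inverse_ev_mul hq hB hC hST hTS ht, Finset.sum_smul, Finset.smul_sum, smul_smul]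
  rw [Finset.sum_comm]
  refine Finset.sum_congr rfl fun l _ => Finset.sum_congr rfl fun r _ => ?_
  by_cases h1 : (d b - d l) + j = 0
  swap; · simp [hev.ev_of_mem _ _ _ _ (hT _ _ (ht.mem l b)) hy h1]
  by_cases h2 : (d l - d r) + i = 0
  swap; · simp [hev.ev_of_mem _ _ _ _ (hT _ _ (ht.mem r l)) hx h2]
  congr 1
  have : qpow q (-((d l - d r) * (d b - d l))) * qpow q ((i + j) * (d r - d a)) =
      qpow q (j * (d l - d a)) * qpow q (i * (d r - d a)) := by
    rw [← qpow_add hq, ← qpow_add hq]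
    congr 1
    linear_combination (-(d l - d r)) * h1
  linear_combination (ev (T (t l b)) y * ev (T (t r l)) x) * this

end Operators

/-! ### Representations of the cross relations and their universal property -/

section CrossRep

variable {k : Type u} [Field k] {n : ℕ} [NeZero n] {q : k}
  {B : Type v} [Ring B] [Algebra k B] [Coalgebra k B] {𝒜 : ZMod n → Submodule k B}
  [GradedAlgebra 𝒜] {SB : B →ₗ[k] B}
  {C : Type w} [Ring C] [Algebra k C] [Coalgebra k C] {𝒞 : ZMod n → Submodule k C}
  [GradedAlgebra 𝒞] {SC : C →ₗ[k] C} {ev : C →ₗ[k] B →ₗ[k] k}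

/-- Homomorphisms from `Cᵒᵖ`, the anyon-generating algebra and `B` to an algebra that satisfy the
cross relations of the double-bosonisation. -/
structure IsCrossRep (q : k) (𝒜 : ZMod n → Submodule k B) (𝒞 : ZMod n → Submodule k C)
    (ev : C →ₗ[k] B →ₗ[k] k) {X : Type*} [Ring X] [Algebra k X]
    (fC : Cᵐᵒᵖ →ₐ[k] X) (fH : AnyonGen k n →ₐ[k] X) (fB : B →ₐ[k] X) : Prop where
  B_g : ∀ (a i : ZMod n) (b : B), b ∈ 𝒜 i →
    fB b * fH (gpow k a) = qpow q (a * i) • (fH (gpow k a) * fB b)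
  C_g : ∀ (a i : ZMod n) (c : C), c ∈ 𝒞 i →
    fC (MulOpposite.op c) * fH (gpow k a) =
      qpow q (a * i) • (fH (gpow k a) * fC (MulOpposite.op c))
  B_C : ∀ (m : ℕ) (d : Fin m → ZMod n) (t : Fin m → Fin m → C), IsComatrix 𝒞 d t →
    ∀ (m' : ℕ) (p : Fin m' → ZMod n) (s : Fin m' → Fin m' → B), IsComatrix 𝒜 p s →
    ∀ i j a b,
    ∑ l, ∑ c, ev (t l j) (s c b) •
      (fB (s a c) * fH (gpow k (d j - d l)) * fC (MulOpposite.op (t i l))) =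
    ∑ l, ∑ c, ev (t i l) (s a c) •
      (fC (MulOpposite.op (t l j)) * fH (gpow k (p c - p a)) * fB (s c b))

/-- The linear map `c ⊗ h ⊗ b ↦ c h b`. -/
def tripleMap {X : Type*} [Ring X] [Algebra k X]
    (fC : Cᵐᵒᵖ →ₐ[k] X) (fH : AnyonGen k n →ₐ[k] X) (fB : B →ₐ[k] X) :
    (C ⊗[k] AnyonGen k n) ⊗[k] B →ₗ[k] X :=
  LinearMap.mul' k X ∘ₗ TensorProduct.map
    (LinearMap.mul' k X ∘ₗ TensorProduct.map
      (fC.toLinearMap ∘ₗ (MulOpposite.opLinearEquiv k : C ≃ₗ[k] Cᵐᵒᵖ).toLinearMap)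
      fH.toLinearMap)
    fB.toLinearMap

variable {X : Type*} [Ring X] [Algebra k X]
  {fC : Cᵐᵒᵖ →ₐ[k] X} {fH : AnyonGen k n →ₐ[k] X} {fB : B →ₐ[k] X}

theorem tripleMap_tmul (c : C) (h : AnyonGen k n) (b : B) :
    tripleMap fC fH fB ((c ⊗ₜ h) ⊗ₜ b) = fC (MulOpposite.op c) * fH h * fB b := by
  simp [tripleMap]

/-- This puts the span of the ordered products into the algebra of submodules, where normal ordering
is a chain of inclusions. -/
theorem range_tripleMap :
    LinearMap.range (tripleMap fC fH fB) = LinearMap.range fC.toLinearMap *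
      LinearMap.range fH.toLinearMap * LinearMap.range fB.toLinearMap := by
  apply le_antisymm
  · rintro _ ⟨z, rfl⟩
    induction z with
    | zero => simp
    | add x y hx hy => rw [map_add]; exact add_mem hx hy
    | tmul z b =>
      induction z with
      | zero => simp
      | add x y hx hy => rw [TensorProduct.add_tmul, map_add]; exact add_mem hx hy
      | tmul c h =>
        rw [tripleMap_tmul]
        exact Submodule.mul_mem_mul (Submodule.mul_mem_mul ⟨_, rfl⟩ ⟨_, rfl⟩) ⟨_, rfl⟩
  · rw [Submodule.mul_le]
    rintro m hm _ ⟨b, rfl⟩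
    refine Submodule.mul_induction_on hm ?_ ?_
    · rintro _ ⟨c, rfl⟩ _ ⟨h, rfl⟩
      exact ⟨(c.unop ⊗ₜ h) ⊗ₜ b, by simp [tripleMap_tmul]⟩
    · intro x y hx hy; rw [add_mul]; exact add_mem hx hy

/-- On the left side of the cross relation the product `b c` occurs convolved with `ev`; convolving
with the twisted inverse `ev (T c) b` isolates it. -/
theorem IsCrossRep.B_mul_C (hq : q ^ n = 1) (hC : IsAnyonicBraidedGroup q 𝒞 SC)
    (hev : IsDualPairing 𝒜 𝒞 ev) {T : C →ₗ[k] C} (hST : ∀ b, SC (T b) = b)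
    (hTS : ∀ b, T (SC b) = b) (h : IsCrossRep q 𝒜 𝒞 ev fC fH fB)
    {m : ℕ} {d : Fin m → ZMod n} {t : Fin m → Fin m → C} (ht : IsComatrix 𝒞 d t)
    {m' : ℕ} {p : Fin m' → ZMod n} {s : Fin m' → Fin m' → B} (hs : IsComatrix 𝒜 p s)
    (i j : Fin m) (a b : Fin m') :
    fB (s a b) * fC (MulOpposite.op (t i j)) = ∑ l, ∑ c,
      (qpow q (-((d l - d i) * (d j - d l))) * ev (T (t l j)) (s c b)) •
        ((∑ l', ∑ c', ev (t i l') (s a c') •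
          (fC (MulOpposite.op (t l' l)) * fH (gpow k (p c' - p a)) * fB (s c' c))) *
        fH (gpow k (d j - d l))) := by
  simp only [← h.B_C m d t ht m' p s hs]
  -- Moving `g ^ (d j - d l)` to the left past `t i l'` changes the twist of the triple `i, l, j`
  -- into that of `l', l, j`, which is the one that `sum_inverse'` needs.
  have key : ∀ (l : Fin m) (c : Fin m') (l' : Fin m) (c' : Fin m'),
      (qpow q (-((d l - d i) * (d j - d l))) * ev (T (t l j)) (s c b)) •
        (ev (t l' l) (s c' c) • (fB (s a c') * fH (gpow k (d l - d l')) *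
          fC (MulOpposite.op (t i l'))) * fH (gpow k (d j - d l))) =
      (qpow q (-((d l - d l') * (d j - d l))) *
        (ev (t l' l) (s c' c) * ev (T (t l j)) (s c b))) •
        (fB (s a c') * fH (gpow k (d j - d l')) * fC (MulOpposite.op (t i l'))) := by
    intro l c l' c'
    rw [smul_mul_assoc, mul_assoc _ (fC _), h.C_g _ _ _ (ht.mem i l'), mul_smul_comm, smul_smul,
      smul_smul, ← mul_assoc, mul_assoc (fB _), ← map_mul, ← gpow_add]
    congr 1
    · rw [show -((d l - d l') * (d j - d l)) = -((d l - d i) * (d j - d l)) +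
        (d j - d l) * (d l' - d i) by ring, qpow_add hq]
      ring
    · congr 4
      ring
  have hsum : ∀ l' c', ∑ l, ∑ c, (qpow q (-((d l - d l') * (d j - d l))) *
        (ev (t l' l) (s c' c) * ev (T (t l j)) (s c b))) •
        (fB (s a c') * fH (gpow k (d j - d l')) * fC (MulOpposite.op (t i l'))) =
      if l' = j ∧ c' = b then fB (s a b) * fC (MulOpposite.op (t i j)) else 0 := by
    intro l' c'
    simp only [← Finset.sum_smul]
    rw [hev.sum_inverse' hq hC hST hTS ht hs]
    split_ifs with hh
    · simp [hh.1, hh.2]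
    · simp
  simp only [Finset.sum_mul, Finset.smul_sum, key]
  have hre : ∀ f : Fin m → Fin m' → Fin m → Fin m' → X, ∑ l, ∑ c, ∑ l', ∑ c', f l c l' c' =
      ∑ l', ∑ c', ∑ l, ∑ c, f l c l' c' := by
    intro f
    simp only [← Fintype.sum_prod_type' (f := fun _ _ => _)]
    exact Fintype.sum_equiv ⟨fun x => (x.2.2.1, x.2.2.2, x.1, x.2.1),
      fun x => (x.2.2.1, x.2.2.2, x.1, x.2.1), fun _ => rfl, fun _ => rfl⟩ _ _ fun _ => rfl
  rw [hre]
  simp [hsum, ite_and]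

/-- Normal ordering: `B` moves past `H` and `H` past `C` by commutation with the powers of `g`, and
`B` past `C` by `B_mul_C`. The bijectivity of the antipode enters through the last step. -/
theorem IsCrossRep.range_mul_range_le (hq : q ^ n = 1) (hB : IsAnyonicBraidedGroup q 𝒜 SB)
    (hC : IsAnyonicBraidedGroup q 𝒞 SC)
    (hSC : Function.Bijective SC) (hev : IsDualPairing 𝒜 𝒞 ev)
    (h : IsCrossRep q 𝒜 𝒞 ev fC fH fB) :
    LinearMap.range (tripleMap fC fH fB) * LinearMap.range (tripleMap fC fH fB) ≤
      LinearMap.range (tripleMap fC fH fB) := by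
  let e := LinearEquiv.ofBijective SC hSC
  have hST : ∀ c, SC (e.symm c) = c := e.apply_symm_apply
  have hTS : ∀ c, e.symm (SC c) = c := e.symm_apply_apply
  rw [range_tripleMap]
  set P := LinearMap.range fC.toLinearMap with hP
  set Q := LinearMap.range fH.toLinearMap with hQ
  set R := LinearMap.range fB.toLinearMap with hR
  have hPP : P * P ≤ P := by
    rw [Submodule.mul_le]; rintro _ ⟨x, rfl⟩ _ ⟨y, rfl⟩; exact ⟨x * y, by simp⟩
  have hQQ : Q * Q ≤ Q := by
    rw [Submodule.mul_le]; rintro _ ⟨x, rfl⟩ _ ⟨y, rfl⟩; exact ⟨x * y, by simp⟩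
  have hRR : R * R ≤ R := by
    rw [Submodule.mul_le]; rintro _ ⟨x, rfl⟩ _ ⟨y, rfl⟩; exact ⟨x * y, by simp⟩
  have hRQ : R * Q ≤ Q * R := by
    rw [Submodule.mul_le]
    rintro _ ⟨b, rfl⟩ _ ⟨y, rfl⟩
    refine anyonGen_induction (P := fun y => fB b * fH y ∈ Q * R) ?_ ?_ (fun a => ?_) y
    · intro x y hx hy; rw [map_add, mul_add]; exact add_mem hx hy
    · intro r x hx; rw [map_smul, mul_smul_comm]; exact Submodule.smul_mem _ _ hx
    refine homogeneous_induction 𝒜 (P := fun b => fB b * fH (gpow k a) ∈ Q * R) ?_ ?_ b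
    · intro x y hx hy; rw [map_add, add_mul]; exact add_mem hx hy
    · intro i x hx
      rw [h.B_g a i x hx]
      exact Submodule.smul_mem _ _ (Submodule.mul_mem_mul ⟨_, rfl⟩ ⟨_, rfl⟩)
  have hQP : Q * P ≤ P * Q := by
    rw [Submodule.mul_le]
    rintro _ ⟨y, rfl⟩ _ ⟨c, rfl⟩
    refine anyonGen_induction (P := fun y => fH y * fC c ∈ P * Q) ?_ ?_ (fun a => ?_) y
    · intro x y hx hy; rw [map_add, add_mul]; exact add_mem hx hy
    · intro r x hx; rw [map_smul, smul_mul_assoc]; exact Submodule.smul_mem _ _ hx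
    rw [← MulOpposite.op_unop c]
    refine homogeneous_induction 𝒞 (P := fun c => fH (gpow k a) * fC (MulOpposite.op c) ∈ P * Q)
      ?_ ?_ c.unop
    · intro x y hx hy; rw [MulOpposite.op_add, map_add, mul_add]; exact add_mem hx hy
    · intro i x hx
      have h1 := h.C_g a i x hx
      have h2 : fH (gpow k a) * fC (MulOpposite.op x) =
          qpow q (-(a * i)) • (fC (MulOpposite.op x) * fH (gpow k a)) := by
        rw [h1, smul_smul, qpow_neg_mul_qpow hq, one_smul]
      rw [h2]
      exact Submodule.smul_mem _ _ (Submodule.mul_mem_mul ⟨_, rfl⟩ ⟨_, rfl⟩)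
  have hRP : R * P ≤ P * Q * R := by
    -- The formula for `b c` ends with a power of `g` on the right, which has to be moved back past
    -- `B`.
    have hle : P * Q * R * Q ≤ P * Q * R := by
      calc P * Q * R * Q = P * Q * (R * Q) := by rw [mul_assoc]
        _ ≤ P * Q * (Q * R) := mul_le_mul_right hRQ _
        _ = P * (Q * Q) * R := by simp only [mul_assoc]
        _ ≤ P * Q * R := mul_le_mul_left (mul_le_mul_right hQQ _) _
    rw [Submodule.mul_le]
    rintro _ ⟨b, rfl⟩ _ ⟨c, rfl⟩
    rw [← MulOpposite.op_unop c]
    refine comatrix_induction (𝒜 := 𝒜) hB.comul_mem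
      (P := fun b => fB b * fC (MulOpposite.op c.unop) ∈ P * Q * R) ?_ ?_ ?_ ?_ b
    · rw [map_zero, zero_mul]; exact zero_mem _
    · intro x y hx hy; rw [map_add, add_mul]; exact add_mem hx hy
    · intro r x hx; rw [map_smul, smul_mul_assoc]; exact Submodule.smul_mem _ _ hx
    intro m p s hs a b
    refine comatrix_induction (𝒜 := 𝒞) hC.comul_mem
      (P := fun c => fB (s a b) * fC (MulOpposite.op c) ∈ P * Q * R) ?_ ?_ ?_ ?_ c.unop
    · rw [MulOpposite.op_zero, map_zero, mul_zero]; exact zero_mem _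
    · intro x y hx hy; rw [MulOpposite.op_add, map_add, mul_add]; exact add_mem hx hy
    · intro r x hx
      rw [MulOpposite.op_smul, map_smul, mul_smul_comm]; exact Submodule.smul_mem _ _ hx
    intro m d t ht i j
    rw [h.B_mul_C hq hC hev (T := e.symm.toLinearMap) hST hTS ht hs]
    refine Submodule.sum_mem _ fun l _ => Submodule.sum_mem _ fun c _ =>
      Submodule.smul_mem _ _ (hle (Submodule.mul_mem_mul (Submodule.sum_mem _ fun l' _ =>
        Submodule.sum_mem _ fun c' _ => Submodule.smul_mem _ _ ?_) ⟨_, rfl⟩))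
    exact Submodule.mul_mem_mul (Submodule.mul_mem_mul ⟨_, rfl⟩ ⟨_, rfl⟩) ⟨_, rfl⟩
  calc P * Q * R * (P * Q * R) = P * Q * (R * P) * Q * R := by simp only [mul_assoc]
    _ ≤ P * Q * (P * Q * R) * Q * R := by gcongr
    _ = P * (Q * P) * Q * (R * Q) * R := by simp only [mul_assoc]
    _ ≤ P * (P * Q) * Q * (Q * R) * R := by gcongr
    _ = (P * P) * (Q * Q * Q) * (R * R) := by simp only [mul_assoc]
    _ ≤ P * (Q * Q) * R := by gcongr
    _ ≤ P * Q * R := by gcongr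

theorem IsCrossRep.algHom_ext {A : Type*} [Ring A] [Algebra k A]
    {jC : Cᵐᵒᵖ →ₐ[k] A} {jH : AnyonGen k n →ₐ[k] A} {jB : B →ₐ[k] A}
    (hsurj : Function.Surjective (tripleMap jC jH jB)) {F F' : A →ₐ[k] X}
    (hFC : ∀ c, F (jC c) = F' (jC c)) (hFH : ∀ a, F (jH (gpow k a)) = F' (jH (gpow k a)))
    (hFB : ∀ b, F (jB b) = F' (jB b)) : F = F' := by
  have hFH' : ∀ h, F (jH h) = F' (jH h) := by
    intro h
    refine LinearMap.congr_fun (anyonGen_linearMap_ext (f := F.toLinearMap ∘ₗ jH.toLinearMap)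
      (f' := F'.toLinearMap ∘ₗ jH.toLinearMap) hFH) h
  ext x
  obtain ⟨z, rfl⟩ := hsurj x
  induction z with
  | zero => simp
  | add x y hx hy => simp only [map_add, hx, hy]
  | tmul z b =>
    induction z with
    | zero => simp
    | add x y hx hy => simp only [TensorProduct.add_tmul, map_add, hx, hy]
    | tmul c h => simp only [tripleMap_tmul, map_mul, hFC, hFH', hFB]

/-- Serves the graph argument in `exists_lift`. -/
theorem IsCrossRep.prod {A : Type*} [Ring A] [Algebra k A]
    {jC : Cᵐᵒᵖ →ₐ[k] A} {jH : AnyonGen k n →ₐ[k] A} {jB : B →ₐ[k] A}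
    (h : IsCrossRep q 𝒜 𝒞 ev jC jH jB) (h' : IsCrossRep q 𝒜 𝒞 ev fC fH fB) :
    IsCrossRep q 𝒜 𝒞 ev (jC.prod fC) (jH.prod fH) (jB.prod fB) where
  B_g a i b hb := Prod.ext (h.B_g a i b hb) (h'.B_g a i b hb)
  C_g a i c hc := Prod.ext (h.C_g a i c hc) (h'.C_g a i c hc)
  B_C m d t ht m' p s hs i j a b := by
    refine Prod.ext ?_ ?_
    · simpa [Prod.fst_sum] using h.B_C m d t ht m' p s hs i j a b
    · simpa [Prod.snd_sum] using h'.B_C m d t ht m' p s hs i j a b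

/-- The universal property of an algebra with the cross relations that is built on
`C ⊗ H ⊗ B`. -/
theorem IsCrossRep.exists_lift (hq : q ^ n = 1) (hB : IsAnyonicBraidedGroup q 𝒜 SB)
    (hC : IsAnyonicBraidedGroup q 𝒞 SC)
    (hSC : Function.Bijective SC) (hev : IsDualPairing 𝒜 𝒞 ev)
    {A : Type*} [Ring A] [Algebra k A]
    {jC : Cᵐᵒᵖ →ₐ[k] A} {jH : AnyonGen k n →ₐ[k] A} {jB : B →ₐ[k] A}
    (h : IsCrossRep q 𝒜 𝒞 ev jC jH jB) (hbij : Function.Bijective (tripleMap jC jH jB))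
    (h' : IsCrossRep q 𝒜 𝒞 ev fC fH fB) :
    ∃ F : A →ₐ[k] X, (∀ c, F (jC c) = fC c) ∧ (∀ x, F (jH x) = fH x) ∧ ∀ b, F (jB b) = fB b := by
  let e := LinearEquiv.ofBijective _ hbij
  set F : A →ₗ[k] X := tripleMap fC fH fB ∘ₗ e.symm.toLinearMap with hF
  have hFT : ∀ z, F (tripleMap jC jH jB z) = tripleMap fC fH fB z := fun z =>
    congrArg (tripleMap fC fH fB) (e.symm_apply_apply z)
  have hprod : ∀ z, tripleMap (jC.prod fC) (jH.prod fH) (jB.prod fB) z =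
      (tripleMap jC jH jB z, tripleMap fC fH fB z) := by
    intro z
    induction z with
    | zero => simp only [map_zero]; rfl
    | add x y hx hy => simp only [map_add, hx, hy, Prod.mk_add_mk]
    | tmul z b =>
      induction z with
      | zero => simp only [TensorProduct.zero_tmul, map_zero]; rfl
      | add x y hx hy => simp only [TensorProduct.add_tmul, map_add, hx, hy, Prod.mk_add_mk]
      | tmul c h => simp [tripleMap_tmul]
  have hF1 : F 1 = 1 := by
    have := hFT ((1 ⊗ₜ 1) ⊗ₜ 1)
    simpa [tripleMap_tmul] using this
  -- The span of the ordered products in `A × X` is the graph of `F`. It is closed under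
  -- multiplication by normal ordering, which says that `F` is multiplicative.
  have hmul : ∀ x y, F (x * y) = F x * F y := by
    intro x y
    obtain ⟨z, rfl⟩ := hbij.2 x
    obtain ⟨z', rfl⟩ := hbij.2 y
    obtain ⟨z'', hz⟩ := (h.prod h').range_mul_range_le hq hB hC hSC hev
      (Submodule.mul_mem_mul (LinearMap.mem_range_self _ z) (LinearMap.mem_range_self _ z'))
    rw [hprod, hprod, hprod, Prod.mk_mul_mk, Prod.mk.injEq] at hz
    rw [← hz.1, hFT, hFT, hFT, hz.2]
  refine ⟨AlgHom.ofLinearMap F hF1 hmul, fun c => ?_, fun x => ?_, fun b => ?_⟩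
  · have := hFT ((c.unop ⊗ₜ 1) ⊗ₜ 1)
    simpa [tripleMap_tmul] using this
  · have := hFT ((1 ⊗ₜ x) ⊗ₜ 1)
    simpa [tripleMap_tmul] using this
  · have := hFT ((1 ⊗ₜ 1) ⊗ₜ b)
    simpa [tripleMap_tmul] using this

end CrossRep

/-! ### The three elementary actions of `B` and their relations with `C` and `g` -/

section Representation

variable {k : Type u} [Field k] {n : ℕ} [NeZero n] {q : k}
  {B : Type v} [Ring B] [Algebra k B] [Coalgebra k B] {𝒜 : ZMod n → Submodule k B}
  [GradedAlgebra 𝒜] {SB : B →ₗ[k] B}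
  {C : Type w} [Ring C] [Algebra k C] [Coalgebra k C] {𝒞 : ZMod n → Submodule k C}
  [GradedAlgebra 𝒞] {SC : C →ₗ[k] C} {ev : C →ₗ[k] B →ₗ[k] k} {T : C →ₗ[k] C}
  {Q : Type*} [Ring Q] [Algebra k Q]

theorem IsDualPairing.flip_one_left (hev : IsDualPairing 𝒜 𝒞 ev) :
    ev.flip 1 = Coalgebra.counit := by
  ext c
  exact hev.ev_one_right c

/-- Apply the counit to the antipode axiom for a comatrix: the counit of the comatrix is the
identity matrix, so that of its image under the antipode is as well. -/
theorem IsAnyonicBraidedGroup.counit_inverse (hB : IsAnyonicBraidedGroup q 𝒜 SB) {T : B →ₗ[k] B}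
    (hST : ∀ b, SB (T b) = b) (b : B) :
    Coalgebra.counit (R := k) (T b) = Coalgebra.counit (R := k) b := by
  have hS : ∀ b, Coalgebra.counit (R := k) (SB b) = Coalgebra.counit (R := k) b := by
    intro b
    refine comatrix_induction (𝒜 := 𝒜) hB.comul_mem (P := fun b =>
      Coalgebra.counit (R := k) (SB b) = Coalgebra.counit (R := k) b) ?_ ?_ ?_ ?_ b
    · simp
    · intro x y hx hy; simp only [map_add, hx, hy]
    · intro r x hx; simp only [map_smul, hx]
    intro m p t ht i j
    have h := congrArg (Coalgebra.counit (R := k)) (hB.sum_antipode_mul ht i j)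
    simp only [map_sum, hB.counit_mul, ht.counit] at h
    rw [ht.counit]
    simp only [mul_ite, mul_one, mul_zero, Finset.sum_ite_eq', Finset.mem_univ, if_true] at h
    rw [h]
    split_ifs <;> simp [hB.counit_one]
  rw [← hS, hST]

theorem IsDualPairing.flip_comp_one_left (hC : IsAnyonicBraidedGroup q 𝒞 SC)
    (hev : IsDualPairing 𝒜 𝒞 ev) (hST : ∀ b, SC (T b) = b) :
    (ev ∘ₗ T).flip 1 = Coalgebra.counit := by
  ext c
  rw [LinearMap.flip_apply, LinearMap.comp_apply, hev.ev_one_right, hC.counit_inverse hST]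

variable (k) in
/-- Tensoring with a fixed element on the right. -/
def tmulRight {X : Type*} [Ring X] [Algebra k X] (y : Q) : X →ₗ[k] X ⊗[k] Q :=
  (TensorProduct.mk k X Q).flip y

@[simp] theorem tmulRight_apply {X : Type*} [Ring X] [Algebra k X] (y : Q) (x : X) :
    tmulRight k y x = x ⊗ₜ[k] y := rfl

/-- The action of `B` on `C ⊗ Q` by `b (c ⊗ x) = ev(c₍₁₎, b) c₍₂₎ ⊗ g ^ |b| x`. -/
def leftAction (hC : IsAnyonicBraidedGroup q 𝒞 SC) (hev : IsDualPairing 𝒜 𝒞 ev)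
    (γ : AnyonGen k n →ₐ[k] Q) : B →ₐ[k] Module.End k C ⊗[k] Q :=
  byDegreeHom (𝒜 := 𝒜) (fun i => tmulRight k (γ (gpow k i)) ∘ₗ leftCoaction ∘ₗ ev.flip)
    (by simp [hev.flip_one_left, leftCoaction_counit, Algebra.TensorProduct.one_def])
    (by
      intro i j x _ y _
      simp only [LinearMap.comp_apply, tmulRight_apply,
        hev.leftCoaction_mul hC, Algebra.TensorProduct.tmul_mul_tmul, gpow_add, map_mul])

theorem leftAction_of_mem (hC : IsAnyonicBraidedGroup q 𝒞 SC) (hev : IsDualPairing 𝒜 𝒞 ev)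
    (γ : AnyonGen k n →ₐ[k] Q) {i : ZMod n} {b : B} (hb : b ∈ 𝒜 i) :
    leftAction hC hev γ b = leftCoaction (ev.flip b) ⊗ₜ γ (gpow k i) := by
  exact (byDegree_of_mem (fun i => tmulRight (X := Module.End k C) k (γ (gpow k i)) ∘ₗ
    leftCoaction ∘ₗ ev.flip) hb)

/-- The action of `B` on `C ⊗ Q` by
`b (c ⊗ x) = q ^ (|b| |c₍₁₎|) ev(S⁻¹ c₍₂₎, b) c₍₁₎ ⊗ g ^ (-|b|) x`. -/
def rightAction (hq : q ^ n = 1) (hB : IsAnyonicBraidedGroup q 𝒜 SB)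
    (hC : IsAnyonicBraidedGroup q 𝒞 SC) (hev : IsDualPairing 𝒜 𝒞 ev)
    (hST : ∀ b, SC (T b) = b) (hTS : ∀ b, T (SC b) = b)
    (γ : AnyonGen k n →ₐ[k] Q) : B →ₐ[k] Module.End k C ⊗[k] Q :=
  byDegreeHom (𝒜 := 𝒜) (fun i => tmulRight k (γ (gpow k (-i))) ∘ₗ
    LinearMap.mulLeft k (degreeScale q 𝒞 i) ∘ₗ rightCoaction ∘ₗ (ev ∘ₗ T).flip)
    (by simp [hev.flip_comp_one_left hC hST, rightCoaction_counit,
      Algebra.TensorProduct.one_def])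
    (by
      intro i j x hx y hy
      simp only [LinearMap.comp_apply, tmulRight_apply,
        LinearMap.mulLeft_apply, hev.rightCoaction_mul hq hB hC hST hTS hx hy,
        Algebra.TensorProduct.tmul_mul_tmul, neg_add, gpow_add, map_mul])

theorem rightAction_of_mem (hq : q ^ n = 1) (hB : IsAnyonicBraidedGroup q 𝒜 SB)
    (hC : IsAnyonicBraidedGroup q 𝒞 SC) (hev : IsDualPairing 𝒜 𝒞 ev)
    (hST : ∀ b, SC (T b) = b) (hTS : ∀ b, T (SC b) = b)
    (γ : AnyonGen k n →ₐ[k] Q) {i : ZMod n} {b : B} (hb : b ∈ 𝒜 i) :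
    rightAction hq hB hC hev hST hTS γ b =
      (degreeScale q 𝒞 i * rightCoaction ((ev ∘ₗ T).flip b)) ⊗ₜ γ (gpow k (-i)) := by
  exact byDegree_of_mem (fun i => tmulRight (X := Module.End k C) k (γ (gpow k (-i))) ∘ₗ
    LinearMap.mulLeft k (degreeScale q 𝒞 i) ∘ₗ rightCoaction ∘ₗ (ev ∘ₗ T).flip) hb

variable (k C Q) in
/-- Right multiplication, as a homomorphism from the opposite algebra. -/
def mulRightAction : Cᵐᵒᵖ →ₐ[k] Module.End k C ⊗[k] Q :=
  Algebra.TensorProduct.includeLeft.comp (Algebra.lsmul k k C)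

theorem mulRightAction_op (c : C) :
    mulRightAction k C Q (MulOpposite.op c) = LinearMap.mulRight k c ⊗ₜ 1 := by
  rw [mulRightAction, AlgHom.comp_apply, Algebra.TensorProduct.includeLeft_apply]
  rfl

variable (𝒞) in
/-- The action of `g` on `C ⊗ Q` by `g (c ⊗ x) = q ^ (-|c|) c ⊗ g x`. -/
def genAction (hq : q ^ n = 1) (γ : AnyonGen k n →ₐ[k] Q) :
    AnyonGen k n →ₐ[k] Module.End k C ⊗[k] Q :=
  AddMonoidAlgebra.lift k (Module.End k C ⊗[k] Q) (ZMod n)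
    { toFun := fun a => degreeScale q 𝒞 (-a.toAdd) ⊗ₜ γ (gpow k a.toAdd)
      map_one' := by simp [Algebra.TensorProduct.one_def]
      map_mul' := by
        intro a b
        rw [toAdd_mul, neg_add, degreeScale_add hq, gpow_add, map_mul,
          Algebra.TensorProduct.tmul_mul_tmul] }

theorem genAction_gpow (hq : q ^ n = 1) (γ : AnyonGen k n →ₐ[k] Q) (a : ZMod n) :
    genAction 𝒞 hq γ (gpow k a) = degreeScale q 𝒞 (-a) ⊗ₜ γ (gpow k a) := by
  simp [genAction, gpow]

theorem degreeScale_comm (hq : q ^ n = 1) (a b : ZMod n) :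
    degreeScale q 𝒞 a * degreeScale q 𝒞 b = degreeScale q 𝒞 b * degreeScale q 𝒞 a := by
  rw [← degreeScale_add hq, add_comm, degreeScale_add hq]

theorem gpow_map_comm (γ : AnyonGen k n →ₐ[k] Q) (a b : ZMod n) :
    γ (gpow k a) * γ (gpow k b) = γ (gpow k b) * γ (gpow k a) := by
  rw [← map_mul, gpow_commute, map_mul]

variable (C) in
/-- The action of `B` on `C ⊗ Q` through the second factor. -/
def innerAction (β : B →ₐ[k] Q) : B →ₐ[k] Module.End k C ⊗[k] Q :=
  Algebra.TensorProduct.includeRight.comp β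

theorem innerAction_apply (β : B →ₐ[k] Q) (b : B) : innerAction C β b = 1 ⊗ₜ β b := rfl

/-- This commutation up to the braiding and the next two are the hypotheses for the convolution
products that define `fullAction`. -/
theorem innerAction_mul_leftAction (hC : IsAnyonicBraidedGroup q 𝒞 SC)
    (hev : IsDualPairing 𝒜 𝒞 ev) {γ : AnyonGen k n →ₐ[k] Q} {β : B →ₐ[k] Q}
    (hβ : ∀ a i : ZMod n, ∀ b ∈ 𝒜 i, β b * γ (gpow k a) = qpow q (a * i) • (γ (gpow k a) * β b))
    (i j : ZMod n) (x : B) (hx : x ∈ 𝒜 i) (y : B) (hy : y ∈ 𝒜 j) :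
    innerAction C β x * leftAction hC hev γ y =
      qpow q (i * j) • (leftAction hC hev γ y * innerAction C β x) := by
  rw [leftAction_of_mem hC hev γ hy, innerAction_apply,
    Algebra.TensorProduct.tmul_mul_tmul, Algebra.TensorProduct.tmul_mul_tmul, hβ j i x hx,
    TensorProduct.tmul_smul, one_mul, mul_one, mul_comm i j]

theorem rightAction_mul_leftAction (hq : q ^ n = 1) (hB : IsAnyonicBraidedGroup q 𝒜 SB)
    (hC : IsAnyonicBraidedGroup q 𝒞 SC) (hev : IsDualPairing 𝒜 𝒞 ev)
    (hST : ∀ b, SC (T b) = b) (hTS : ∀ b, T (SC b) = b) (γ : AnyonGen k n →ₐ[k] Q)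
    (i j : ZMod n) (x : B) (hx : x ∈ 𝒜 i) (y : B) (hy : y ∈ 𝒜 j) :
    rightAction hq hB hC hev hST hTS γ x * leftAction hC hev γ y =
      qpow q (i * j) • (leftAction hC hev γ y * rightAction hq hB hC hev hST hTS γ x) := by
  rw [leftAction_of_mem hC hev γ hy, rightAction_of_mem hq hB hC hev hST hTS γ hx,
    Algebra.TensorProduct.tmul_mul_tmul, Algebra.TensorProduct.tmul_mul_tmul, mul_assoc,
    rightCoaction_mul_leftCoaction hC, ← mul_assoc, hev.degreeScale_mul_leftCoaction hq hC hy,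
    smul_mul_assoc, mul_assoc, gpow_map_comm, TensorProduct.smul_tmul']

/-- The power `g ^ (-i)` in `rightAction` is responsible for the scalar: moving it past `β y` gives
the braiding with the required sign. -/
theorem rightAction_mul_innerAction (hq : q ^ n = 1) (hB : IsAnyonicBraidedGroup q 𝒜 SB)
    (hC : IsAnyonicBraidedGroup q 𝒞 SC) (hev : IsDualPairing 𝒜 𝒞 ev)
    (hST : ∀ b, SC (T b) = b) (hTS : ∀ b, T (SC b) = b) {γ : AnyonGen k n →ₐ[k] Q}
    {β : B →ₐ[k] Q}
    (hβ : ∀ a i : ZMod n, ∀ b ∈ 𝒜 i, β b * γ (gpow k a) = qpow q (a * i) • (γ (gpow k a) * β b))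
    (i j : ZMod n) (x : B) (hx : x ∈ 𝒜 i) (y : B) (hy : y ∈ 𝒜 j) :
    rightAction hq hB hC hev hST hTS γ x * innerAction C β y =
      qpow q (i * j) • (innerAction C β y * rightAction hq hB hC hev hST hTS γ x) := by
  rw [rightAction_of_mem hq hB hC hev hST hTS γ hx, innerAction_apply,
    Algebra.TensorProduct.tmul_mul_tmul, Algebra.TensorProduct.tmul_mul_tmul, hβ (-i) j y hy,
    TensorProduct.tmul_smul, smul_smul, ← qpow_add hq, one_mul, mul_one, neg_mul, add_neg_cancel,
    qpow_zero, one_smul]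

theorem leftAction_mul_genAction (hq : q ^ n = 1)
    (hC : IsAnyonicBraidedGroup q 𝒞 SC) (hev : IsDualPairing 𝒜 𝒞 ev) (γ : AnyonGen k n →ₐ[k] Q)
    (a i : ZMod n) {b : B} (hb : b ∈ 𝒜 i) :
    leftAction hC hev γ b * genAction 𝒞 hq γ (gpow k a) =
      qpow q (a * i) • (genAction 𝒞 hq γ (gpow k a) * leftAction hC hev γ b) := by
  rw [leftAction_of_mem hC hev γ hb, genAction_gpow, Algebra.TensorProduct.tmul_mul_tmul,
    Algebra.TensorProduct.tmul_mul_tmul, hev.degreeScale_mul_leftCoaction hq hC hb,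
    ← TensorProduct.smul_tmul', smul_smul, ← qpow_add hq, gpow_map_comm, neg_mul, add_neg_cancel,
    qpow_zero, one_smul]

theorem rightAction_mul_genAction (hq : q ^ n = 1) (hB : IsAnyonicBraidedGroup q 𝒜 SB)
    (hC : IsAnyonicBraidedGroup q 𝒞 SC) (hev : IsDualPairing 𝒜 𝒞 ev)
    (hST : ∀ b, SC (T b) = b) (hTS : ∀ b, T (SC b) = b) (γ : AnyonGen k n →ₐ[k] Q)
    (a i : ZMod n) {b : B} (hb : b ∈ 𝒜 i) :
    rightAction hq hB hC hev hST hTS γ b * genAction 𝒞 hq γ (gpow k a) = qpow q (a * i) •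
      (genAction 𝒞 hq γ (gpow k a) * rightAction hq hB hC hev hST hTS γ b) := by
  rw [rightAction_of_mem hq hB hC hev hST hTS γ hb, genAction_gpow,
    Algebra.TensorProduct.tmul_mul_tmul, Algebra.TensorProduct.tmul_mul_tmul,
    ← mul_assoc (degreeScale q 𝒞 (-a)), degreeScale_comm hq (-a), mul_assoc, mul_assoc,
    hev.degreeScale_mul_rightCoaction hq hC (hC.inverse_mem hST hTS) hb, mul_smul_comm,
    ← TensorProduct.smul_tmul', smul_smul, ← qpow_add hq, gpow_map_comm, neg_mul, add_neg_cancel,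
    qpow_zero, one_smul]

theorem innerAction_mul_genAction (hq : q ^ n = 1) {γ : AnyonGen k n →ₐ[k] Q} {β : B →ₐ[k] Q}
    (hβ : ∀ a i : ZMod n, ∀ b ∈ 𝒜 i, β b * γ (gpow k a) = qpow q (a * i) • (γ (gpow k a) * β b))
    (a i : ZMod n) {b : B} (hb : b ∈ 𝒜 i) :
    innerAction C β b * genAction 𝒞 hq γ (gpow k a) = qpow q (a * i) •
      (genAction 𝒞 hq γ (gpow k a) * innerAction C β b) := by
  rw [innerAction_apply, genAction_gpow, Algebra.TensorProduct.tmul_mul_tmul,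
    Algebra.TensorProduct.tmul_mul_tmul, hβ a i b hb, TensorProduct.tmul_smul, one_mul, mul_one]

theorem mulRightAction_mul_genAction (hq : q ^ n = 1) (γ : AnyonGen k n →ₐ[k] Q)
    (a i : ZMod n) (c : C) (hc : c ∈ 𝒞 i) :
    mulRightAction k C Q (MulOpposite.op c) * genAction 𝒞 hq γ (gpow k a) = qpow q (a * i) •
      (genAction 𝒞 hq γ (gpow k a) * mulRightAction k C Q (MulOpposite.op c)) := by
  have h : degreeScale q 𝒞 (-a) * LinearMap.mulRight k c =
      qpow q (-(a * i)) • (LinearMap.mulRight k c * degreeScale q 𝒞 (-a)) := by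
    ext x
    refine homogeneous_induction 𝒞 (P := fun x => (degreeScale q 𝒞 (-a) *
      LinearMap.mulRight k c) x = (qpow q (-(a * i)) • (LinearMap.mulRight k c *
      degreeScale q 𝒞 (-a))) x) ?_ (fun j x hx => ?_) x
    · intro x y hx hy; rw [map_add, map_add, hx, hy]
    · rw [LinearMap.smul_apply, Module.End.mul_apply, Module.End.mul_apply,
        LinearMap.mulRight_apply, degreeScale_of_mem _ hx,
        degreeScale_of_mem _ (SetLike.mul_mem_graded hx hc), map_smul, LinearMap.mulRight_apply,
        smul_smul, ← qpow_add hq]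
      congr 2
      ring
  rw [mulRightAction_op, genAction_gpow, Algebra.TensorProduct.tmul_mul_tmul,
    Algebra.TensorProduct.tmul_mul_tmul, h, ← TensorProduct.smul_tmul', smul_smul, ← qpow_add hq,
    one_mul, mul_one, add_neg_cancel, qpow_zero, one_smul]

theorem innerAction_mul_mulRightAction (β : B →ₐ[k] Q) (b : B) (c : C) :
    innerAction C β b * mulRightAction k C Q (MulOpposite.op c) =
      mulRightAction k C Q (MulOpposite.op c) * innerAction C β b := by
  rw [innerAction_apply, mulRightAction_op, Algebra.TensorProduct.tmul_mul_tmul,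
    Algebra.TensorProduct.tmul_mul_tmul, one_mul, mul_one, one_mul, mul_one]

section

variable {I : Type*} [Fintype I] [DecidableEq I] {d : I → ZMod n} {t : I → I → C}
  {J : Type*} [Fintype J] [DecidableEq J] {p : J → ZMod n} {s : J → J → B}

/-- The coproduct of `x c` in the braided tensor product is contracted on the left; the pairing
splits this contraction between `c` and `x`, and the braiding scalar is expressed by a scaling
operator acting on `x`. -/
theorem IsDualPairing.leftCoaction_mul_mulRight (hq : q ^ n = 1)
    (hC : IsAnyonicBraidedGroup q 𝒞 SC) (hev : IsDualPairing 𝒜 𝒞 ev)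
    (ht : IsComatrix 𝒞 d t) (hs : IsComatrix 𝒜 p s) (i j : I) (a b : J) :
    leftCoaction (ev.flip (s a b)) * LinearMap.mulRight k (t i j) = ∑ l, ∑ c,
      ev (t i l) (s a c) • (LinearMap.mulRight k (t l j) * degreeScale q 𝒞 (-(p c - p a)) *
        leftCoaction (ev.flip (s c b))) := by
  refine hC.linearMap_ext fun m e r hr x y => ?_
  have hw := hr.mul hq hC ht
  -- The product is rewritten as a scalar multiple of an entry of the product comatrix, whose
  -- coproduct carries no scalars.
  have hxy : r x y * t i j = qpow q (-((e y - e x) * d i)) •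
      (qpow q ((e y - e x) * d i) • (r x y * t i j)) := by
    rw [smul_smul, ← qpow_add hq, neg_add_cancel, qpow_zero, one_smul]
  rw [Module.End.mul_apply, LinearMap.mulRight_apply, hxy, map_smul,
    leftCoaction_comatrix _ hw (x, i) (y, j), Fintype.sum_prod_type_right]
  simp only [LinearMap.sum_apply, LinearMap.smul_apply, Module.End.mul_apply,
    leftCoaction_comatrix _ hr, map_sum, map_smul, LinearMap.mulRight_apply,
    degreeScale_of_mem _ (hr.mem _ y), LinearMap.flip_apply, hev.mul_comatrix hs,
    Finset.smul_sum, Finset.sum_smul, smul_smul, smul_eq_mul, Finset.mul_sum,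
    Finset.sum_mul]
  refine Finset.sum_congr rfl fun l _ => ?_
  rw [Finset.sum_comm]
  refine Finset.sum_congr rfl fun c _ => Finset.sum_congr rfl fun z _ => ?_
  -- Where the pairing is nonzero, the degree of the contracted part of `c` is minus that of `s a
  -- c`; this converts the braiding exponent into the degree scaling.
  by_cases h0 : (d l - d i) + (p c - p a) = 0
  · have hp : p c - p a = -(d l - d i) := by linear_combination h0
    have hx : qpow q (-(p c - p a) * (e y - e z)) =
        qpow q (-((e y - e x) * d i)) * qpow q ((e z - e x) * d i) *
          qpow q ((e y - e z) * d l) := by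
      rw [← qpow_add hq, ← qpow_add hq, hp]
      congr 1
      ring
    rw [hx]
    congr 1
    ring
  · rw [hev.ev_eq_zero ht hs h0]
    simp

/-- The half of the cross relation in which `ev` stands on the first legs; moving `leftAction` past
`C` generates its right side. -/
theorem IsDualPairing.leftAction_mul_mulRightAction (hq : q ^ n = 1)
    (hC : IsAnyonicBraidedGroup q 𝒞 SC) (hev : IsDualPairing 𝒜 𝒞 ev)
    (γ : AnyonGen k n →ₐ[k] Q)
    (ht : IsComatrix 𝒞 d t) (hs : IsComatrix 𝒜 p s) (i j : I) (a b : J) :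
    leftAction hC hev γ (s a b) * mulRightAction k C Q (MulOpposite.op (t i j)) = ∑ l, ∑ c,
      ev (t i l) (s a c) • (mulRightAction k C Q (MulOpposite.op (t l j)) *
        genAction 𝒞 hq γ (gpow k (p c - p a)) * leftAction hC hev γ (s c b)) := by
  rw [leftAction_of_mem hC hev γ (hs.mem a b), mulRightAction_op,
    Algebra.TensorProduct.tmul_mul_tmul, hev.leftCoaction_mul_mulRight hq hC ht hs,
    TensorProduct.sum_tmul]
  refine Finset.sum_congr rfl fun l _ => ?_
  rw [TensorProduct.sum_tmul]
  refine Finset.sum_congr rfl fun c _ => ?_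
  rw [leftAction_of_mem hC hev γ (hs.mem c b), mulRightAction_op, genAction_gpow,
    Algebra.TensorProduct.tmul_mul_tmul, Algebra.TensorProduct.tmul_mul_tmul,
    TensorProduct.smul_tmul', one_mul, mul_one, ← map_mul, ← gpow_add, sub_add_sub_cancel']

theorem IsDualPairing.rightCoaction_mul_comatrix (hq : q ^ n = 1)
    (hC : IsAnyonicBraidedGroup q 𝒞 SC) (hev : IsDualPairing 𝒜 𝒞 ev)
    (hST : ∀ b, SC (T b) = b) (hTS : ∀ b, T (SC b) = b)
    {L : Type*} [Fintype L] [DecidableEq L] {e : L → ZMod n} {r : L → L → C}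
    (hr : IsComatrix 𝒞 e r) (ht : IsComatrix 𝒞 d t) (hs : IsComatrix 𝒜 p s)
    (x y : L) (i l : I) (a c : J) :
    rightCoaction ((ev ∘ₗ T).flip (s a c)) (r x y * t i l) = ∑ z, ∑ f, ∑ h,
      (qpow q ((e y - e z) * (d f - d i) - (e y - e z) * (d l - d f)) *
        (ev (T (r z y)) (s a h) * ev (T (t f l)) (s h c))) • (r x z * t i f) := by
  have hw := hr.mul hq hC ht
  have hxy : r x y * t i l = qpow q (-((e y - e x) * d i)) •
      (qpow q ((e y - e x) * d i) • (r x y * t i l)) := by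
    rw [smul_smul, ← qpow_add hq, neg_add_cancel, qpow_zero, one_smul]
  rw [hxy, map_smul, rightCoaction_comatrix _ hw (x, i) (y, l), Fintype.sum_prod_type]
  simp only [map_smul, LinearMap.flip_apply, LinearMap.comp_apply,
    hev.inverse_mul_comatrix hq hC hST hTS hs (hr.mem _ _) (ht.mem _ _),
    Finset.smul_sum, Finset.sum_smul, smul_smul, smul_eq_mul, Finset.mul_sum, Finset.sum_mul]
  refine Finset.sum_congr rfl fun z _ => Finset.sum_congr rfl fun f _ =>
    Finset.sum_congr rfl fun h _ => ?_
  have hx : qpow q ((e y - e z) * (d f - d i) - (e y - e z) * (d l - d f)) =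
      qpow q (-((e y - e x) * d i)) * qpow q ((e y - e z) * d f) *
        qpow q (-((e y - e z) * (d l - d f))) * qpow q ((e z - e x) * d i) := by
    rw [← qpow_add hq, ← qpow_add hq, ← qpow_add hq]
    congr 1
    ring
  rw [hx]
  congr 1
  ring

/-- Contracting `x c` on the right through `T` yields one factor for `x` and one for `c`; the
additional pairing on the left side is the twisted inverse of the factor for `c` and cancels it. -/
theorem IsDualPairing.rightCoaction_mul_mulRight (hq : q ^ n = 1)
    (hC : IsAnyonicBraidedGroup q 𝒞 SC) (hev : IsDualPairing 𝒜 𝒞 ev)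
    (hST : ∀ b, SC (T b) = b) (hTS : ∀ b, T (SC b) = b)
    (ht : IsComatrix 𝒞 d t) (hs : IsComatrix 𝒜 p s) (i j : I) (a b : J) :
    ∑ l, ∑ c, ev (t l j) (s c b) •
      (degreeScale q 𝒞 (p c - p a) * rightCoaction ((ev ∘ₗ T).flip (s a c)) *
        degreeScale q 𝒞 (-(d j - d l)) * LinearMap.mulRight k (t i l)) =
    LinearMap.mulRight k (t i j) *
      (degreeScale q 𝒞 (p b - p a) * rightCoaction ((ev ∘ₗ T).flip (s a b))) := by
  have hT := hC.inverse_mem hST hTS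
  refine hC.linearMap_ext fun m e r hr x y => ?_
  have hmem : ∀ z l, r x z * t i l ∈ 𝒞 ((e z - e x) + (d l - d i)) := fun z l =>
    SetLike.mul_mem_graded (hr.mem x z) (ht.mem i l)
  simp only [LinearMap.sum_apply, LinearMap.smul_apply, Module.End.mul_apply,
    LinearMap.mulRight_apply, degreeScale_of_mem _ (hmem y _), map_smul,
    hev.rightCoaction_mul_comatrix hq hC hST hTS hr ht hs, map_sum,
    degreeScale_of_mem _ (hmem _ _), rightCoaction_comatrix _ hr,
    degreeScale_of_mem _ (hr.mem _ _), Finset.smul_sum, smul_smul]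
  rw [sum_reorder]
  have key : ∀ f h z, ∑ l, ∑ c, ((ev (t l j)) (s c b) *
      (qpow q (-(d j - d l) * (e y - e x + (d l - d i))) *
        (qpow q ((e y - e z) * (d f - d i) - (e y - e z) * (d l - d f)) *
          (ev (T (r z y)) (s a h) * ev (T (t f l)) (s h c)) *
          qpow q ((p c - p a) * (e z - e x + (d f - d i)))))) • (r x z * t i f) =
      if f = j ∧ h = b then (ev (T (r z y)) (s a b) *
        qpow q ((p b - p a) * (e z - e x))) • (r x z * t i j) else 0 := by
    intro f h z
    by_cases h₁ : (e y - e z) + (p h - p a) = 0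
    · have hh : p h - p a = -(e y - e z) := by linear_combination h₁
      -- After the degree conditions are inserted, the scalar depends on `l` and `c` only through
      -- the twist of `sum_inverse`, so the rest can be taken out of the sum.
      have hterm : ∀ l c, ev (t l j) (s c b) *
          (qpow q (-(d j - d l) * (e y - e x + (d l - d i))) *
            (qpow q ((e y - e z) * (d f - d i) - (e y - e z) * (d l - d f)) *
              (ev (T (r z y)) (s a h) * ev (T (t f l)) (s h c)) *
              qpow q ((p c - p a) * (e z - e x + (d f - d i))))) =
          (qpow q (-((d j - d f) * (e y - e x + (d f - d i))) - (e y - e z) * (e z - e x)) *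
            ev (T (r z y)) (s a h)) * (qpow q (-((d l - d f) * (d j - d l))) *
              (ev (T (t f l)) (s h c) * ev (t l j) (s c b))) := by
        intro l c
        by_cases h₂ : (d l - d f) + (p c - p h) = 0
        · have hc : p c - p a = -(e y - e z) - (d l - d f) := by linear_combination h₁ + h₂
          have hx : qpow q (-((d j - d f) * (e y - e x + (d f - d i))) -
              (e y - e z) * (e z - e x)) * qpow q (-((d l - d f) * (d j - d l))) =
              qpow q (-(d j - d l) * (e y - e x + (d l - d i))) *
              qpow q ((e y - e z) * (d f - d i) - (e y - e z) * (d l - d f)) *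
              qpow q ((p c - p a) * (e z - e x + (d f - d i))) := by
            rw [← qpow_add hq, ← qpow_add hq, ← qpow_add hq, hc]
            congr 1
            ring
          linear_combination (-(ev (T (r z y)) (s a h) * ev (T (t f l)) (s h c) *
            ev (t l j) (s c b))) * hx
        · rw [hev.ev_of_mem _ _ _ _ (hT _ _ (ht.mem f l)) (hs.mem h c) h₂]
          simp
      have hsum := hev.sum_inverse hq hC hST hTS ht hs f j h b
      simp only [← Finset.mul_sum] at hsum
      simp only [hterm, ← Finset.sum_smul, ← Finset.mul_sum]
      rw [hsum]
      split_ifs with hfh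
      · obtain ⟨rfl, rfl⟩ := hfh
        rw [hh, mul_one, mul_comm (qpow _ _), neg_mul, sub_self, zero_mul, neg_zero, zero_sub]
      · rw [mul_zero, zero_smul]
    · have h0 : ev (T (r z y)) (s a h) = 0 :=
        hev.ev_of_mem _ _ _ _ (hT _ _ (hr.mem z y)) (hs.mem a h) h₁
      simp only [h0, zero_mul, mul_zero, zero_smul, Finset.sum_const_zero]
      split_ifs with hfh
      · rw [← hfh.2, h0, zero_mul, zero_smul]
      · rfl
  simp only [key]
  rw [Finset.sum_eq_single j]
  · rw [Finset.sum_eq_single b]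
    · simp
    · intro h _ hh
      simp [hh]
    · simp
  · intro f _ hf
    simp [hf]
  · simp

/-- The half of the cross relation in which `ev` stands on the last legs; `rightAction` absorbs its
left side. -/
theorem IsDualPairing.rightAction_mul_mulRightAction (hq : q ^ n = 1)
    (hB : IsAnyonicBraidedGroup q 𝒜 SB)
    (hC : IsAnyonicBraidedGroup q 𝒞 SC) (hev : IsDualPairing 𝒜 𝒞 ev)
    (hST : ∀ b, SC (T b) = b) (hTS : ∀ b, T (SC b) = b) (γ : AnyonGen k n →ₐ[k] Q)
    (ht : IsComatrix 𝒞 d t) (hs : IsComatrix 𝒜 p s) (i j : I) (a b : J) :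
    ∑ l, ∑ c, ev (t l j) (s c b) • (rightAction hq hB hC hev hST hTS γ (s a c) *
      genAction 𝒞 hq γ (gpow k (d j - d l)) * mulRightAction k C Q (MulOpposite.op (t i l))) =
    mulRightAction k C Q (MulOpposite.op (t i j)) *
      rightAction hq hB hC hev hST hTS γ (s a b) := by
  rw [rightAction_of_mem hq hB hC hev hST hTS γ (hs.mem a b), mulRightAction_op,
    Algebra.TensorProduct.tmul_mul_tmul, ← hev.rightCoaction_mul_mulRight hq hC hST hTS ht hs,
    TensorProduct.sum_tmul]
  refine Finset.sum_congr rfl fun l _ => ?_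
  rw [TensorProduct.sum_tmul]
  refine Finset.sum_congr rfl fun c _ => ?_
  by_cases h : (d j - d l) + (p b - p c) = 0
  · rw [rightAction_of_mem hq hB hC hev hST hTS γ (hs.mem a c), mulRightAction_op, genAction_gpow,
      Algebra.TensorProduct.tmul_mul_tmul, Algebra.TensorProduct.tmul_mul_tmul,
      TensorProduct.smul_tmul', one_mul, mul_one, ← map_mul, ← gpow_add,
      show -(p c - p a) + (d j - d l) = -(p b - p a) by linear_combination h]
  · rw [hev.ev_eq_zero ht hs h, zero_smul, zero_smul, TensorProduct.zero_tmul]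

end

end Representation

theorem sum_sum_comm {R K₁ K₂ K₃ K₄ : Type*} [AddCommMonoid R] [Fintype K₁] [Fintype K₂]
    [Fintype K₃] [Fintype K₄] (f : K₁ → K₂ → K₃ → K₄ → R) :
    ∑ a, ∑ b, ∑ c, ∑ d, f a b c d = ∑ c, ∑ d, ∑ a, ∑ b, f a b c d := by
  simp only [← Fintype.sum_prod_type' (f := fun _ _ => _)]
  exact Fintype.sum_equiv ⟨fun x => (x.2.2.1, x.2.2.2, x.1, x.2.1),
    fun x => (x.2.2.1, x.2.2.2, x.1, x.2.1), fun _ => rfl, fun _ => rfl⟩ _ _ fun _ => rfl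

/-! ### Commutation of an element with a convolution product -/

section ConvHom

variable {k : Type u} [Field k] {n : ℕ} [NeZero n] {q : k}
  {B : Type v} [Ring B] [Algebra k B] [Coalgebra k B] {𝒜 : ZMod n → Submodule k B}
  [GradedAlgebra 𝒜] {S : B →ₗ[k] B} {X : Type*} [Ring X] [Algebra k X]

/-- The degrees of the two legs of a comatrix entry add up to its degree, so the two scalars
multiply to the right one. This permits convolving a third action with a convolution product. -/
theorem mul_convHom (hq : q ^ n = 1) (hB : IsAnyonicBraidedGroup q 𝒜 S) (f f' : B →ₐ[k] X)
    (h : ∀ i j, ∀ x ∈ 𝒜 i, ∀ y ∈ 𝒜 j, f' x * f y = qpow q (i * j) • (f y * f' x))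
    {z : X} {a : ZMod n} (hf : ∀ i, ∀ b ∈ 𝒜 i, z * f b = qpow q (a * i) • (f b * z))
    (hf' : ∀ i, ∀ b ∈ 𝒜 i, z * f' b = qpow q (a * i) • (f' b * z)) (i : ZMod n) (b : B)
    (hb : b ∈ 𝒜 i) : z * convHom hB f f' h b = qpow q (a * i) • (convHom hB f f' h b * z) := by
  refine comatrix_induction_mem hB.comul_mem (P := fun i b => z * convHom hB f f' h b =
    qpow q (a * i) • (convHom hB f f' h b * z)) ?_ ?_ ?_ ?_ i b hb
  · intro i; simp
  · intro i x y hx hy; simp only [map_add, mul_add, add_mul, hx, hy, smul_add]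
  · intro i r x hx; simp only [map_smul, mul_smul_comm, smul_mul_assoc, hx, smul_comm r]
  intro m p t ht i j
  rw [convHom_comatrix hB f f' h ht, Finset.mul_sum, Finset.sum_mul, Finset.smul_sum]
  refine Finset.sum_congr rfl fun l _ => ?_
  rw [← mul_assoc, hf _ _ (ht.mem i l), smul_mul_assoc, mul_assoc, hf' _ _ (ht.mem l j),
    mul_smul_comm, smul_smul, ← qpow_add hq, ← mul_assoc, ← mul_add, sub_add_sub_cancel']

theorem convHom_mul (hq : q ^ n = 1) (hB : IsAnyonicBraidedGroup q 𝒜 S) (f f' : B →ₐ[k] X)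
    (h : ∀ i j, ∀ x ∈ 𝒜 i, ∀ y ∈ 𝒜 j, f' x * f y = qpow q (i * j) • (f y * f' x))
    {z : X} {a : ZMod n} (hf : ∀ i, ∀ b ∈ 𝒜 i, f b * z = qpow q (a * i) • (z * f b))
    (hf' : ∀ i, ∀ b ∈ 𝒜 i, f' b * z = qpow q (a * i) • (z * f' b)) (i : ZMod n) (b : B)
    (hb : b ∈ 𝒜 i) : convHom hB f f' h b * z = qpow q (a * i) • (z * convHom hB f f' h b) := by
  refine comatrix_induction_mem hB.comul_mem (P := fun i b => convHom hB f f' h b * z =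
    qpow q (a * i) • (z * convHom hB f f' h b)) ?_ ?_ ?_ ?_ i b hb
  · intro i; simp
  · intro i x y hx hy; simp only [map_add, mul_add, add_mul, hx, hy, smul_add]
  · intro i r x hx; simp only [map_smul, mul_smul_comm, smul_mul_assoc, hx, smul_comm r]
  intro m p t ht i j
  rw [convHom_comatrix hB f f' h ht, Finset.mul_sum, Finset.sum_mul, Finset.smul_sum]
  refine Finset.sum_congr rfl fun l _ => ?_
  rw [mul_assoc, hf' _ _ (ht.mem l j), mul_smul_comm, ← mul_assoc, hf _ _ (ht.mem i l),
    smul_mul_assoc, smul_smul, ← qpow_add hq, mul_assoc, ← mul_add, sub_add_sub_cancel]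

end ConvHom

/-! ### A faithful representation of the cross relations -/

section Representation

variable {k : Type u} [Field k] {n : ℕ} [NeZero n] {q : k}
  {B : Type v} [Ring B] [Algebra k B] [Coalgebra k B] {𝒜 : ZMod n → Submodule k B}
  [GradedAlgebra 𝒜] {SB : B →ₗ[k] B}
  {C : Type w} [Ring C] [Algebra k C] [Coalgebra k C] {𝒞 : ZMod n → Submodule k C}
  [GradedAlgebra 𝒞] {SC : C →ₗ[k] C} {ev : C →ₗ[k] B →ₗ[k] k} {T : C →ₗ[k] C}
  {Q : Type*} [Ring Q] [Algebra k Q]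

/-- The action of `B` on `C ⊗ Q`, the convolution product of the three elementary ones. -/
def fullAction (hq : q ^ n = 1) (hB : IsAnyonicBraidedGroup q 𝒜 SB)
    (hC : IsAnyonicBraidedGroup q 𝒞 SC) (hev : IsDualPairing 𝒜 𝒞 ev)
    (hST : ∀ b, SC (T b) = b) (hTS : ∀ b, T (SC b) = b) {γ : AnyonGen k n →ₐ[k] Q}
    {β : B →ₐ[k] Q}
    (hβ : ∀ a i : ZMod n, ∀ b ∈ 𝒜 i, β b * γ (gpow k a) = qpow q (a * i) • (γ (gpow k a) * β b)) :
    B →ₐ[k] Module.End k C ⊗[k] Q :=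
  convHom (X := Module.End k C ⊗[k] Q) hB (convHom (X := Module.End k C ⊗[k] Q) hB (leftAction hC hev γ) (innerAction C β)
      (innerAction_mul_leftAction hC hev hβ))
    (rightAction hq hB hC hev hST hTS γ)
    (fun i _ x hx y hy => mul_convHom hq hB _ _ _
      (fun j y hy => rightAction_mul_leftAction hq hB hC hev hST hTS γ i j x hx y hy)
      (fun j y hy => rightAction_mul_innerAction hq hB hC hev hST hTS hβ i j x hx y hy) _ y hy)

section

variable {hq : q ^ n = 1} {hB : IsAnyonicBraidedGroup q 𝒜 SB}
  {hC : IsAnyonicBraidedGroup q 𝒞 SC} {hev : IsDualPairing 𝒜 𝒞 ev}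
  {hST : ∀ b, SC (T b) = b} {hTS : ∀ b, T (SC b) = b} {γ : AnyonGen k n →ₐ[k] Q}
  {β : B →ₐ[k] Q}
  (hβ : ∀ a i : ZMod n, ∀ b ∈ 𝒜 i, β b * γ (gpow k a) = qpow q (a * i) • (γ (gpow k a) * β b))

theorem fullAction_comatrix {J : Type*} [Fintype J] [DecidableEq J] {p : J → ZMod n}
    {s : J → J → B} (hs : IsComatrix 𝒜 p s) (a b : J) :
    fullAction hq hB hC hev hST hTS hβ (s a b) = ∑ f, ∑ e, leftAction hC hev γ (s a e) *
      innerAction C β (s e f) * rightAction hq hB hC hev hST hTS γ (s f b) := by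
  rw [fullAction, convHom_comatrix hB _ _ _ hs]
  refine Finset.sum_congr rfl fun f _ => ?_
  rw [convHom_comatrix hB _ _ _ hs, Finset.sum_mul]

theorem isCrossRep_fullAction :
    IsCrossRep (X := Module.End k C ⊗[k] Q) q 𝒜 𝒞 ev (mulRightAction k C Q) (genAction 𝒞 hq γ)
      (fullAction hq hB hC hev hST hTS hβ) where
  B_g a i b hb := convHom_mul hq hB _ _ _
    (convHom_mul hq hB _ _ _ (fun i b hb => leftAction_mul_genAction hq hC hev γ a i hb)
      (fun i b hb => innerAction_mul_genAction hq hβ a i hb))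
    (fun i b hb => rightAction_mul_genAction hq hB hC hev hST hTS γ a i hb) i b hb
  C_g a i c hc := mulRightAction_mul_genAction hq γ a i c hc
  B_C m d t ht m' p s hs i j a b := by
    simp only [fullAction_comatrix hβ hs, Finset.sum_mul, Finset.mul_sum, Finset.smul_sum]
    -- Write the action of `b` as left, inner and right part. The right part absorbs the left side
    -- of the relation and leaves `c` in front of it, `c` commutes with the inner part, and moving
    -- it past the left part produces the right side.
    trans ∑ f, ∑ e, leftAction hC hev γ (s a e) * innerAction C β (s e f) * ∑ l, ∑ c,
      ev (t l j) (s c b) • (rightAction hq hB hC hev hST hTS γ (s f c) *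
      genAction 𝒞 hq γ (gpow k (d j - d l)) * mulRightAction k C Q (MulOpposite.op (t i l)))
    · simp only [Finset.mul_sum, mul_smul_comm, mul_assoc]
      exact sum_sum_comm _
    trans ∑ f, ∑ e, (leftAction hC hev γ (s a e) * mulRightAction k C Q (MulOpposite.op (t i j))) *
      innerAction C β (s e f) * rightAction hq hB hC hev hST hTS γ (s f b)
    · refine Finset.sum_congr rfl fun f _ => Finset.sum_congr rfl fun e _ => ?_
      rw [hev.rightAction_mul_mulRightAction hq hB hC hST hTS γ ht hs, ← mul_assoc,
        mul_assoc (leftAction hC hev γ (s a e)), innerAction_mul_mulRightAction]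
      simp only [mul_assoc]
    · simp only [hev.leftAction_mul_mulRightAction hq hC γ ht hs, Finset.sum_mul,
        smul_mul_assoc, mul_assoc]
      exact sum_sum_comm _

/-- Evaluating the first factor at `1` reduces a product of the three actions to the actions
on `Q`. -/
theorem mulRightAction_genAction_fullAction_apply {Z : Type*} [AddCommGroup Z] [Module k Z]
    (ζ : Q →ₗ[k] Z) (c : C) (a : ZMod n) (b : B) :
    TensorProduct.map (LinearMap.applyₗ (1 : C)) ζ
      (mulRightAction k C Q (MulOpposite.op c) * genAction 𝒞 hq γ (gpow k a) *
        fullAction hq hB hC hev hST hTS hβ b) = c ⊗ₜ ζ (γ (gpow k a) * β b) := by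
  have h1 : ∀ x, degreeScale q 𝒞 x (1 : C) = 1 := fun x => by
    rw [degreeScale_of_mem _ (SetLike.one_mem_graded 𝒞), mul_zero, qpow_zero, one_smul]
  refine comatrix_induction (𝒜 := 𝒜) hB.comul_mem (P := fun b =>
    TensorProduct.map (LinearMap.applyₗ (1 : C)) ζ
      (mulRightAction k C Q (MulOpposite.op c) * genAction 𝒞 hq γ (gpow k a) *
        fullAction hq hB hC hev hST hTS hβ b) = c ⊗ₜ ζ (γ (gpow k a) * β b)) ?_ ?_ ?_ ?_ b
  · simp
  · intro x y hx hy; simp only [map_add, mul_add, hx, hy, TensorProduct.tmul_add]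
  · intro r x hx; simp only [map_smul, mul_smul_comm, hx, TensorProduct.tmul_smul]
  intro m p s hs i j
  -- On `1 ∈ C` both contractions reduce to the counit, so only the term with `f = j` and `e = i`
  -- survives; the outer entries then have degree zero and contribute no power of `g`.
  rw [fullAction_comatrix hβ hs, Finset.mul_sum, map_sum, Finset.sum_eq_single j,
    Finset.mul_sum, map_sum, Finset.sum_eq_single i]
  · rw [leftAction_of_mem hC hev γ (hs.mem i i), innerAction_apply,
      rightAction_of_mem hq hB hC hev hST hTS γ (hs.mem j j), mulRightAction_op, genAction_gpow]
    simp only [Algebra.TensorProduct.tmul_mul_tmul, sub_self, neg_zero, gpow_zero, map_one,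
      mul_one, one_mul, TensorProduct.map_tmul, LinearMap.applyₗ_apply_apply, Module.End.mul_apply,
      rightCoaction_one hC, leftCoaction_one hC, h1, LinearMap.flip_apply,
      LinearMap.comp_apply, hC.inverse_one hTS, hev.ev_one_left, hs.counit, if_true, one_smul,
      LinearMap.mulRight_apply]
  · intro e _ he
    rw [leftAction_of_mem hC hev γ (hs.mem i e), innerAction_apply,
      rightAction_of_mem hq hB hC hev hST hTS γ (hs.mem j j), mulRightAction_op, genAction_gpow]
    simp only [Algebra.TensorProduct.tmul_mul_tmul,
      TensorProduct.map_tmul, LinearMap.applyₗ_apply_apply, Module.End.mul_apply, one_mul,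
      Module.End.one_apply,
      rightCoaction_one hC, leftCoaction_one hC, map_smul, h1, LinearMap.flip_apply,
      LinearMap.comp_apply, hC.inverse_one hTS, hev.ev_one_left, hs.counit, if_neg he.symm,
      zero_smul, smul_zero, TensorProduct.zero_tmul, map_zero]
  · simp
  · intro f _ hf
    rw [Finset.mul_sum, map_sum]
    refine Finset.sum_eq_zero fun e _ => ?_
    rw [leftAction_of_mem hC hev γ (hs.mem i e), innerAction_apply,
      rightAction_of_mem hq hB hC hev hST hTS γ (hs.mem f j), mulRightAction_op, genAction_gpow]
    simp only [Algebra.TensorProduct.tmul_mul_tmul,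
      TensorProduct.map_tmul, LinearMap.applyₗ_apply_apply, Module.End.mul_apply, one_mul,
      rightCoaction_one hC, LinearMap.flip_apply,
      LinearMap.comp_apply, hC.inverse_one hTS, hev.ev_one_left, hs.counit, if_neg hf,
      zero_smul, TensorProduct.zero_tmul, map_zero]
  · simp

end

variable (q) in
/-- The algebra automorphism `g ↦ q ^ i g`. -/
def anyonGenScale (hq : q ^ n = 1) (i : ZMod n) : AnyonGen k n →ₐ[k] AnyonGen k n :=
  AddMonoidAlgebra.lift k (AnyonGen k n) (ZMod n)
    { toFun := fun a => qpow q (a.toAdd * i) • gpow k a.toAdd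
      map_one' := by simp
      map_mul' := by
        intro a b
        rw [toAdd_mul, add_mul, qpow_add hq, gpow_add, smul_mul_smul_comm] }

theorem anyonGenScale_gpow (hq : q ^ n = 1) (i a : ZMod n) :
    anyonGenScale q hq i (gpow k a) = qpow q (a * i) • gpow k a := by
  simp [anyonGenScale, gpow]

theorem anyonGenScale_add (hq : q ^ n = 1) (i j : ZMod n) :
    (anyonGenScale q hq (i + j)).toLinearMap =
      (anyonGenScale q hq i).toLinearMap ∘ₗ (anyonGenScale q hq j).toLinearMap := by
  refine anyonGen_linearMap_ext fun a => ?_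
  simp only [AlgHom.toLinearMap_apply, LinearMap.comp_apply, anyonGenScale_gpow, map_smul,
    smul_smul, mul_add, qpow_add hq]
  rw [mul_comm]

theorem anyonGenScale_zero (hq : q ^ n = 1) :
    (anyonGenScale q hq (0 : ZMod n)).toLinearMap = LinearMap.id := by
  refine anyonGen_linearMap_ext fun a => ?_
  simp [anyonGenScale_gpow]

variable (k n B) in
/-- Left multiplication on the first factor of `k[ℤ/nℤ] ⊗ B`. -/
def smashGen : AnyonGen k n →ₐ[k] Module.End k (AnyonGen k n ⊗[k] B) :=
  (Module.End.rTensorAlgHom k (AnyonGen k n) B).comp (Algebra.lmul k (AnyonGen k n))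

theorem smashGen_apply (h : AnyonGen k n) :
    smashGen k n B h = TensorProduct.map (LinearMap.mulLeft k h) LinearMap.id := rfl

/-- The operator `h ⊗ b' ↦ q ^ (i |h|) h ⊗ b b'`, as a function of `b`. -/
def smashMulAux (hq : q ^ n = 1) (i : ZMod n) : B →ₗ[k] Module.End k (AnyonGen k n ⊗[k] B) :=
  TensorProduct.mapBilinear (RingHom.id k) _ _ _ _ (anyonGenScale q hq i).toLinearMap ∘ₗ
    LinearMap.mul k B

theorem smashMulAux_tmul (hq : q ^ n = 1) (i : ZMod n) (b b' : B) (h : AnyonGen k n) :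
    smashMulAux hq i b (h ⊗ₜ b') = anyonGenScale q hq i h ⊗ₜ (b * b') := rfl

variable (𝒜) in
/-- The action of `B` on `k[ℤ/nℤ] ⊗ B` by left multiplication in the smash product. -/
def smashMul (hq : q ^ n = 1) : B →ₐ[k] Module.End k (AnyonGen k n ⊗[k] B) :=
  byDegreeHom (𝒜 := 𝒜) (X := Module.End k (AnyonGen k n ⊗[k] B)) (smashMulAux hq)
    (by
      refine TensorProduct.ext' fun h b => ?_
      have := LinearMap.congr_fun (anyonGenScale_zero (n := n) hq) h
      rw [AlgHom.toLinearMap_apply] at this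
      rw [smashMulAux_tmul, this, one_mul]
      rfl)
    (by
      intro i j x _ y _
      refine TensorProduct.ext' fun h b => ?_
      have := LinearMap.congr_fun (anyonGenScale_add hq i j) h
      rw [LinearMap.comp_apply, AlgHom.toLinearMap_apply, AlgHom.toLinearMap_apply,
        AlgHom.toLinearMap_apply] at this
      rw [Module.End.mul_apply, smashMulAux_tmul, smashMulAux_tmul, smashMulAux_tmul, this,
        mul_assoc])

theorem smashMul_mul_smashGen (hq : q ^ n = 1) (a i : ZMod n) (b : B) (hb : b ∈ 𝒜 i) :
    smashMul 𝒜 hq b * smashGen k n B (gpow k a) =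
      qpow q (a * i) • (smashGen k n B (gpow k a) * smashMul 𝒜 hq b) := by
  have hsm : smashMul 𝒜 hq b = smashMulAux hq i b := byDegree_of_mem _ hb
  refine TensorProduct.ext' fun h b' => ?_
  rw [hsm, LinearMap.smul_apply, Module.End.mul_apply, Module.End.mul_apply, smashMulAux_tmul,
    smashGen_apply, TensorProduct.map_tmul, TensorProduct.map_tmul, smashMulAux_tmul,
    LinearMap.mulLeft_apply, LinearMap.mulLeft_apply, map_mul, anyonGenScale_gpow, smul_mul_assoc,
    ← TensorProduct.smul_tmul']
  rfl

theorem smashMul_apply_one (hq : q ^ n = 1) (b b' : B) :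
    smashMul 𝒜 hq b (1 ⊗ₜ b') = 1 ⊗ₜ (b * b') := by
  refine homogeneous_induction 𝒜 (P := fun b => smashMul 𝒜 hq b (1 ⊗ₜ b') = 1 ⊗ₜ (b * b'))
    ?_ (fun i x hx => ?_) b
  · intro x y hx hy
    rw [map_add, LinearMap.add_apply, hx, hy, add_mul, TensorProduct.tmul_add]
  · have hsm : smashMul 𝒜 hq x = smashMulAux hq i x := byDegree_of_mem _ hx
    rw [hsm, smashMulAux_tmul, map_one]

/-- Here `Q` consists of the operators on the smash product `H ⋉ B`, acting by left multiplication,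
and `ζ` is evaluation at `1 ⊗ 1`; thus ordered products `h b` are independent in `Q`. -/
theorem exists_smash_action (hq : q ^ n = 1) :
    ∃ (Q : Type (max u v)) (_ : Ring Q) (_ : Algebra k Q) (γ : AnyonGen k n →ₐ[k] Q)
      (β : B →ₐ[k] Q), (∀ a i : ZMod n, ∀ b ∈ 𝒜 i, β b * γ (gpow k a) =
        qpow q (a * i) • (γ (gpow k a) * β b)) ∧
      ∃ ζ : Q →ₗ[k] AnyonGen k n ⊗[k] B, ∀ a b, ζ (γ (gpow k a) * β b) = gpow k a ⊗ₜ b :=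
  ⟨Module.End k (AnyonGen k n ⊗[k] B), inferInstance, inferInstance, smashGen k n B,
    smashMul 𝒜 hq, smashMul_mul_smashGen hq, LinearMap.applyₗ (1 ⊗ₜ 1), fun a b => by
      rw [LinearMap.applyₗ_apply_apply, Module.End.mul_apply, smashMul_apply_one, mul_one,
        smashGen_apply, TensorProduct.map_tmul, LinearMap.mulLeft_apply, mul_one]
      rfl⟩

/-- Evaluating the operator of `c h b` at `1` gives back `c ⊗ (h ⊗ b)`, so the ordered product map
has the associativity isomorphism as a composite. -/
theorem injective_tripleMap_fullAction {hq : q ^ n = 1} {hB : IsAnyonicBraidedGroup q 𝒜 SB}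
    {hC : IsAnyonicBraidedGroup q 𝒞 SC} {hev : IsDualPairing 𝒜 𝒞 ev}
    {hST : ∀ b, SC (T b) = b} {hTS : ∀ b, T (SC b) = b} {γ : AnyonGen k n →ₐ[k] Q}
    {β : B →ₐ[k] Q}
    (hβ : ∀ a i : ZMod n, ∀ b ∈ 𝒜 i, β b * γ (gpow k a) = qpow q (a * i) • (γ (gpow k a) * β b))
    (ζ : Q →ₗ[k] AnyonGen k n ⊗[k] B)
    (hζ : ∀ a b, ζ (γ (gpow k a) * β b) = gpow k a ⊗ₜ b) :
    Function.Injective (tripleMap (X := Module.End k C ⊗[k] Q) (mulRightAction k C Q)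
      (genAction 𝒞 hq γ) (fullAction hq hB hC hev hST hTS hβ)) := by
  have hψ : (TensorProduct.map (LinearMap.applyₗ (1 : C)) ζ) ∘ₗ
      tripleMap (X := Module.End k C ⊗[k] Q) (mulRightAction k C Q) (genAction 𝒞 hq γ)
        (fullAction hq hB hC hev hST hTS hβ) =
      (TensorProduct.assoc k C (AnyonGen k n) B).toLinearMap := by
    refine TensorProduct.ext (TensorProduct.ext (LinearMap.ext fun c =>
      anyonGen_linearMap_ext fun a => LinearMap.ext fun b => ?_))
    change TensorProduct.map (LinearMap.applyₗ (1 : C)) ζ (tripleMap _ _ _ ((c ⊗ₜ gpow k a) ⊗ₜ b)) =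
      c ⊗ₜ (gpow k a ⊗ₜ b)
    rw [tripleMap_tmul, mulRightAction_genAction_fullAction_apply, hζ]
  have hinj := (TensorProduct.assoc k C (AnyonGen k n) B).injective
  rw [← LinearEquiv.coe_toLinearMap, ← hψ] at hinj
  exact Function.Injective.of_comp hinj

/-- The space `C ⊗ k[ℤ/nℤ] ⊗ B` carries a faithful representation of the cross relations. -/
theorem IsDualPairing.exists_faithful_crossRep (hq : q ^ n = 1) (hB : IsAnyonicBraidedGroup q 𝒜 SB)
    (hC : IsAnyonicBraidedGroup q 𝒞 SC) (hSC : Function.Bijective SC)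
    (hev : IsDualPairing 𝒜 𝒞 ev) :
    ∃ (X : Type (max u v w)) (_ : Ring X) (_ : Algebra k X) (fC : Cᵐᵒᵖ →ₐ[k] X)
      (fH : AnyonGen k n →ₐ[k] X) (fB : B →ₐ[k] X),
      IsCrossRep q 𝒜 𝒞 ev fC fH fB ∧ Function.Injective (tripleMap fC fH fB) := by
  let e := LinearEquiv.ofBijective SC hSC
  have hST : ∀ b, SC (e.symm.toLinearMap b) = b := e.apply_symm_apply
  have hTS : ∀ b, e.symm.toLinearMap (SC b) = b := e.symm_apply_apply
  obtain ⟨Q, _, _, γ, β, hβ, ζ, hζ⟩ := exists_smash_action (𝒜 := 𝒜) hq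
  exact ⟨Module.End k C ⊗[k] Q, inferInstance, inferInstance, mulRightAction k C Q,
    genAction 𝒞 hq γ, fullAction hq hB hC hev hST hTS hβ, isCrossRep_fullAction hβ,
    injective_tripleMap_fullAction hβ ζ hζ⟩

end Representation

/-! ### The underlying algebra -/

section Existence

variable {k : Type u} [Field k] {n : ℕ} [NeZero n] {q : k}
  {B : Type v} [Ring B] [Algebra k B] [Coalgebra k B] {𝒜 : ZMod n → Submodule k B}
  [GradedAlgebra 𝒜] {SB : B →ₗ[k] B}
  {C : Type w} [Ring C] [Algebra k C] [Coalgebra k C] {𝒞 : ZMod n → Submodule k C}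
  [GradedAlgebra 𝒞] {SC : C →ₗ[k] C} {ev : C →ₗ[k] B →ₗ[k] k}
  {A X : Type*} [Ring A] [Algebra k A] [Ring X] [Algebra k X]
  {jC : Cᵐᵒᵖ →ₐ[k] A} {jH : AnyonGen k n →ₐ[k] A} {jB : B →ₐ[k] A}

theorem IsCrossRep.of_injective (φ : A →ₐ[k] X) (hφ : Function.Injective φ)
    (h : IsCrossRep q 𝒜 𝒞 ev (φ.comp jC) (φ.comp jH) (φ.comp jB)) :
    IsCrossRep q 𝒜 𝒞 ev jC jH jB where
  B_g a i b hb := hφ <| by simpa using h.B_g a i b hb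
  C_g a i c hc := hφ <| by simpa using h.C_g a i c hc
  B_C m d t ht m' p s hs i j a b := hφ <| by simpa using h.B_C m d t ht m' p s hs i j a b

theorem comp_tripleMap (φ : A →ₐ[k] X) : φ.toLinearMap ∘ₗ tripleMap jC jH jB =
    tripleMap (φ.comp jC) (φ.comp jH) (φ.comp jB) := by
  refine TensorProduct.ext_threefold fun c h b => ?_
  simp [tripleMap_tmul]

/-- The algebra is the span of the ordered products in the faithful representation: a subalgebra by
normal ordering, and a copy of `C ⊗ H ⊗ B` by faithfulness. -/
theorem IsDualPairing.exists_crossRep_bijective (hq : q ^ n = 1)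
    (hB : IsAnyonicBraidedGroup q 𝒜 SB)
    (hC : IsAnyonicBraidedGroup q 𝒞 SC) (hSC : Function.Bijective SC)
    (hev : IsDualPairing 𝒜 𝒞 ev) :
    ∃ (A : Type (max u v w)) (_ : Ring A) (_ : Algebra k A) (jC : Cᵐᵒᵖ →ₐ[k] A)
      (jH : AnyonGen k n →ₐ[k] A) (jB : B →ₐ[k] A),
      IsCrossRep q 𝒜 𝒞 ev jC jH jB ∧ Function.Bijective (tripleMap jC jH jB) := by
  obtain ⟨X, _, _, fC, fH, fB, h, hinj⟩ := hev.exists_faithful_crossRep hq hB hC hSC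
  have hmul := h.range_mul_range_le hq hB hC hSC hev
  let A : Subalgebra k X := (LinearMap.range (tripleMap fC fH fB)).toSubalgebra
    ⟨(1 ⊗ₜ 1) ⊗ₜ 1, by rw [tripleMap_tmul, MulOpposite.op_one]; simp⟩
    (fun x y hx hy => hmul (Submodule.mul_mem_mul hx hy))
  let jC := fC.codRestrict A fun c => ⟨(c.unop ⊗ₜ 1) ⊗ₜ 1, by
    rw [tripleMap_tmul, MulOpposite.op_unop]; simp⟩
  let jH := fH.codRestrict A fun x => ⟨(1 ⊗ₜ x) ⊗ₜ 1, by
    rw [tripleMap_tmul, MulOpposite.op_one]; simp⟩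
  let jB := fB.codRestrict A fun b => ⟨(1 ⊗ₜ 1) ⊗ₜ b, by
    rw [tripleMap_tmul, MulOpposite.op_one]; simp⟩
  have hval : ∀ x, (tripleMap jC jH jB x : X) = tripleMap fC fH fB x :=
    LinearMap.congr_fun (comp_tripleMap (jC := jC) (jH := jH) (jB := jB) A.val)
  refine ⟨A, inferInstance, inferInstance, jC, jH, jB,
    IsCrossRep.of_injective A.val Subtype.val_injective h, ?_, ?_⟩
  · intro x y hxy
    exact hinj (by rw [← hval, ← hval, hxy])
  · rintro ⟨_, x, rfl⟩
    exact ⟨x, Subtype.ext (hval x)⟩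

end Existence

/-! ### The coproduct on generators respects the cross relations -/

section Coproduct

variable {k : Type u} [Field k] {n : ℕ} [NeZero n] {q : k}
  {B : Type v} [Ring B] [Algebra k B] [Coalgebra k B] {𝒜 : ZMod n → Submodule k B}
  [GradedAlgebra 𝒜] {SB : B →ₗ[k] B}
  {C : Type w} [Ring C] [Algebra k C] [Coalgebra k C] {𝒞 : ZMod n → Submodule k C}
  [GradedAlgebra 𝒞] {SC : C →ₗ[k] C} {ev : C →ₗ[k] B →ₗ[k] k}
  {A : Type*} [Ring A] [Algebra k A]
  {jC : Cᵐᵒᵖ →ₐ[k] A} {jH : AnyonGen k n →ₐ[k] A} {jB : B →ₐ[k] A}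

variable (𝒜) in
/-- The homomorphism `b ↦ b ⊗ g ^ |b|`. -/
def tensorDegreeB (jH : AnyonGen k n →ₐ[k] A) (jB : B →ₐ[k] A) : B →ₐ[k] A ⊗[k] A :=
  byDegreeHom (𝒜 := 𝒜) (X := A ⊗[k] A)
    (fun i => (TensorProduct.mk k A A).flip (jH (gpow k i)) ∘ₗ jB.toLinearMap)
    (by simp [Algebra.TensorProduct.one_def])
    (by
      intro i j x _ y _
      simp [gpow_add])

theorem tensorDegreeB_of_mem {i : ZMod n} {b : B} (hb : b ∈ 𝒜 i) :
    tensorDegreeB 𝒜 jH jB b = jB b ⊗ₜ jH (gpow k i) :=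
  byDegree_of_mem (fun i => (TensorProduct.mk k A A).flip (jH (gpow k i)) ∘ₗ jB.toLinearMap) hb

variable (𝒞) in
/-- The homomorphism `c ↦ g ^ |c| ⊗ c` into the opposite algebra. -/
def degreeTensorC (jC : Cᵐᵒᵖ →ₐ[k] A) (jH : AnyonGen k n →ₐ[k] A) : C →ₐ[k] (A ⊗[k] A)ᵐᵒᵖ :=
  byDegreeHom (𝒜 := 𝒞) (X := (A ⊗[k] A)ᵐᵒᵖ)
    (fun i => (MulOpposite.opLinearEquiv k).toLinearMap ∘ₗ TensorProduct.mk k A A (jH (gpow k i)) ∘ₗ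
      jC.toLinearMap ∘ₗ (MulOpposite.opLinearEquiv k).toLinearMap)
    (by simp [← Algebra.TensorProduct.one_def])
    (by
      intro i j x _ y _
      simp only [LinearMap.comp_apply, LinearEquiv.coe_coe, MulOpposite.coe_opLinearEquiv,
        AlgHom.toLinearMap_apply, TensorProduct.mk_apply, ← MulOpposite.op_mul,
        Algebra.TensorProduct.tmul_mul_tmul, add_comm i j, gpow_add, map_mul]
      rw [MulOpposite.op_mul, map_mul])

theorem degreeTensorC_of_mem {i : ZMod n} {c : C} (hc : c ∈ 𝒞 i) :
    degreeTensorC 𝒞 jC jH c =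
      MulOpposite.op (jH (gpow k i) ⊗ₜ jC (MulOpposite.op c)) :=
  byDegree_of_mem (fun i => (MulOpposite.opLinearEquiv k).toLinearMap ∘ₗ
    TensorProduct.mk k A A (jH (gpow k i)) ∘ₗ
      jC.toLinearMap ∘ₗ (MulOpposite.opLinearEquiv k).toLinearMap) hc

/-- The coproduct on `B`, namely `b ↦ b₍₁₎ ⊗ g ^ |b₍₁₎| b₍₂₎`. -/
def IsCrossRep.comulB (h : IsCrossRep q 𝒜 𝒞 ev jC jH jB) (hB : IsAnyonicBraidedGroup q 𝒜 SB) :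
    B →ₐ[k] A ⊗[k] A :=
  convHom (X := A ⊗[k] A) hB (tensorDegreeB 𝒜 jH jB)
    (Algebra.TensorProduct.includeRight.comp jB) (by
      intro i j x hx y hy
      rw [tensorDegreeB_of_mem hy, AlgHom.comp_apply, Algebra.TensorProduct.includeRight_apply,
        Algebra.TensorProduct.tmul_mul_tmul, Algebra.TensorProduct.tmul_mul_tmul, one_mul, mul_one,
        h.B_g j i x hx, TensorProduct.tmul_smul, mul_comm j])

theorem IsCrossRep.comulB_comatrix (h : IsCrossRep q 𝒜 𝒞 ev jC jH jB)
    (hB : IsAnyonicBraidedGroup q 𝒜 SB) {J : Type*} [Fintype J] [DecidableEq J] {p : J → ZMod n}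
    {s : J → J → B} (hs : IsComatrix 𝒜 p s) (a b : J) :
    h.comulB hB (s a b) = ∑ c, jB (s a c) ⊗ₜ (jH (gpow k (p c - p a)) * jB (s c b)) := by
  rw [IsCrossRep.comulB, convHom_comatrix hB _ _ _ hs]
  refine Finset.sum_congr rfl fun c _ => ?_
  rw [tensorDegreeB_of_mem (hs.mem a c), AlgHom.comp_apply,
    Algebra.TensorProduct.includeRight_apply, Algebra.TensorProduct.tmul_mul_tmul, mul_one]

/-- The maps into the opposite algebra serve to treat `Cᵒᵖ` by `convHom`, which needs algebra maps
out of `C`. -/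
theorem IsCrossRep.degreeTensorC_mul (h : IsCrossRep q 𝒜 𝒞 ev jC jH jB) (i j : ZMod n) (x : C)
    (hx : x ∈ 𝒞 i) (y : C) (hy : y ∈ 𝒞 j) :
    degreeTensorC 𝒞 jC jH x *
      AlgHom.opComm.symm (Algebra.TensorProduct.includeLeft.comp jC : Cᵐᵒᵖ →ₐ[k] A ⊗[k] A) y =
    qpow q (i * j) •
      (AlgHom.opComm.symm (Algebra.TensorProduct.includeLeft.comp jC : Cᵐᵒᵖ →ₐ[k] A ⊗[k] A) y *
        degreeTensorC 𝒞 jC jH x) := by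
  rw [degreeTensorC_of_mem hx]
  change MulOpposite.op ((jC (MulOpposite.op y) ⊗ₜ 1) * (_ ⊗ₜ _)) =
    _ • MulOpposite.op ((_ ⊗ₜ _) * (jC (MulOpposite.op y) ⊗ₜ 1))
  rw [Algebra.TensorProduct.tmul_mul_tmul, Algebra.TensorProduct.tmul_mul_tmul, one_mul,
    mul_one, h.C_g i j y hy, ← TensorProduct.smul_tmul', MulOpposite.op_smul]

/-- The coproduct on `C`, namely `c ↦ g ^ |c₍₂₎| c₍₁₎ ⊗ c₍₂₎`. -/
def IsCrossRep.comulC (h : IsCrossRep q 𝒜 𝒞 ev jC jH jB) (hC : IsAnyonicBraidedGroup q 𝒞 SC) :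
    Cᵐᵒᵖ →ₐ[k] A ⊗[k] A :=
  AlgHom.opComm (convHom (X := (A ⊗[k] A)ᵐᵒᵖ) hC
    (AlgHom.opComm.symm (Algebra.TensorProduct.includeLeft.comp jC)) (degreeTensorC 𝒞 jC jH)
    h.degreeTensorC_mul)

theorem IsCrossRep.comulC_comatrix (h : IsCrossRep q 𝒜 𝒞 ev jC jH jB)
    (hC : IsAnyonicBraidedGroup q 𝒞 SC) {I : Type*} [Fintype I] [DecidableEq I] {d : I → ZMod n}
    {t : I → I → C} (ht : IsComatrix 𝒞 d t) (i j : I) :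
    h.comulC hC (MulOpposite.op (t i j)) = ∑ l, (jH (gpow k (d j - d l)) *
      jC (MulOpposite.op (t i l))) ⊗ₜ jC (MulOpposite.op (t l j)) := by
  change MulOpposite.unop (convHom (X := (A ⊗[k] A)ᵐᵒᵖ) hC _ _
    h.degreeTensorC_mul (t i j)) = _
  rw [convHom_comatrix hC _ _ _ ht, Finset.unop_sum]
  refine Finset.sum_congr rfl fun l _ => ?_
  rw [degreeTensorC_of_mem (ht.mem l j)]
  change (_ ⊗ₜ _) * (jC (MulOpposite.op (t i l)) ⊗ₜ 1) = _
  rw [Algebra.TensorProduct.tmul_mul_tmul, mul_one]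

/-- The coproduct on `k[ℤ/nℤ]`, namely `g ↦ g ⊗ g`. -/
def comulH (jH : AnyonGen k n →ₐ[k] A) : AnyonGen k n →ₐ[k] A ⊗[k] A :=
  (Algebra.TensorProduct.map jH jH).comp (Bialgebra.comulAlgHom k (AnyonGen k n))

theorem comulH_gpow (a : ZMod n) :
    comulH jH (gpow k a) = jH (gpow k a) ⊗ₜ jH (gpow k a) := by
  rw [comulH, AlgHom.comp_apply, Bialgebra.comulAlgHom_apply, comul_gpow,
    Algebra.TensorProduct.map_tmul]

theorem IsCrossRep.C_mul_gpow_comm (hq : q ^ n = 1) (h : IsCrossRep q 𝒜 𝒞 ev jC jH jB)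
    (a i : ZMod n) {c : C}
    (hc : c ∈ 𝒞 i) : jH (gpow k a) * jC (MulOpposite.op c) =
      qpow q (-(a * i)) • (jC (MulOpposite.op c) * jH (gpow k a)) := by
  rw [h.C_g a i c hc, smul_smul, ← qpow_add hq, neg_add_cancel, qpow_zero, one_smul]

/-- For the relation between `B` and `C`, apply the cross relation of `A` in the second tensor
factor, redistribute powers of `g`, and apply it again in the first factor. -/
theorem IsCrossRep.isCrossRep_comul (hq : q ^ n = 1) (h : IsCrossRep q 𝒜 𝒞 ev jC jH jB)
    (hB : IsAnyonicBraidedGroup q 𝒜 SB) (hC : IsAnyonicBraidedGroup q 𝒞 SC) :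
    IsCrossRep (X := A ⊗[k] A) q 𝒜 𝒞 ev (h.comulC hC) (comulH jH) (h.comulB hB) where
  B_g a i b hb := by
    refine convHom_mul hq hB _ _ _ (fun i b hb => ?_) (fun i b hb => ?_) i b hb
    · rw [tensorDegreeB_of_mem hb, comulH_gpow, Algebra.TensorProduct.tmul_mul_tmul,
        Algebra.TensorProduct.tmul_mul_tmul, h.B_g a i b hb, gpow_map_comm,
        TensorProduct.smul_tmul']
    · rw [comulH_gpow, AlgHom.comp_apply, Algebra.TensorProduct.includeRight_apply,
        Algebra.TensorProduct.tmul_mul_tmul,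
        Algebra.TensorProduct.tmul_mul_tmul, h.B_g a i b hb, one_mul, mul_one,
        TensorProduct.tmul_smul]
  C_g a i c hc := by
    refine comatrix_induction_mem hC.comul_mem (P := fun i c =>
      h.comulC hC (MulOpposite.op c) * comulH jH (gpow k a) =
        qpow q (a * i) • (comulH jH (gpow k a) * h.comulC hC (MulOpposite.op c))) ?_ ?_ ?_ ?_ i c hc
    · intro i; simp
    · intro i x y hx hy; simp only [MulOpposite.op_add, map_add, mul_add, add_mul, hx, hy, smul_add]
    · intro i r x hx
      simp only [MulOpposite.op_smul, map_smul, mul_smul_comm, smul_mul_assoc, hx, smul_comm r]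
    intro m d t ht i j
    rw [h.comulC_comatrix hC ht, Finset.mul_sum, Finset.sum_mul, Finset.smul_sum]
    refine Finset.sum_congr rfl fun l _ => ?_
    rw [comulH_gpow, Algebra.TensorProduct.tmul_mul_tmul, Algebra.TensorProduct.tmul_mul_tmul,
      mul_assoc, h.C_g _ _ _ (ht.mem i l), h.C_g _ _ _ (ht.mem l j), mul_smul_comm, ← mul_assoc,
      gpow_map_comm, TensorProduct.tmul_smul, ← TensorProduct.smul_tmul', smul_smul,
      ← qpow_add hq, mul_assoc, ← mul_add, sub_add_sub_cancel]
  B_C m d t ht m' p s hs i j a b := by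
    have hl : ∀ l c, ev (t l j) (s c b) • (h.comulB hB (s a c) *
        comulH jH (gpow k (d j - d l)) * h.comulC hC (MulOpposite.op (t i l))) =
        ∑ e, ∑ f, (jB (s a e) * jH (gpow k (d j - d f)) * jC (MulOpposite.op (t i f))) ⊗ₜ[k]
          (jH (gpow k (p e - p a)) * (ev (t l j) (s c b) • (jB (s e c) *
            jH (gpow k (d j - d l)) * jC (MulOpposite.op (t f l))))) := by
      intro l c
      rw [h.comulB_comatrix hB hs, h.comulC_comatrix hC ht, comulH_gpow, Finset.sum_mul,
        Finset.sum_mul, Finset.smul_sum]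
      refine Finset.sum_congr rfl fun e _ => ?_
      rw [Finset.mul_sum, Finset.smul_sum]
      refine Finset.sum_congr rfl fun f _ => ?_
      rw [Algebra.TensorProduct.tmul_mul_tmul, Algebra.TensorProduct.tmul_mul_tmul,
        mul_smul_comm, TensorProduct.tmul_smul, ← sub_add_sub_cancel (d j) (d l) (d f), gpow_add,
        map_mul]
      simp only [mul_assoc]
    have hr : ∀ l c, ev (t i l) (s a c) • (h.comulC hC (MulOpposite.op (t l j)) *
        comulH jH (gpow k (p c - p a)) * h.comulB hB (s c b)) =
        ∑ f, ∑ e, (jH (gpow k (d j - d f)) * (ev (t i l) (s a c) • (jC (MulOpposite.op (t l f)) *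
          jH (gpow k (p c - p a)) * jB (s c e)))) ⊗ₜ[k] (jC (MulOpposite.op (t f j)) *
            jH (gpow k (p e - p a)) * jB (s e b)) := by
      intro l c
      rw [h.comulB_comatrix hB hs, h.comulC_comatrix hC ht, comulH_gpow, Finset.sum_mul,
        Finset.sum_mul, Finset.smul_sum]
      refine Finset.sum_congr rfl fun f _ => ?_
      rw [Finset.mul_sum, Finset.smul_sum]
      refine Finset.sum_congr rfl fun e _ => ?_
      rw [Algebra.TensorProduct.tmul_mul_tmul, Algebra.TensorProduct.tmul_mul_tmul,
        mul_smul_comm, ← TensorProduct.smul_tmul', ← sub_add_sub_cancel' (p c) (p a) (p e),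
        gpow_add, map_mul]
      simp only [mul_assoc]
    -- The passage between the two applications: `g ^ (d j - d l)` moves to the front of the first
    -- factor past `s a e`, and `g ^ (p e - p a)` moves past `t l j` in the second. The two scalars
    -- are inverse to each other.
    have hm : ∀ e f l c, (jB (s a e) * jH (gpow k (d j - d f)) * jC (MulOpposite.op (t i f))) ⊗ₜ[k]
        (jH (gpow k (p e - p a)) * (ev (t f l) (s e c) • (jC (MulOpposite.op (t l j)) *
          jH (gpow k (p c - p e)) * jB (s c b)))) =
        (jH (gpow k (d j - d l)) * (ev (t f l) (s e c) • (jB (s a e) * jH (gpow k (d l - d f)) *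
          jC (MulOpposite.op (t i f))))) ⊗ₜ[k] (jC (MulOpposite.op (t l j)) *
            jH (gpow k (p c - p a)) * jB (s c b)) := by
      intro e f l c
      rw [← sub_add_sub_cancel (d j) (d l) (d f), gpow_add, map_mul, ← mul_assoc (jB (s a e)),
        h.B_g _ _ _ (hs.mem a e), mul_smul_comm, mul_smul_comm, ← mul_assoc (jH _), ← mul_assoc (jH _),
        h.C_mul_gpow_comm hq _ _ (ht.mem l j), ← sub_add_sub_cancel' (p e) (p a) (p c), gpow_add,
        map_mul]
      simp only [smul_mul_assoc, ← TensorProduct.smul_tmul', TensorProduct.tmul_smul, smul_smul]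
      rw [mul_assoc (ev _ _), ← qpow_add hq, mul_comm (p e - p a), neg_add_cancel, qpow_zero, mul_one]
      simp only [mul_assoc]
    simp only [hl, hr]
    rw [sum_sum_comm]
    simp only [← TensorProduct.tmul_sum, ← Finset.mul_sum, h.B_C m d t ht m' p s hs _ j _ b]
    simp only [Finset.mul_sum, TensorProduct.tmul_sum, hm]
    rw [sum_sum_comm]
    conv_rhs => rw [sum_sum_comm]
    refine Finset.sum_congr rfl fun l _ => Finset.sum_congr rfl fun c _ => ?_
    rw [Finset.sum_comm]
    simp only [← TensorProduct.sum_tmul, ← Finset.mul_sum]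
    rw [h.B_C m d t ht m' p s hs]

end Coproduct

/-! ### Coproduct and counit from the universal property -/

section Bialgebra

variable {k : Type u} [Field k] {n : ℕ} [NeZero n] {q : k}
  {B : Type v} [Ring B] [Algebra k B] [Coalgebra k B] {𝒜 : ZMod n → Submodule k B}
  [GradedAlgebra 𝒜] {SB : B →ₗ[k] B}
  {C : Type w} [Ring C] [Algebra k C] [Coalgebra k C] {𝒞 : ZMod n → Submodule k C}
  [GradedAlgebra 𝒞] {SC : C →ₗ[k] C} {ev : C →ₗ[k] B →ₗ[k] k}
  {A X : Type*} [Ring A] [Algebra k A] [Ring X] [Algebra k X]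
  {jC : Cᵐᵒᵖ →ₐ[k] A} {jH : AnyonGen k n →ₐ[k] A} {jB : B →ₐ[k] A}

/-- The counit of an anyonic braided group as an algebra homomorphism. -/
def IsAnyonicBraidedGroup.counitHom (hB : IsAnyonicBraidedGroup q 𝒜 SB) : B →ₐ[k] k :=
  AlgHom.ofLinearMap Coalgebra.counit hB.counit_one hB.counit_mul

/-- The counit of an anyonic braided group as an algebra homomorphism on the opposite algebra. -/
def IsAnyonicBraidedGroup.counitHomOp (hB : IsAnyonicBraidedGroup q 𝒜 SB) : Bᵐᵒᵖ →ₐ[k] k :=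
  AlgHom.ofLinearMap (Coalgebra.counit ∘ₗ (MulOpposite.opLinearEquiv k).symm.toLinearMap)
    hB.counit_one fun x y => by
      change Coalgebra.counit (y.unop * x.unop) = _
      rw [hB.counit_mul, mul_comm]
      rfl

/-- The counits vanish outside degree zero, so the scalars disappear; on comatrices both sides of
the relation between `B` and `C` reduce to `ev (t i j) (s a b)`. -/
theorem isCrossRep_counit (hB : IsAnyonicBraidedGroup q 𝒜 SB)
    (hC : IsAnyonicBraidedGroup q 𝒞 SC) :
    IsCrossRep q 𝒜 𝒞 ev hC.counitHomOp (Bialgebra.counitAlgHom k (AnyonGen k n))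
      hB.counitHom where
  B_g a i b hb := by
    change Coalgebra.counit b * _ = _ • (_ * Coalgebra.counit b)
    by_cases hi : i = 0
    · rw [hi, mul_zero, qpow_zero, one_smul, mul_comm]
    · rw [hB.counit_of_mem i b hb hi]; simp
  C_g a i c hc := by
    change Coalgebra.counit c * _ = _ • (_ * Coalgebra.counit c)
    by_cases hi : i = 0
    · rw [hi, mul_zero, qpow_zero, one_smul, mul_comm]
    · rw [hC.counit_of_mem i c hc hi]; simp
  B_C m d t ht m' p s hs i j a b := by
    change ∑ l, ∑ c, ev (t l j) (s c b) • (Coalgebra.counit (s a c) *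
      Coalgebra.counit (R := k) (gpow k (d j - d l)) * Coalgebra.counit (R := k) (t i l)) =
      ∑ l, ∑ c, ev (t i l) (s a c) • (Coalgebra.counit (R := k) (t l j) *
      Coalgebra.counit (R := k) (gpow k (p c - p a)) * Coalgebra.counit (R := k) (s c b))
    simp [hs.counit, ht.counit, counit_gpow]

theorem IsCrossRep.algHom_ext_comatrix (hB : IsAnyonicBraidedGroup q 𝒜 SB)
    (hC : IsAnyonicBraidedGroup q 𝒞 SC)
    (hsurj : Function.Surjective (tripleMap jC jH jB)) {F F' : A →ₐ[k] X}
    (hFC : ∀ (m : ℕ) (d : Fin m → ZMod n) (t : Fin m → Fin m → C), IsComatrix 𝒞 d t →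
      ∀ i j, F (jC (MulOpposite.op (t i j))) = F' (jC (MulOpposite.op (t i j))))
    (hFH : ∀ a, F (jH (gpow k a)) = F' (jH (gpow k a)))
    (hFB : ∀ (m : ℕ) (p : Fin m → ZMod n) (s : Fin m → Fin m → B), IsComatrix 𝒜 p s →
      ∀ i j, F (jB (s i j)) = F' (jB (s i j))) : F = F' := by
  refine IsCrossRep.algHom_ext hsurj (fun c => ?_) hFH (fun b => ?_)
  · exact LinearMap.congr_fun (hC.linearMap_ext
      (f := F.toLinearMap ∘ₗ jC.toLinearMap ∘ₗ (MulOpposite.opLinearEquiv k).toLinearMap)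
      (f' := F'.toLinearMap ∘ₗ jC.toLinearMap ∘ₗ (MulOpposite.opLinearEquiv k).toLinearMap) hFC)
      c.unop
  · exact LinearMap.congr_fun (hB.linearMap_ext (f := F.toLinearMap ∘ₗ jB.toLinearMap)
      (f' := F'.toLinearMap ∘ₗ jB.toLinearMap) hFB) b

/-- The explicit coproducts and counits on the generators of the double-bosonisation. -/
structure HasCrossCoproduct (𝒜 : ZMod n → Submodule k B) (𝒞 : ZMod n → Submodule k C)
    (jC : Cᵐᵒᵖ →ₐ[k] A) (jH : AnyonGen k n →ₐ[k] A) (jB : B →ₐ[k] A)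
    (Δ : A →ₐ[k] A ⊗[k] A) (ε : A →ₐ[k] k) : Prop where
  comul_C : ∀ (m : ℕ) (d : Fin m → ZMod n) (t : Fin m → Fin m → C), IsComatrix 𝒞 d t →
    ∀ i j, Δ (jC (MulOpposite.op (t i j))) = ∑ l, (jH (gpow k (d j - d l)) *
      jC (MulOpposite.op (t i l))) ⊗ₜ jC (MulOpposite.op (t l j))
  comul_H : ∀ a, Δ (jH (gpow k a)) = jH (gpow k a) ⊗ₜ jH (gpow k a)
  comul_B : ∀ (m : ℕ) (p : Fin m → ZMod n) (s : Fin m → Fin m → B), IsComatrix 𝒜 p s →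
    ∀ a b, Δ (jB (s a b)) = ∑ c, jB (s a c) ⊗ₜ (jH (gpow k (p c - p a)) * jB (s c b))
  counit_C : ∀ c, ε (jC (MulOpposite.op c)) = Coalgebra.counit c
  counit_H : ∀ a, ε (jH (gpow k a)) = 1
  counit_B : ∀ b, ε (jB b) = Coalgebra.counit b

theorem IsCrossRep.exists_coproduct (hq : q ^ n = 1)
    (hB : IsAnyonicBraidedGroup q 𝒜 SB) (hC : IsAnyonicBraidedGroup q 𝒞 SC)
    (hSC : Function.Bijective SC) (hev : IsDualPairing 𝒜 𝒞 ev)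
    (h : IsCrossRep q 𝒜 𝒞 ev jC jH jB) (hbij : Function.Bijective (tripleMap jC jH jB)) :
    ∃ (Δ : A →ₐ[k] A ⊗[k] A) (ε : A →ₐ[k] k), HasCrossCoproduct 𝒜 𝒞 jC jH jB Δ ε := by
  obtain ⟨Δ, hΔC, hΔH, hΔB⟩ := h.exists_lift hq hB hC hSC hev hbij (h.isCrossRep_comul hq hB hC)
  obtain ⟨ε, hεC, hεH, hεB⟩ := h.exists_lift hq hB hC hSC hev hbij (isCrossRep_counit hB hC)
  refine ⟨Δ, ε, ⟨fun m d t ht i j => ?_, fun a => ?_, fun m p s hs a b => ?_, fun c => ?_,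
    fun a => ?_, fun b => ?_⟩⟩
  · rw [hΔC, h.comulC_comatrix hC ht]
  · rw [hΔH, comulH_gpow]
  · rw [hΔB, h.comulB_comatrix hB hs]
  · rw [hεC]; rfl
  · rw [hεH]; exact counit_gpow a
  · rw [hεB]; rfl

variable {Δ : A →ₐ[k] A ⊗[k] A} {ε : A →ₐ[k] k}

/-- Both sides are algebra maps, so the generators suffice; there the powers of `g` combine because
degree differences along a comatrix telescope. -/
theorem HasCrossCoproduct.coassoc (hB : IsAnyonicBraidedGroup q 𝒜 SB)
    (hC : IsAnyonicBraidedGroup q 𝒞 SC) (hsurj : Function.Surjective (tripleMap jC jH jB))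
    (h : HasCrossCoproduct 𝒜 𝒞 jC jH jB Δ ε) :
    (Algebra.TensorProduct.assoc k k k A A A).toAlgHom.comp
      ((Algebra.TensorProduct.map Δ (.id k A)).comp Δ) =
      (Algebra.TensorProduct.map (.id k A) Δ).comp Δ := by
  refine IsCrossRep.algHom_ext_comatrix hB hC hsurj (fun m d t ht i j => ?_) (fun a => ?_)
    (fun m p s hs a b => ?_)
  · simp only [AlgHom.comp_apply, h.comul_C m d t ht, map_sum, Algebra.TensorProduct.map_tmul,
      map_mul, h.comul_H, Finset.mul_sum, TensorProduct.sum_tmul, TensorProduct.tmul_sum,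
      Algebra.TensorProduct.tmul_mul_tmul, AlgHom.id_apply]
    rw [Finset.sum_comm]
    refine Finset.sum_congr rfl fun f _ => Finset.sum_congr rfl fun l _ => ?_
    rw [← mul_assoc, ← map_mul, ← gpow_add, sub_add_sub_cancel]
    rfl
  · simp only [AlgHom.comp_apply, h.comul_H, Algebra.TensorProduct.map_tmul, AlgHom.id_apply]
    rfl
  · simp only [AlgHom.comp_apply, h.comul_B m p s hs, map_sum, Algebra.TensorProduct.map_tmul,
      map_mul, h.comul_H, Finset.mul_sum, TensorProduct.sum_tmul, TensorProduct.tmul_sum,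
      Algebra.TensorProduct.tmul_mul_tmul, AlgHom.id_apply]
    rw [Finset.sum_comm]
    refine Finset.sum_congr rfl fun f _ => Finset.sum_congr rfl fun l _ => ?_
    rw [← mul_assoc, ← map_mul jH, ← gpow_add, sub_add_sub_cancel']
    rfl

theorem HasCrossCoproduct.rTensor (hB : IsAnyonicBraidedGroup q 𝒜 SB)
    (hC : IsAnyonicBraidedGroup q 𝒞 SC) (hsurj : Function.Surjective (tripleMap jC jH jB))
    (h : HasCrossCoproduct 𝒜 𝒞 jC jH jB Δ ε) :
    (Algebra.TensorProduct.map ε (.id k A)).comp Δ = (Algebra.TensorProduct.lid k A).symm := by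
  refine IsCrossRep.algHom_ext_comatrix hB hC hsurj (fun m d t ht i j => ?_) (fun a => ?_)
    (fun m p s hs a b => ?_)
  · rw [AlgHom.comp_apply, h.comul_C m d t ht, map_sum, Finset.sum_eq_single i]
    · simp [h.counit_H, h.counit_C, ht.counit]
    · intro l _ hl
      simp [h.counit_C, ht.counit, hl.symm]
    · simp
  · simp [h.comul_H, h.counit_H]
  · rw [AlgHom.comp_apply, h.comul_B m p s hs, map_sum, Finset.sum_eq_single a]
    · simp [h.counit_B, hs.counit]
    · intro l _ hl
      simp [h.counit_B, hs.counit, hl.symm]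
    · simp

theorem HasCrossCoproduct.lTensor (hB : IsAnyonicBraidedGroup q 𝒜 SB)
    (hC : IsAnyonicBraidedGroup q 𝒞 SC) (hsurj : Function.Surjective (tripleMap jC jH jB))
    (h : HasCrossCoproduct 𝒜 𝒞 jC jH jB Δ ε) :
    (Algebra.TensorProduct.map (.id k A) ε).comp Δ = (Algebra.TensorProduct.rid k k A).symm := by
  refine IsCrossRep.algHom_ext_comatrix hB hC hsurj (fun m d t ht i j => ?_) (fun a => ?_)
    (fun m p s hs a b => ?_)
  · rw [AlgHom.comp_apply, h.comul_C m d t ht, map_sum, Finset.sum_eq_single j]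
    · simp [h.counit_C, ht.counit]
    · intro l _ hl
      simp [h.counit_C, ht.counit, hl]
    · simp
  · simp [h.comul_H, h.counit_H]
  · rw [AlgHom.comp_apply, h.comul_B m p s hs, map_sum, Finset.sum_eq_single b]
    · simp [h.counit_B, h.counit_H, hs.counit]
    · intro l _ hl
      simp [h.counit_B, hs.counit, hl]
    · simp

end Bialgebra

/-! ### The antipode of the double-bosonisation -/

section Antipode

variable {k : Type u} [Field k] {n : ℕ} [NeZero n] {q : k}
  {B : Type v} [Ring B] [Algebra k B] [Coalgebra k B] {𝒜 : ZMod n → Submodule k B}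
  [GradedAlgebra 𝒜] {SB : B →ₗ[k] B}
  {C : Type w} [Ring C] [Algebra k C] [Coalgebra k C] {𝒞 : ZMod n → Submodule k C}
  [GradedAlgebra 𝒞] {SC : C →ₗ[k] C} {ev : C →ₗ[k] B →ₗ[k] k} {T : C →ₗ[k] C}
  {A : Type*} [Ring A] [Algebra k A]
  {jC : Cᵐᵒᵖ →ₐ[k] A} {jH : AnyonGen k n →ₐ[k] A} {jB : B →ₐ[k] A}

variable (𝒜) in
/-- The antipode on `B`, namely `b ↦ S(b) g ^ (-|b|)`. -/
def antipodeB (SB : B →ₗ[k] B) (jH : AnyonGen k n →ₐ[k] A) (jB : B →ₐ[k] A) : B →ₗ[k] A :=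
  byDegree 𝒜 fun i => LinearMap.mulRight k (jH (gpow k (-i))) ∘ₗ jB.toLinearMap ∘ₗ SB

theorem antipodeB_of_mem {i : ZMod n} {b : B} (hb : b ∈ 𝒜 i) :
    antipodeB 𝒜 SB jH jB b = jB (SB b) * jH (gpow k (-i)) :=
  byDegree_of_mem (fun i => LinearMap.mulRight k (jH (gpow k (-i))) ∘ₗ jB.toLinearMap ∘ₗ SB) hb

variable (𝒞) in
/-- The antipode on `C`, namely `c ↦ g ^ (-|c|) S⁻¹(c)`. -/
def antipodeC (T : C →ₗ[k] C) (jC : Cᵐᵒᵖ →ₐ[k] A) (jH : AnyonGen k n →ₐ[k] A) : C →ₗ[k] A :=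
  byDegree 𝒞 fun i => LinearMap.mulLeft k (jH (gpow k (-i))) ∘ₗ jC.toLinearMap ∘ₗ
    (MulOpposite.opLinearEquiv k).toLinearMap ∘ₗ T

theorem antipodeC_of_mem {i : ZMod n} {c : C} (hc : c ∈ 𝒞 i) :
    antipodeC 𝒞 T jC jH c = jH (gpow k (-i)) * jC (MulOpposite.op (T c)) :=
  byDegree_of_mem (fun i => LinearMap.mulLeft k (jH (gpow k (-i))) ∘ₗ jC.toLinearMap ∘ₗ
    (MulOpposite.opLinearEquiv k).toLinearMap ∘ₗ T) hc

theorem map_gpow_neg_mul (a : ZMod n) : jH (gpow k (-a)) * jH (gpow k a) = 1 := by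
  rw [← map_mul, gpow_neg_mul_gpow, map_one]

theorem map_gpow_mul_neg (a : ZMod n) : jH (gpow k a) * jH (gpow k (-a)) = 1 := by
  rw [← map_mul, gpow_mul_gpow_neg, map_one]

section

variable {I : Type*} [Fintype I] [DecidableEq I] {d : I → ZMod n} {t : I → I → C}
  {p : I → ZMod n} {s : I → I → B}

theorem IsAnyonicBraidedGroup.sum_antipodeB_mul (hB : IsAnyonicBraidedGroup q 𝒜 SB)
    (hs : IsComatrix 𝒜 p s) (a b : I) :
    ∑ c, antipodeB 𝒜 SB jH jB (s a c) * (jH (gpow k (p c - p a)) * jB (s c b)) =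
      if a = b then 1 else 0 := by
  have h := congrArg jB (hB.sum_antipode_mul hs a b)
  rw [map_sum, apply_ite jB, map_one, map_zero] at h
  rw [← h]
  refine Finset.sum_congr rfl fun c _ => ?_
  rw [antipodeB_of_mem (hs.mem a c), ← mul_assoc, mul_assoc (jB _), map_gpow_neg_mul, mul_one,
    map_mul]

theorem IsAnyonicBraidedGroup.sum_mul_antipodeB (hB : IsAnyonicBraidedGroup q 𝒜 SB)
    (hs : IsComatrix 𝒜 p s) (a b : I) :
    ∑ c, jB (s a c) * (antipodeB 𝒜 SB jH jB (s c b) * jH (gpow k (-(p c - p a)))) =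
      if a = b then 1 else 0 := by
  have h := congrArg (fun x => jB x * jH (gpow k (-(p b - p a)))) (hB.sum_mul_antipode hs a b)
  simp only [map_sum, Finset.sum_mul] at h
  trans jB (if a = b then 1 else 0) * jH (gpow k (-(p b - p a)))
  · rw [← h]
    refine Finset.sum_congr rfl fun c _ => ?_
    rw [antipodeB_of_mem (hs.mem c b), mul_assoc, ← map_mul jH, ← gpow_add, map_mul, mul_assoc]
    congr 4
    ring
  · split_ifs with hab
    · rw [hab]; simp
    · simp

/-- In `Cᵒᵖ` the factors are reversed, so it is the inverse of the braided antipode that satisfies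
the antipode axiom here. The twist is cancelled later by moving a power of `g`. -/
theorem IsAnyonicBraidedGroup.sum_antipodeC_mul (hq : q ^ n = 1)
    (hC : IsAnyonicBraidedGroup q 𝒞 SC) (hST : ∀ b, SC (T b) = b) (hTS : ∀ b, T (SC b) = b)
    (ht : IsComatrix 𝒞 d t) (i j : I) :
    ∑ l, qpow q (-((d l - d i) * (d j - d l))) • (jH (gpow k (-(d j - d l))) *
      antipodeC 𝒞 T jC jH (t i l) * jC (MulOpposite.op (t l j))) = if i = j then 1 else 0 := by
  have h := congrArg (fun x => jH (gpow k (-(d j - d i))) * jC (MulOpposite.op x))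
    (hC.sum_mul_inverse hq hST hTS ht i j)
  simp only [Finset.op_sum, map_sum, Finset.mul_sum, MulOpposite.op_smul, map_smul,
    mul_smul_comm] at h
  trans jH (gpow k (-(d j - d i))) * jC (MulOpposite.op (if i = j then 1 else 0))
  · rw [← h]
    refine Finset.sum_congr rfl fun l _ => ?_
    rw [antipodeC_of_mem (ht.mem i l), ← mul_assoc, ← map_mul jH, ← gpow_add,
      MulOpposite.op_mul, map_mul, mul_assoc]
    congr 4
    ring
  · split_ifs with hij
    · rw [hij]; simp
    · simp

theorem IsCrossRep.sum_mul_antipodeC (hq : q ^ n = 1) (h : IsCrossRep q 𝒜 𝒞 ev jC jH jB)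
    (hC : IsAnyonicBraidedGroup q 𝒞 SC) (hST : ∀ b, SC (T b) = b) (hTS : ∀ b, T (SC b) = b)
    (ht : IsComatrix 𝒞 d t) (i j : I) :
    ∑ l, jH (gpow k (d j - d l)) * jC (MulOpposite.op (t i l)) * antipodeC 𝒞 T jC jH (t l j) =
      if i = j then 1 else 0 := by
  have h' := congrArg (fun x => jC (MulOpposite.op x)) (hC.sum_inverse_mul hq hST hTS ht i j)
  simp only [Finset.op_sum, map_sum, MulOpposite.op_smul, map_smul] at h'
  rw [apply_ite MulOpposite.op, apply_ite jC, MulOpposite.op_one, MulOpposite.op_zero, map_one,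
    map_zero] at h'
  rw [← h']
  refine Finset.sum_congr rfl fun l _ => ?_
  rw [antipodeC_of_mem (ht.mem l j), ← mul_assoc, mul_assoc (jH _), h.C_g _ _ _ (ht.mem i l),
    mul_smul_comm, ← mul_assoc, map_gpow_mul_neg, one_mul, smul_mul_assoc, MulOpposite.op_mul,
    map_mul, neg_mul, mul_comm (d j - d l)]

end

variable (𝒜 𝒞) in
/-- The antipode of the double-bosonisation as a linear map on the underlying tensor product. -/
def tripleAntipode (SB : B →ₗ[k] B) (T : C →ₗ[k] C) (jC : Cᵐᵒᵖ →ₐ[k] A)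
    (jH : AnyonGen k n →ₐ[k] A) (jB : B →ₐ[k] A) : (C ⊗[k] AnyonGen k n) ⊗[k] B →ₗ[k] A :=
  LinearMap.mul' k A ∘ₗ (TensorProduct.comm k A A).toLinearMap ∘ₗ TensorProduct.map
    (LinearMap.mul' k A ∘ₗ (TensorProduct.comm k A A).toLinearMap ∘ₗ TensorProduct.map
      (antipodeC 𝒞 T jC jH) (jH.toLinearMap ∘ₗ HopfAlgebra.antipode k))
    (antipodeB 𝒜 SB jH jB)

theorem tripleAntipode_tmul (c : C) (a : ZMod n) (b : B) :
    tripleAntipode 𝒜 𝒞 SB T jC jH jB ((c ⊗ₜ gpow k a) ⊗ₜ b) =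
      antipodeB 𝒜 SB jH jB b * (jH (gpow k (-a)) * antipodeC 𝒞 T jC jH c) := by
  have : HopfAlgebra.antipode k (gpow k a : AnyonGen k n) = gpow k (-a) := by
    simp [gpow]
  simp [tripleAntipode, this]

variable {Δ : A →ₐ[k] A ⊗[k] A} {ε : A →ₐ[k] k}

theorem HasCrossCoproduct.comul_triple (h : HasCrossCoproduct 𝒜 𝒞 jC jH jB Δ ε)
    {m : ℕ} {d : Fin m → ZMod n} {t : Fin m → Fin m → C} (ht : IsComatrix 𝒞 d t)
    {m' : ℕ} {p : Fin m' → ZMod n} {s : Fin m' → Fin m' → B} (hs : IsComatrix 𝒜 p s)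
    (i j : Fin m) (a b : Fin m') (y : ZMod n) :
    Δ (jC (MulOpposite.op (t i j)) * jH (gpow k y) * jB (s a b)) = ∑ l, ∑ c,
      (jH (gpow k (d j - d l)) * jC (MulOpposite.op (t i l)) * jH (gpow k y) * jB (s a c)) ⊗ₜ
      (jC (MulOpposite.op (t l j)) * jH (gpow k (y + (p c - p a))) * jB (s c b)) := by
  rw [map_mul, map_mul, h.comul_C m d t ht, h.comul_H, h.comul_B m' p s hs]
  simp only [Finset.sum_mul, Finset.mul_sum, Algebra.TensorProduct.tmul_mul_tmul]
  rw [Finset.sum_comm]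
  simp only [gpow_add, map_mul, mul_assoc]

theorem IsCrossRep.exists_antipode (hq : q ^ n = 1)
    (hB : IsAnyonicBraidedGroup q 𝒜 SB) (hC : IsAnyonicBraidedGroup q 𝒞 SC)
    (hSC : Function.Bijective SC)
    (h : IsCrossRep q 𝒜 𝒞 ev jC jH jB) (hbij : Function.Bijective (tripleMap jC jH jB))
    (hΔ : HasCrossCoproduct 𝒜 𝒞 jC jH jB Δ ε) :
    ∃ S : A →ₗ[k] A,
      LinearMap.mul' k A ∘ₗ S.rTensor A ∘ₗ Δ.toLinearMap =
        Algebra.linearMap k A ∘ₗ ε.toLinearMap ∧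
      LinearMap.mul' k A ∘ₗ S.lTensor A ∘ₗ Δ.toLinearMap =
        Algebra.linearMap k A ∘ₗ ε.toLinearMap := by
  let e := LinearEquiv.ofBijective SC hSC
  have hST : ∀ b, SC (e.symm.toLinearMap b) = b := e.apply_symm_apply
  have hTS : ∀ b, e.symm.toLinearMap (SC b) = b := e.symm_apply_apply
  generalize e.symm.toLinearMap = T at hST hTS
  let E := LinearEquiv.ofBijective _ hbij
  -- The map is defined by reversal on ordered products. Its antimultiplicativity is not needed: the
  -- two convolution identities are verified on the ordered products themselves.
  let S : A →ₗ[k] A := tripleAntipode 𝒜 𝒞 SB T jC jH jB ∘ₗ E.symm.toLinearMap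
  have hS : ∀ c y b, S (jC (MulOpposite.op c) * jH (gpow k y) * jB b) =
      antipodeB 𝒜 SB jH jB b * (jH (gpow k (-y)) * antipodeC 𝒞 T jC jH c) := by
    intro c y b
    rw [← tripleAntipode_tmul, ← tripleMap_tmul]
    exact congrArg (tripleAntipode 𝒜 𝒞 SB T jC jH jB) (E.symm_apply_apply _)
  have hext : ∀ {f f' : A →ₗ[k] A},
      (∀ (m : ℕ) (d : Fin m → ZMod n) (t : Fin m → Fin m → C), IsComatrix 𝒞 d t →
        ∀ (m' : ℕ) (p : Fin m' → ZMod n) (s : Fin m' → Fin m' → B), IsComatrix 𝒜 p s →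
        ∀ i j a b y, f (jC (MulOpposite.op (t i j)) * jH (gpow k y) * jB (s a b)) =
          f' (jC (MulOpposite.op (t i j)) * jH (gpow k y) * jB (s a b))) → f = f' := by
    intro f f' hf
    have : f ∘ₗ tripleMap jC jH jB = f' ∘ₗ tripleMap jC jH jB := by
      refine TensorProduct.ext (TensorProduct.ext ?_)
      refine hC.linearMap_ext (M := AnyonGen k n →ₗ[k] B →ₗ[k] A) fun m d t ht i j => ?_
      refine anyonGen_linearMap_ext fun y => ?_
      refine hB.linearMap_ext (M := A) fun m' p s hs a b => ?_
      change f (tripleMap _ _ _ ((_ ⊗ₜ _) ⊗ₜ _)) = f' (tripleMap _ _ _ ((_ ⊗ₜ _) ⊗ₜ _))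
      rw [tripleMap_tmul]
      exact hf m d t ht m' p s hs i j a b y
    exact LinearMap.ext fun z => by
      obtain ⟨w, rfl⟩ := hbij.2 z
      exact LinearMap.congr_fun this w
  refine ⟨S, hext fun m d t ht m' p s hs i j a b y => ?_,
    hext fun m d t ht m' p s hs i j a b y => ?_⟩
  · simp only [LinearMap.comp_apply, AlgHom.toLinearMap_apply, hΔ.comul_triple ht hs, map_sum,
      LinearMap.rTensor_tmul, LinearMap.mul'_apply, map_mul ε, hΔ.counit_C, hΔ.counit_H,
      hΔ.counit_B, ht.counit, hs.counit]
    -- The first leg must be put in normal order before `S` can be evaluated; this costs exactly the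
    -- twist in `sum_antipodeC_mul`. The sum over `l` then collapses in the middle, and that over
    -- `c` around it.
    have key : ∀ l c, S (jH (gpow k (d j - d l)) * jC (MulOpposite.op (t i l)) * jH (gpow k y) *
        jB (s a c)) * (jC (MulOpposite.op (t l j)) * jH (gpow k (y + (p c - p a))) * jB (s c b)) =
        antipodeB 𝒜 SB jH jB (s a c) * (jH (gpow k (-y)) *
          (qpow q (-((d l - d i) * (d j - d l))) • (jH (gpow k (-(d j - d l))) *
            antipodeC 𝒞 T jC jH (t i l) * jC (MulOpposite.op (t l j)))) * jH (gpow k y)) *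
          (jH (gpow k (p c - p a)) * jB (s c b)) := by
      intro l c
      rw [h.C_mul_gpow_comm hq _ _ (ht.mem i l), smul_mul_assoc, smul_mul_assoc, map_smul,
        mul_assoc (jC _), ← map_mul jH, ← gpow_add, hS, mul_comm (d j - d l), neg_add_rev, gpow_add,
        gpow_add, map_mul, map_mul]
      simp only [smul_mul_assoc, mul_smul_comm, mul_assoc]
    simp only [key]
    rw [Finset.sum_comm]
    simp only [← Finset.mul_sum, ← Finset.sum_mul, hC.sum_antipodeC_mul hq hST hTS ht i j]
    by_cases hij : i = j
    · simp only [if_pos hij, mul_one, map_gpow_neg_mul, hB.sum_antipodeB_mul hs, one_mul]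
      split_ifs <;> simp
    · simp [hij]
  · simp only [LinearMap.comp_apply, AlgHom.toLinearMap_apply, hΔ.comul_triple ht hs, map_sum,
      LinearMap.lTensor_tmul, LinearMap.mul'_apply, map_mul ε, hΔ.counit_C, hΔ.counit_H,
      hΔ.counit_B, ht.counit, hs.counit, hS]
    -- Here the order is opposite: the sum for `B` stands in the middle and collapses first, then
    -- that for `C`.
    have key : ∀ l c, jH (gpow k (d j - d l)) * jC (MulOpposite.op (t i l)) * jH (gpow k y) *
        jB (s a c) * (antipodeB 𝒜 SB jH jB (s c b) * (jH (gpow k (-(y + (p c - p a)))) *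
          antipodeC 𝒞 T jC jH (t l j))) =
        jH (gpow k (d j - d l)) * jC (MulOpposite.op (t i l)) * jH (gpow k y) *
          (jB (s a c) * (antipodeB 𝒜 SB jH jB (s c b) * jH (gpow k (-(p c - p a))))) *
          (jH (gpow k (-y)) * antipodeC 𝒞 T jC jH (t l j)) := by
      intro l c
      rw [neg_add_rev, gpow_add, map_mul]
      simp only [mul_assoc]
    simp only [key, ← Finset.mul_sum, ← Finset.sum_mul, hB.sum_mul_antipodeB hs a b]
    by_cases hab : a = b
    · simp only [if_pos hab, mul_one, ← mul_assoc]
      simp only [mul_assoc _ (jH (gpow k y)) (jH (gpow k (-y))), map_gpow_mul_neg, mul_one,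
        h.sum_mul_antipodeC hq hC hST hTS ht]
      split_ifs <;> simp
    · simp [hab]

end Antipode

/-! ### Double Sweedler sums on comatrices -/

section Sweedler

variable {k : Type u} [Field k] {n : ℕ} [NeZero n] {q : k}
  {B : Type v} [Ring B] [Algebra k B] [Coalgebra k B] {𝒜 : ZMod n → Submodule k B}
  [GradedAlgebra 𝒜] {SB : B →ₗ[k] B}
  {C : Type w} [Ring C] [Algebra k C] [Coalgebra k C] {𝒞 : ZMod n → Submodule k C}
  [GradedAlgebra 𝒞] {SC : C →ₗ[k] C}
  {M : Type*} [AddCommGroup M] [Module k M]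

theorem IsBilin.sweedler_zero_left {F : B → B → M} (hF : IsBilin k F) :
    sweedler k (0 : B) F = 0 := by
  simp [hF.sweedler_eq]

theorem isBilin_sweedler {F : B → B → C → C → M}
    (hF : ∀ c₁ c₂, IsBilin k fun b₁ b₂ => F b₁ b₂ c₁ c₂) (c : C) :
    IsBilin k fun b₁ b₂ => sweedler k c (F b₁ b₂) where
  add_left x x' y := by
    rw [← sweedler_add]; congr 1; funext c₁ c₂; exact (hF c₁ c₂).add_left x x' y
  smul_left r x y := by
    rw [← sweedler_smul]; congr 1; funext c₁ c₂; exact (hF c₁ c₂).smul_left r x y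
  add_right x y y' := by
    rw [← sweedler_add]; congr 1; funext c₁ c₂; exact (hF c₁ c₂).add_right x y y'
  smul_right r x y := by
    rw [← sweedler_smul]; congr 1; funext c₁ c₂; exact (hF c₁ c₂).smul_right r x y

theorem sweedler_sweedler_comatrix {F : B → B → C → C → M}
    (hF : ∀ c₁ c₂, IsBilin k fun b₁ b₂ => F b₁ b₂ c₁ c₂) (hF' : ∀ b₁ b₂, IsBilin k (F b₁ b₂))
    {I : Type*} [Fintype I] [DecidableEq I] {d : I → ZMod n} {t : I → I → C}
    (ht : IsComatrix 𝒞 d t)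
    {J : Type*} [Fintype J] [DecidableEq J] {p : J → ZMod n} {s : J → J → B}
    (hs : IsComatrix 𝒜 p s) (i j : I) (a b : J) :
    sweedler k (s a b) (fun b₁ b₂ => sweedler k (t i j) (F b₁ b₂)) =
      ∑ l, ∑ c, F (s a c) (s c b) (t i l) (t l j) := by
  rw [hs.sweedler_eq_sum (isBilin_sweedler hF _), Finset.sum_comm]
  exact Finset.sum_congr rfl fun c _ => ht.sweedler_eq_sum (hF' _ _) i j

/-- Both expressions are linear in `b` and in `c`, so equality on comatrix entries is enough. -/
theorem sweedler_sweedler_ext (hB : IsAnyonicBraidedGroup q 𝒜 SB)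
    (hC : IsAnyonicBraidedGroup q 𝒞 SC) {F G : B → B → C → C → M}
    (hF : ∀ c₁ c₂, IsBilin k fun b₁ b₂ => F b₁ b₂ c₁ c₂) (hF' : ∀ b₁ b₂, IsBilin k (F b₁ b₂))
    (hG : ∀ c₁ c₂, IsBilin k fun b₁ b₂ => G b₁ b₂ c₁ c₂) (hG' : ∀ b₁ b₂, IsBilin k (G b₁ b₂))
    (h : ∀ (m : ℕ) (d : Fin m → ZMod n) (t : Fin m → Fin m → C), IsComatrix 𝒞 d t →
      ∀ (m' : ℕ) (p : Fin m' → ZMod n) (s : Fin m' → Fin m' → B), IsComatrix 𝒜 p s →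
      ∀ i j a b, ∑ l, ∑ c, F (s a c) (s c b) (t i l) (t l j) =
        ∑ l, ∑ c, G (s a c) (s c b) (t i l) (t l j)) (b : B) (c : C) :
    sweedler k b (fun b₁ b₂ => sweedler k c (F b₁ b₂)) =
      sweedler k b (fun b₁ b₂ => sweedler k c (G b₁ b₂)) := by
  refine comatrix_induction (𝒜 := 𝒜) hB.comul_mem (P := fun b =>
    sweedler k b (fun b₁ b₂ => sweedler k c (F b₁ b₂)) =
      sweedler k b (fun b₁ b₂ => sweedler k c (G b₁ b₂))) ?_ ?_ ?_ ?_ b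
  · rw [(isBilin_sweedler hF c).sweedler_zero_left, (isBilin_sweedler hG c).sweedler_zero_left]
  · intro x y hx hy
    rw [(isBilin_sweedler hF c).sweedler_add_left, (isBilin_sweedler hG c).sweedler_add_left, hx,
      hy]
  · intro r x hx
    rw [(isBilin_sweedler hF c).sweedler_smul_left, (isBilin_sweedler hG c).sweedler_smul_left, hx]
  intro m' p s hs a b
  refine comatrix_induction (𝒜 := 𝒞) hC.comul_mem (P := fun c =>
    sweedler k (s a b) (fun b₁ b₂ => sweedler k c (F b₁ b₂)) =
      sweedler k (s a b) (fun b₁ b₂ => sweedler k c (G b₁ b₂))) ?_ ?_ ?_ ?_ c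
  · simp only [fun b₁ b₂ => (hF' b₁ b₂).sweedler_zero_left,
      fun b₁ b₂ => (hG' b₁ b₂).sweedler_zero_left]
  · intro x y hx hy
    simp only [fun b₁ b₂ => (hF' b₁ b₂).sweedler_add_left,
      fun b₁ b₂ => (hG' b₁ b₂).sweedler_add_left, sweedler_add, hx, hy]
  · intro r x hx
    simp only [fun b₁ b₂ => (hF' b₁ b₂).sweedler_smul_left,
      fun b₁ b₂ => (hG' b₁ b₂).sweedler_smul_left, sweedler_smul, hx]
  intro m d t ht i j
  rw [sweedler_sweedler_comatrix hF hF' ht hs, sweedler_sweedler_comatrix hG hG' ht hs]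
  exact h m d t ht m' p s hs i j a b

/-- A sum over homogeneous components, by which degrees are encoded in the definitions, has one term
on a comatrix entry. -/
theorem IsComatrix.sum_proj {I : Type*} [Fintype I] [DecidableEq I] {p : I → ZMod n}
    {s : I → I → B} (hs : IsComatrix 𝒜 p s) (a b : I) (f : ZMod n → B → M) (hf : ∀ i, f i 0 = 0) :
    ∑ i, f i (GradedAlgebra.proj 𝒜 i (s a b)) = f (p b - p a) (s a b) := by
  rw [Finset.sum_eq_single (p b - p a)]
  · rw [proj_of_mem 𝒜 (hs.mem a b), if_pos rfl]
  · intro i _ hi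
    rw [proj_of_mem 𝒜 (hs.mem a b), if_neg hi, hf]
  · simp

end Sweedler

/-! ### From Sweedler notation to comatrices -/

section Conversion

variable {k : Type u} [Field k] {n : ℕ} [NeZero n] {q : k}
  {B : Type v} [Ring B] [Algebra k B] [Coalgebra k B] {𝒜 : ZMod n → Submodule k B}
  [GradedAlgebra 𝒜] {SB : B →ₗ[k] B}
  {C : Type w} [Ring C] [Algebra k C] [Coalgebra k C] {𝒞 : ZMod n → Submodule k C}
  [GradedAlgebra 𝒞] {SC : C →ₗ[k] C} {ev : C →ₗ[k] B →ₗ[k] k}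
  {A : Type*} [Ring A] [Algebra k A]

/-- Commutation with `g` up to a scalar implies commutation with the powers of `g`. -/
theorem mul_gpow_of_mul_gpow_one (hq : q ^ n = 1) (jH : AnyonGen k n →ₐ[k] A) {z : A} {i : ZMod n}
    (h : z * jH (gpow k 1) = qpow q i • (jH (gpow k 1) * z)) (a : ZMod n) :
    z * jH (gpow k a) = qpow q (a * i) • (jH (gpow k a) * z) := by
  have hm : ∀ m : ℕ, z * jH (gpow k (m : ZMod n)) =
      qpow q ((m : ZMod n) * i) • (jH (gpow k (m : ZMod n)) * z) := by
    intro m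
    induction m with
    | zero => simp
    | succ m ih =>
      rw [Nat.cast_succ, gpow_add, map_mul, ← mul_assoc, ih, smul_mul_assoc, mul_assoc, h,
        mul_smul_comm, smul_smul, ← qpow_add hq, add_mul, one_mul, mul_assoc]
  simpa using hm a.val

variable (𝒜) in
theorem isBilin_comulB (jH : AnyonGen k n →ₐ[k] A) (jB : B →ₐ[k] A) :
    IsBilin k (fun b₁ b₂ : B => ∑ i : ZMod n,
      jB (GradedAlgebra.proj 𝒜 i b₁) ⊗ₜ[k] (jH (gpow k i) * jB b₂)) where
  add_left x x' y := by
    simp only [map_add, TensorProduct.add_tmul, Finset.sum_add_distrib]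
  smul_left r x y := by
    simp only [map_smul, ← TensorProduct.smul_tmul', Finset.smul_sum]
  add_right x y y' := by
    simp only [map_add, mul_add, TensorProduct.tmul_add, Finset.sum_add_distrib]
  smul_right r x y := by
    simp only [map_smul, mul_smul_comm, TensorProduct.tmul_smul, Finset.smul_sum]

variable (𝒞) in
theorem isBilin_comulC (jH : AnyonGen k n →ₐ[k] A) (jC : Cᵐᵒᵖ →ₐ[k] A) :
    IsBilin k (fun c₁ c₂ : C => ∑ i : ZMod n,
      (jH (gpow k i) * jC (MulOpposite.op c₁)) ⊗ₜ[k]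
        jC (MulOpposite.op (GradedAlgebra.proj 𝒞 i c₂))) where
  add_left x x' y := by
    simp only [map_add, MulOpposite.op_add, mul_add, TensorProduct.add_tmul,
      Finset.sum_add_distrib]
  smul_left r x y := by
    simp only [map_smul, MulOpposite.op_smul, mul_smul_comm, ← TensorProduct.smul_tmul',
      Finset.smul_sum]
  add_right x y y' := by
    simp only [map_add, MulOpposite.op_add, TensorProduct.tmul_add, Finset.sum_add_distrib]
  smul_right r x y := by
    simp only [map_smul, MulOpposite.op_smul, TensorProduct.tmul_smul, Finset.smul_sum]

/-- Links the form of the cross relation in the definition with the one used in all computations. -/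
theorem isAnyonicDoubleBosonisation_cross_iff (hB : IsAnyonicBraidedGroup q 𝒜 SB)
    (hC : IsAnyonicBraidedGroup q 𝒞 SC) (jC : Cᵐᵒᵖ →ₐ[k] A) (jH : AnyonGen k n →ₐ[k] A)
    (jB : B →ₐ[k] A) :
    (∀ (b : B) (c : C),
      sweedler k b (fun b₁ b₂ => sweedler k c (fun c₁ c₂ => ∑ i : ZMod n,
        ev (GradedAlgebra.proj 𝒞 i c₂) b₂ •
          (jB b₁ * jH (gpow k i) * jC (MulOpposite.op c₁)))) =
      sweedler k b (fun b₁ b₂ => sweedler k c (fun c₁ c₂ => ∑ i : ZMod n,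
        ev c₁ (GradedAlgebra.proj 𝒜 i b₁) •
          (jC (MulOpposite.op c₂) * jH (gpow k i) * jB b₂)))) ↔
    ∀ (m : ℕ) (d : Fin m → ZMod n) (t : Fin m → Fin m → C), IsComatrix 𝒞 d t →
      ∀ (m' : ℕ) (p : Fin m' → ZMod n) (s : Fin m' → Fin m' → B), IsComatrix 𝒜 p s →
      ∀ i j a b,
      ∑ l, ∑ c, ev (t l j) (s c b) •
        (jB (s a c) * jH (gpow k (d j - d l)) * jC (MulOpposite.op (t i l))) =
      ∑ l, ∑ c, ev (t i l) (s a c) •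
        (jC (MulOpposite.op (t l j)) * jH (gpow k (p c - p a)) * jB (s c b)) := by
  have hF : ∀ c₁ c₂ : C, IsBilin k (fun b₁ b₂ : B => ∑ i : ZMod n,
      ev (GradedAlgebra.proj 𝒞 i c₂) b₂ •
        (jB b₁ * jH (gpow k i) * jC (MulOpposite.op c₁))) := fun c₁ c₂ =>
    { add_left := fun x x' y => by
        simp only [map_add, add_mul, smul_add, Finset.sum_add_distrib]
      smul_left := fun r x y => by
        simp only [map_smul, smul_mul_assoc, Finset.smul_sum, smul_comm r]
      add_right := fun x y y' => by
        simp only [map_add, add_smul, Finset.sum_add_distrib]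
      smul_right := fun r x y => by
        simp only [map_smul, smul_eq_mul, mul_smul, Finset.smul_sum] }
  have hF' : ∀ b₁ b₂ : B, IsBilin k (fun c₁ c₂ : C => ∑ i : ZMod n,
      ev (GradedAlgebra.proj 𝒞 i c₂) b₂ •
        (jB b₁ * jH (gpow k i) * jC (MulOpposite.op c₁))) := fun b₁ b₂ =>
    { add_left := fun x x' y => by
        simp only [map_add, MulOpposite.op_add, mul_add, smul_add, Finset.sum_add_distrib]
      smul_left := fun r x y => by
        simp only [map_smul, MulOpposite.op_smul, mul_smul_comm, Finset.smul_sum, smul_comm r]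
      add_right := fun x y y' => by
        simp only [map_add, LinearMap.add_apply, add_smul, Finset.sum_add_distrib]
      smul_right := fun r x y => by
        simp only [map_smul, LinearMap.smul_apply, smul_eq_mul, mul_smul, Finset.smul_sum] }
  have hG : ∀ c₁ c₂ : C, IsBilin k (fun b₁ b₂ : B => ∑ i : ZMod n,
      ev c₁ (GradedAlgebra.proj 𝒜 i b₁) •
        (jC (MulOpposite.op c₂) * jH (gpow k i) * jB b₂)) := fun c₁ c₂ =>
    { add_left := fun x x' y => by
        simp only [map_add, add_smul, Finset.sum_add_distrib]
      smul_left := fun r x y => by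
        simp only [map_smul, smul_eq_mul, mul_smul, Finset.smul_sum]
      add_right := fun x y y' => by
        simp only [map_add, mul_add, smul_add, Finset.sum_add_distrib]
      smul_right := fun r x y => by
        simp only [map_smul, mul_smul_comm, Finset.smul_sum, smul_comm r] }
  have hG' : ∀ b₁ b₂ : B, IsBilin k (fun c₁ c₂ : C => ∑ i : ZMod n,
      ev c₁ (GradedAlgebra.proj 𝒜 i b₁) •
        (jC (MulOpposite.op c₂) * jH (gpow k i) * jB b₂)) := fun b₁ b₂ =>
    { add_left := fun x x' y => by
        simp only [map_add, LinearMap.add_apply, add_smul, Finset.sum_add_distrib]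
      smul_left := fun r x y => by
        simp only [map_smul, LinearMap.smul_apply, smul_eq_mul, mul_smul, Finset.smul_sum]
      add_right := fun x y y' => by
        simp only [map_add, MulOpposite.op_add, add_mul, smul_add, Finset.sum_add_distrib]
      smul_right := fun r x y => by
        simp only [map_smul, MulOpposite.op_smul, smul_mul_assoc, Finset.smul_sum, smul_comm r] }
  have hl : ∀ (m : ℕ) (d : Fin m → ZMod n) (t : Fin m → Fin m → C), IsComatrix 𝒞 d t →
      ∀ (b₁ b₂ : B) (c : C) l j, ∑ i : ZMod n, ev (GradedAlgebra.proj 𝒞 i (t l j)) b₂ •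
        (jB b₁ * jH (gpow k i) * jC (MulOpposite.op c)) = ev (t l j) b₂ •
        (jB b₁ * jH (gpow k (d j - d l)) * jC (MulOpposite.op c)) :=
    fun m d t ht b₁ b₂ c l j => ht.sum_proj l j (fun i x => ev x b₂ •
      (jB b₁ * jH (gpow k i) * jC (MulOpposite.op c))) (by simp)
  have hr : ∀ (m : ℕ) (p : Fin m → ZMod n) (s : Fin m → Fin m → B), IsComatrix 𝒜 p s →
      ∀ (b : B) (c₁ c₂ : C) l j, ∑ i : ZMod n, ev c₁ (GradedAlgebra.proj 𝒜 i (s l j)) •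
        (jC (MulOpposite.op c₂) * jH (gpow k i) * jB b) = ev c₁ (s l j) •
        (jC (MulOpposite.op c₂) * jH (gpow k (p j - p l)) * jB b) :=
    fun m p s hs b c₁ c₂ l j => hs.sum_proj l j (fun i x => ev c₁ x •
      (jC (MulOpposite.op c₂) * jH (gpow k i) * jB b)) (by simp)
  constructor
  · intro h m d t ht m' p s hs i j a b
    have := h (s a b) (t i j)
    rw [sweedler_sweedler_comatrix hF hF' ht hs, sweedler_sweedler_comatrix hG hG' ht hs] at this
    simpa only [hl m d t ht, hr m' p s hs] using this
  · intro h b c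
    refine sweedler_sweedler_ext hB hC hF hF' hG hG' (fun m d t ht m' p s hs i j a b => ?_) b c
    simpa only [hl m d t ht, hr m' p s hs] using h m d t ht m' p s hs i j a b

end Conversion

/-! ### The explicit presentation in terms of comatrices -/

section DoubleBosonisation

variable {k : Type u} [Field k] {n : ℕ} [NeZero n] {q : k}
  {B : Type v} [Ring B] [Algebra k B] [Coalgebra k B] {𝒜 : ZMod n → Submodule k B}
  [GradedAlgebra 𝒜] {SB : B →ₗ[k] B}
  {C : Type w} [Ring C] [Algebra k C] [Coalgebra k C] {𝒞 : ZMod n → Submodule k C}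
  [GradedAlgebra 𝒞] {SC : C →ₗ[k] C} {ev : C →ₗ[k] B →ₗ[k] k}
  {A : Type*} [Ring A] [Bialgebra k A]
  {jC : Cᵐᵒᵖ →ₐ[k] A} {jH : AnyonGen k n →ₐc[k] A} {jB : B →ₐ[k] A}

theorem IsAnyonicDoubleBosonisation.isCrossRep (hq : q ^ n = 1)
    (hB : IsAnyonicBraidedGroup q 𝒜 SB) (hC : IsAnyonicBraidedGroup q 𝒞 SC)
    (h : IsAnyonicDoubleBosonisation q 𝒜 𝒞 ev jC jH jB) :
    IsCrossRep q 𝒜 𝒞 ev jC (jH : AnyonGen k n →ₐ[k] A) jB where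
  B_g a i b hb := mul_gpow_of_mul_gpow_one hq (jH : AnyonGen k n →ₐ[k] A) (h.cross_B_g i b hb) a
  C_g a i c hc := mul_gpow_of_mul_gpow_one hq (jH : AnyonGen k n →ₐ[k] A) (h.cross_C_g i c hc) a
  B_C := (isAnyonicDoubleBosonisation_cross_iff hB hC jC (jH : AnyonGen k n →ₐ[k] A) jB).1
    h.cross_B_C

theorem IsAnyonicDoubleBosonisation.comul_C_comatrix
    (h : IsAnyonicDoubleBosonisation q 𝒜 𝒞 ev jC jH jB)
    {I : Type*} [Fintype I] [DecidableEq I] {d : I → ZMod n} {t : I → I → C}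
    (ht : IsComatrix 𝒞 d t) (i j : I) :
    Coalgebra.comul (R := k) (jC (MulOpposite.op (t i j))) = ∑ l, (jH (gpow k (d j - d l)) *
      jC (MulOpposite.op (t i l))) ⊗ₜ[k] jC (MulOpposite.op (t l j)) := by
  refine (h.comul_C _).trans ((ht.sweedler_eq_sum
    (isBilin_comulC 𝒞 (jH : AnyonGen k n →ₐ[k] A) jC) i j).trans ?_)
  exact Finset.sum_congr rfl fun l _ => ht.sum_proj l j (fun i' x => (jH (gpow k i') *
    jC (MulOpposite.op (t i l))) ⊗ₜ[k] jC (MulOpposite.op x)) (by simp)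

theorem IsAnyonicDoubleBosonisation.comul_B_comatrix
    (h : IsAnyonicDoubleBosonisation q 𝒜 𝒞 ev jC jH jB)
    {I : Type*} [Fintype I] [DecidableEq I] {p : I → ZMod n} {s : I → I → B}
    (hs : IsComatrix 𝒜 p s) (a b : I) :
    Coalgebra.comul (R := k) (jB (s a b)) =
      ∑ c, jB (s a c) ⊗ₜ[k] (jH (gpow k (p c - p a)) * jB (s c b)) := by
  refine (h.comul_B _).trans ((hs.sweedler_eq_sum
    (isBilin_comulB 𝒜 (jH : AnyonGen k n →ₐ[k] A) jB) a b).trans ?_)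
  exact Finset.sum_congr rfl fun c _ => hs.sum_proj a c (fun i x => jB x ⊗ₜ[k]
    (jH (gpow k i) * jB (s c b))) (by simp)

theorem IsCrossRep.isAnyonicDoubleBosonisation (hB : IsAnyonicBraidedGroup q 𝒜 SB)
    (hC : IsAnyonicBraidedGroup q 𝒞 SC)
    (h : IsCrossRep q 𝒜 𝒞 ev jC (jH : AnyonGen k n →ₐ[k] A) jB)
    (hbij : Function.Bijective (tripleMap jC (jH : AnyonGen k n →ₐ[k] A) jB))
    (hcC : ∀ (m : ℕ) (d : Fin m → ZMod n) (t : Fin m → Fin m → C), IsComatrix 𝒞 d t →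
      ∀ i j, Coalgebra.comul (R := k) (jC (MulOpposite.op (t i j))) =
        ∑ l, (jH (gpow k (d j - d l)) *
          jC (MulOpposite.op (t i l))) ⊗ₜ[k] jC (MulOpposite.op (t l j)))
    (hcB : ∀ (m : ℕ) (p : Fin m → ZMod n) (s : Fin m → Fin m → B), IsComatrix 𝒜 p s →
      ∀ a b, Coalgebra.comul (R := k) (jB (s a b)) =
        ∑ c, jB (s a c) ⊗ₜ[k] (jH (gpow k (p c - p a)) * jB (s c b))) :
    IsAnyonicDoubleBosonisation q 𝒜 𝒞 ev jC jH jB where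
  bijective := hbij
  cross_B_g i b hb := by simpa using h.B_g 1 i b hb
  cross_C_g i c hc := by simpa using h.C_g 1 i c hc
  cross_B_C := (isAnyonicDoubleBosonisation_cross_iff hB hC jC (jH : AnyonGen k n →ₐ[k] A) jB).2
    h.B_C
  comul_B b := by
    have hb := isBilin_comulB 𝒜 (jH : AnyonGen k n →ₐ[k] A) jB
    refine (LinearMap.congr_fun (hB.linearMap_ext (f := Coalgebra.comul ∘ₗ jB.toLinearMap)
      (f' := TensorProduct.lift hb.toLin ∘ₗ Coalgebra.comul) fun m p s hs a b => ?_) b).trans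
      (hb.sweedler_eq b).symm
    refine (hcB m p s hs a b).trans ?_
    rw [LinearMap.comp_apply, ← hb.sweedler_eq, hs.sweedler_eq_sum hb]
    exact Finset.sum_congr rfl fun c _ => (hs.sum_proj a c (fun i x => jB x ⊗ₜ[k]
      (jH (gpow k i) * jB (s c b))) (by simp)).symm
  comul_C c := by
    have hb := isBilin_comulC 𝒞 (jH : AnyonGen k n →ₐ[k] A) jC
    refine (LinearMap.congr_fun (hC.linearMap_ext (f := Coalgebra.comul ∘ₗ jC.toLinearMap ∘ₗ
      (MulOpposite.opLinearEquiv k).toLinearMap)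
      (f' := TensorProduct.lift hb.toLin ∘ₗ Coalgebra.comul) fun m d t ht i j => ?_) c).trans
      (hb.sweedler_eq c).symm
    refine (hcC m d t ht i j).trans ?_
    rw [LinearMap.comp_apply, ← hb.sweedler_eq, ht.sweedler_eq_sum hb]
    exact Finset.sum_congr rfl fun l _ => (ht.sum_proj l j (fun i' x => (jH (gpow k i') *
      jC (MulOpposite.op (t i l))) ⊗ₜ[k] jC (MulOpposite.op x)) (by simp)).symm

end DoubleBosonisation

/-! ### Fourier inversion and the universal R-matrix -/

section Fourier

variable {k : Type u} [Field k] {n : ℕ} [NeZero n] {q : k}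

theorem sum_qpow_mul_of_isPrimitiveRoot (hq : IsPrimitiveRoot q n) (j : ZMod n) :
    ∑ a : ZMod n, qpow q (a * j) = if j = 0 then (n : k) else 0 := by
  split_ifs with hj
  · simp [hj, ZMod.card]
  have h1 : qpow q j ≠ 1 := hq.pow_ne_one_of_pos_of_lt
    (fun h => hj ((ZMod.val_eq_zero j).1 h)) (ZMod.val_lt j)
  -- Shifting the summation variable by one multiplies the character sum by `q ^ j`, which differs
  -- from `1`.
  have h2 : qpow q j * ∑ a : ZMod n, qpow q (a * j) = ∑ a : ZMod n, qpow q (a * j) := by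
    rw [Finset.mul_sum,
      ← Equiv.sum_comp (Equiv.addRight (1 : ZMod n)) (fun a : ZMod n => qpow q (a * j))]
    refine Finset.sum_congr rfl fun a _ => ?_
    rw [← qpow_add hq.pow_eq_one, Equiv.coe_addRight, add_mul, one_mul, add_comm]
  have h3 : (qpow q j - 1) * ∑ a : ZMod n, qpow q (a * j) = 0 := by
    rw [sub_mul, h2, one_mul, sub_self]
  exact (mul_eq_zero.1 h3).resolve_left (sub_ne_zero.2 h1)

theorem sum_qpow_mul_qpow_of_isPrimitiveRoot (hq : IsPrimitiveRoot q n) (i c : ZMod n) :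
    ∑ a : ZMod n, (n : k)⁻¹ * qpow q (-(a * c)) * qpow q (a * i) = if c = i then 1 else 0 := by
  -- A primitive `n`-th root of unity exists in a field only if `n` is invertible there.
  have hn : (n : k) ≠ 0 := (hq.neZero').out
  have : ∀ a : ZMod n, (n : k)⁻¹ * qpow q (-(a * c)) * qpow q (a * i) =
      (n : k)⁻¹ * qpow q (a * (i - c)) := fun a => by
    rw [mul_assoc, ← qpow_add hq.pow_eq_one]
    congr 2
    ring
  simp only [this, ← Finset.mul_sum, sum_qpow_mul_of_isPrimitiveRoot hq, sub_eq_zero, eq_comm (a := i)]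
  split_ifs
  · exact inv_mul_cancel₀ hn
  · rw [mul_zero]

variable {B : Type v} [Ring B] [Algebra k B] {𝒜 : ZMod n → Submodule k B} [GradedAlgebra 𝒜]
  {M : Type*} [AddCommGroup M] [Module k M]

/-- On degree `i` the first leg of the R-matrix acts by the character `a ↦ q ^ (a i)`; by
orthogonality only `g ^ i` survives in the second leg. So contraction with the R-matrix replaces it
by `g ^ |b|`. -/
theorem sum_act_anyonR₁ (hq : IsPrimitiveRoot q n) {F : B → AnyonGen k n → M}
    (hadd : ∀ x y h, F (x + y) h = F x h + F y h) (hsmul : ∀ (r : k) x h, F (r • x) h = r • F x h)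
    (b : B) : ∑ r, F (act q 𝒜 b (anyonR₁ q r)) (anyonR₂ (k := k) r) =
      ∑ i, F (GradedAlgebra.proj 𝒜 i b) (gpow k i) := by
  have h0 : ∀ h, F 0 h = 0 := fun h => by simpa using hsmul 0 0 h
  refine homogeneous_induction 𝒜 (P := fun b => ∑ r, F (act q 𝒜 b (anyonR₁ q r))
    (anyonR₂ (k := k) r) = ∑ i, F (GradedAlgebra.proj 𝒜 i b) (gpow k i)) ?_ (fun i x hx => ?_) b
  · intro x y hx hy
    simp only [map_add, LinearMap.add_apply, hadd, Finset.sum_add_distrib, hx, hy]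
  rw [Finset.sum_eq_single i, proj_of_mem 𝒜 hx, if_pos rfl, Fintype.sum_prod_type_right]
  · simp only [anyonR₁, anyonR₂, map_smul, act_gpow q 𝒜 hx, hsmul, smul_smul, ← Finset.sum_smul,
      sum_qpow_mul_qpow_of_isPrimitiveRoot hq]
    simp
  · intro j _ hj
    rw [proj_of_mem 𝒜 hx, if_neg hj, h0]
  · simp

/-- The same inversion on the other leg, the R-matrix being symmetric. Its scalars are stored in the
first legs, which are now the second argument of `F`, so homogeneity there is required too. -/
theorem sum_act_anyonR₂ (hq : IsPrimitiveRoot q n) {F : B → AnyonGen k n → M}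
    (hadd : ∀ x y h, F (x + y) h = F x h + F y h) (hsmul : ∀ (r : k) x h, F (r • x) h = r • F x h)
    (hsmul' : ∀ (r : k) x h, F x (r • h) = r • F x h)
    (b : B) : ∑ r, F (act q 𝒜 b (anyonR₂ r)) (anyonR₁ q r) =
      ∑ i, F (GradedAlgebra.proj 𝒜 i b) (gpow k i) := by
  have h0 : ∀ h, F 0 h = 0 := fun h => by simpa using hsmul 0 0 h
  refine homogeneous_induction 𝒜 (P := fun b => ∑ r, F (act q 𝒜 b (anyonR₂ r))
    (anyonR₁ q r) = ∑ i, F (GradedAlgebra.proj 𝒜 i b) (gpow k i)) ?_ (fun i x hx => ?_) b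
  · intro x y hx hy
    simp only [map_add, LinearMap.add_apply, hadd, Finset.sum_add_distrib, hx, hy]
  rw [Finset.sum_eq_single i, proj_of_mem 𝒜 hx, if_pos rfl, Fintype.sum_prod_type]
  · simp only [anyonR₁, anyonR₂, act_gpow q 𝒜 hx, hsmul, hsmul', smul_smul, ← Finset.sum_smul]
    have : ∀ c : ZMod n, ∑ a : ZMod n, qpow q (a * i) * ((n : k)⁻¹ * qpow q (-(c * a))) =
        if c = i then 1 else 0 := fun c => by
      rw [← sum_qpow_mul_qpow_of_isPrimitiveRoot hq]
      exact Finset.sum_congr rfl fun a _ => by rw [mul_comm, mul_comm c]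
    simp only [this]
    simp
  · intro j _ hj
    rw [proj_of_mem 𝒜 hx, if_neg hj, h0]
  · simp

/-- Both relations are linear in `h`, so group-like `h = g ^ a` suffice, and these follow from `g`.
Only the values of `F` at `g ^ a, g ^ a` matter, so one statement covers the conventions for `B` and
for `C`. -/
theorem cross_gen_iff (hq : q ^ n = 1) {A : Type*} [Ring A] [Algebra k A]
    (jH : AnyonGen k n →ₐ[k] A) (f : B →ₗ[k] A) {F : B → AnyonGen k n → AnyonGen k n → A}
    (hF : ∀ b, IsBilin k (F b))
    (hFg : ∀ b a, F b (gpow k a) (gpow k a) = jH (gpow k a) * f (act q 𝒜 b (gpow k a))) :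
    (∀ b h, f b * jH h = sweedler k h (F b)) ↔ ∀ i, ∀ b ∈ 𝒜 i,
      f b * jH (gpow k 1) = qpow q i • (jH (gpow k 1) * f b) := by
  have hs : ∀ b a, sweedler k (gpow k a) (F b) = jH (gpow k a) * f (act q 𝒜 b (gpow k a)) := by
    intro b a
    rw [← hFg, (hF b).sweedler_of_comul (ι := Unit) (x := fun _ => gpow k a)
      (y := fun _ => gpow k a) (by rw [comul_gpow]; simp)]
    simp
  constructor
  · intro h i b hb
    rw [h, hs, act_gpow q 𝒜 hb, map_smul, mul_smul_comm, one_mul]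
  · intro h b x
    refine anyonGen_induction (P := fun x => f b * jH x = sweedler k x (F b)) ?_ ?_ ?_ x
    · intro x y hx hy
      rw [map_add, mul_add, hx, hy, (hF b).sweedler_add_left]
    · intro r x hx
      rw [map_smul, mul_smul_comm, hx, (hF b).sweedler_smul_left]
    intro a
    rw [hs]
    refine homogeneous_induction 𝒜 (P := fun b => f b * jH (gpow k a) =
      jH (gpow k a) * f (act q 𝒜 b (gpow k a))) ?_ (fun i x hx => ?_) b
    · intro x y hx hy
      simp only [map_add, add_mul, LinearMap.add_apply, mul_add, hx, hy]
    · rw [mul_gpow_of_mul_gpow_one hq jH (h i x hx), act_gpow q 𝒜 hx, map_smul, mul_smul_comm]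

end Fourier

/-! ### Comparison with the R-matrix form, uniqueness and existence -/

section Main

variable {k : Type u} [Field k] {n : ℕ} [NeZero n] {q : k}
  {B : Type v} [Ring B] [Algebra k B] [Coalgebra k B] {𝒜 : ZMod n → Submodule k B}
  [GradedAlgebra 𝒜] {SB : B →ₗ[k] B}
  {C : Type w} [Ring C] [Algebra k C] [Coalgebra k C] {𝒞 : ZMod n → Submodule k C}
  [GradedAlgebra 𝒞] {SC : C →ₗ[k] C} {ev : C →ₗ[k] B →ₗ[k] k}

/-- Inside the Sweedler sums the R-matrix terms and the degree terms agree for each pair of legs by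
Fourier inversion, so no property of the braided groups enters. -/
theorem isDoubleBosonisation_iff (hq : IsPrimitiveRoot q n) {A : Type*} [Ring A] [Bialgebra k A]
    (jC : Cᵐᵒᵖ →ₐ[k] A) (jH : AnyonGen k n →ₐc[k] A) (jB : B →ₐ[k] A) :
    IsDoubleBosonisation (anyonR₁ q) (anyonR₂ (n := n)) (act q 𝒜) (act q 𝒞) ev jC jH jB ↔
      IsAnyonicDoubleBosonisation q 𝒜 𝒞 ev jC jH jB := by
  have hBH := cross_gen_iff (𝒜 := 𝒜) hq.pow_eq_one (jH : AnyonGen k n →ₐ[k] A) jB.toLinearMap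
    (F := fun b h₁ h₂ => jH h₁ * jB (act q 𝒜 b h₂))
    (fun b =>
      { add_left := fun x x' y => by simp only [map_add, add_mul]
        smul_left := fun r x y => by simp only [map_smul, smul_mul_assoc]
        add_right := fun x y y' => by simp only [map_add, mul_add]
        smul_right := fun r x y => by simp only [map_smul, mul_smul_comm] })
    (fun _ _ => rfl)
  have hCH := cross_gen_iff (𝒜 := 𝒞) hq.pow_eq_one (jH : AnyonGen k n →ₐ[k] A)
    (jC.toLinearMap ∘ₗ (MulOpposite.opLinearEquiv k).toLinearMap)
    (F := fun c h₁ h₂ => jH h₂ * jC (MulOpposite.op (act q 𝒞 c h₁)))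
    (fun b =>
      { add_left := fun x x' y => by simp only [map_add, mul_add, MulOpposite.op_add]
        smul_left := fun r x y => by simp only [map_smul, mul_smul_comm, MulOpposite.op_smul]
        add_right := fun x y y' => by simp only [map_add, add_mul]
        smul_right := fun r x y => by simp only [map_smul, smul_mul_assoc] })
    (fun _ _ => rfl)
  have h₁ : ∀ (b₁ b₂ : B) (c₁ c₂ : C), ∑ r, ev (act q 𝒞 c₂ (anyonR₂ r)) b₂ •
      (jB b₁ * jH (anyonR₁ q r) * jC (MulOpposite.op c₁)) =
      ∑ i : ZMod n, ev (GradedAlgebra.proj 𝒞 i c₂) b₂ •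
        (jB b₁ * jH (gpow k i) * jC (MulOpposite.op c₁)) := fun b₁ b₂ c₁ c₂ =>
    sum_act_anyonR₂ hq (F := fun c h => ev c b₂ • (jB b₁ * jH h * jC (MulOpposite.op c₁)))
      (fun x y h => by simp only [map_add, LinearMap.add_apply, add_smul])
      (fun r x h => by simp only [map_smul, LinearMap.smul_apply, smul_eq_mul, mul_smul])
      (fun r x h => by simp only [map_smul, mul_smul_comm, smul_mul_assoc, smul_comm r]) c₂
  have h₂ : ∀ (b₁ b₂ : B) (c₁ c₂ : C), ∑ r, ev c₁ (act q 𝒜 b₁ (anyonR₁ q r)) •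
      (jC (MulOpposite.op c₂) * jH (anyonR₂ r) * jB b₂) =
      ∑ i : ZMod n, ev c₁ (GradedAlgebra.proj 𝒜 i b₁) •
          (jC (MulOpposite.op c₂) * jH (gpow k i) * jB b₂) := fun b₁ b₂ c₁ c₂ =>
    sum_act_anyonR₁ hq (F := fun b h => ev c₁ b • (jC (MulOpposite.op c₂) * jH h * jB b₂))
      (fun x y h => by simp only [map_add, add_smul])
      (fun r x h => by simp only [map_smul, smul_eq_mul, mul_smul]) b₁
  have h₃ : ∀ b₁ b₂ : B, ∑ r, jB (act q 𝒜 b₁ (anyonR₁ q r)) ⊗ₜ[k] (jH (anyonR₂ r) * jB b₂) =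
      ∑ i : ZMod n, jB (GradedAlgebra.proj 𝒜 i b₁) ⊗ₜ[k] (jH (gpow k i) * jB b₂) := fun b₁ b₂ =>
    sum_act_anyonR₁ hq (F := fun b h => jB b ⊗ₜ[k] (jH h * jB b₂))
      (fun x y h => by simp only [map_add, TensorProduct.add_tmul])
      (fun r x h => by simp only [map_smul, ← TensorProduct.smul_tmul']) b₁
  have h₄ : ∀ c₁ c₂ : C, ∑ r, (jH (anyonR₁ q r) * jC (MulOpposite.op c₁)) ⊗ₜ[k]
      jC (MulOpposite.op (act q 𝒞 c₂ (anyonR₂ r))) =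
      ∑ i : ZMod n, (jH (gpow k i) * jC (MulOpposite.op c₁)) ⊗ₜ[k]
        jC (MulOpposite.op (GradedAlgebra.proj 𝒞 i c₂)) := fun c₁ c₂ =>
    sum_act_anyonR₂ hq (F := fun c h => (jH h * jC (MulOpposite.op c₁)) ⊗ₜ[k]
      jC (MulOpposite.op c))
      (fun x y h => by simp only [map_add, MulOpposite.op_add, TensorProduct.tmul_add])
      (fun r x h => by simp only [map_smul, MulOpposite.op_smul, TensorProduct.tmul_smul])
      (fun r x h => by simp only [map_smul, smul_mul_assoc, ← TensorProduct.smul_tmul']) c₂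
  constructor
  · intro h
    exact
      { bijective := h.bijective
        cross_B_g := hBH.1 h.cross_B_H
        cross_C_g := hCH.1 h.cross_C_H
        cross_B_C := by simpa only [h₁, h₂] using h.cross_B_C
        comul_B := by simpa only [h₃] using h.comul_B
        comul_C := by simpa only [h₄] using h.comul_C }
  · intro h
    exact
      { bijective := h.bijective
        cross_B_H := hBH.2 h.cross_B_g
        cross_C_H := hCH.2 h.cross_C_g
        cross_B_C := by simpa only [h₁, h₂] using h.cross_B_C
        comul_B := by simpa only [h₃] using h.comul_B
        comul_C := by simpa only [h₄] using h.comul_C }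

/-- An algebra isomorphism that preserves the coproduct preserves the counit. -/
theorem counit_algEquiv_apply {A A' : Type*} [Ring A] [Bialgebra k A] [Ring A'] [Bialgebra k A']
    (e : A ≃ₐ[k] A') (he : (Algebra.TensorProduct.map (e : A →ₐ[k] A') (e : A →ₐ[k] A')).comp
      (Bialgebra.comulAlgHom k A) = (Bialgebra.comulAlgHom k A').comp (e : A →ₐ[k] A')) (a : A) :
    Coalgebra.counit (R := k) (e a) = Coalgebra.counit (R := k) a := by
  have r := Coalgebra.Repr.arbitrary k a
  let r' : Coalgebra.Repr k (e a) (A × A) :=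
    { index := r.index
      left := fun i => e (r.left i)
      right := fun i => e (r.right i)
      eq := by
        have := AlgHom.congr_fun he a
        rw [AlgHom.comp_apply, AlgHom.comp_apply, Bialgebra.comulAlgHom_apply,
          Bialgebra.comulAlgHom_apply, ← r.eq, map_sum] at this
        exact this }
  -- Uniqueness of the counit: both sides equal `∑ ε(a₍₁₎) ε'(e a₍₂₎)`, by the counit axiom of `A`
  -- on the left leg and that of `A'` on the right leg.
  have h1 := congrArg (fun x => Coalgebra.counit (R := k) (e x)) (Coalgebra.sum_counit_smul r)
  have h2 := congrArg (LinearMap.mul' k k ∘ₗ TensorProduct.map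
    (Coalgebra.counit ∘ₗ e.symm.toLinearMap) LinearMap.id) (Coalgebra.sum_tmul_counit_eq r')
  simp only [map_sum, map_smul, smul_eq_mul] at h1
  simp only [map_sum, LinearMap.comp_apply, TensorProduct.map_tmul, LinearMap.mul'_apply,
    LinearMap.id_apply, r', AlgEquiv.toLinearMap_apply, AlgEquiv.symm_apply_apply, mul_one] at h2
  rw [← h1, ← h2]

/-- A bialgebra isomorphism of double-bosonisations exists and is unique. -/
theorem IsAnyonicDoubleBosonisation.existsUnique_equiv (hq : q ^ n = 1)
    (hB : IsAnyonicBraidedGroup q 𝒜 SB) (hC : IsAnyonicBraidedGroup q 𝒞 SC)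
    (hSC : Function.Bijective SC) (hev : IsDualPairing 𝒜 𝒞 ev)
    {A A' : Type*} [Ring A] [Bialgebra k A] [Ring A'] [Bialgebra k A']
    {jC : Cᵐᵒᵖ →ₐ[k] A} {jH : AnyonGen k n →ₐc[k] A} {jB : B →ₐ[k] A}
    {jC' : Cᵐᵒᵖ →ₐ[k] A'} {jH' : AnyonGen k n →ₐc[k] A'} {jB' : B →ₐ[k] A'}
    (h : IsAnyonicDoubleBosonisation q 𝒜 𝒞 ev jC jH jB)
    (h' : IsAnyonicDoubleBosonisation q 𝒜 𝒞 ev jC' jH' jB') :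
    ∃! e : A ≃ₐc[k] A',
      (∀ c, e (jC c) = jC' c) ∧ (∀ h, e (jH h) = jH' h) ∧ (∀ b, e (jB b) = jB' b) := by
  have hr := h.isCrossRep hq hB hC
  have hr' := h'.isCrossRep hq hB hC
  have hbij : Function.Bijective (tripleMap jC (jH : AnyonGen k n →ₐ[k] A) jB) := h.bijective
  have hbij' : Function.Bijective (tripleMap jC' (jH' : AnyonGen k n →ₐ[k] A') jB') := h'.bijective
  obtain ⟨F, hFC, hFH, hFB⟩ := hr.exists_lift hq hB hC hSC hev hbij hr'
  obtain ⟨G, hGC, hGH, hGB⟩ := hr'.exists_lift hq hB hC hSC hev hbij' hr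
  -- The lifts in the two directions are mutually inverse, because their composites fix the
  -- generators.
  let e : A ≃ₐ[k] A' := AlgEquiv.ofAlgHom F G
    (IsCrossRep.algHom_ext hbij'.2 (fun c => by simp [hGC, hFC])
      (fun a => by rw [AlgHom.comp_apply, hGH, hFH]; rfl) (fun b => by simp [hGB, hFB]))
    (IsCrossRep.algHom_ext hbij.2 (fun c => by simp [hGC, hFC])
      (fun a => by rw [AlgHom.comp_apply, hFH, hGH]; rfl) (fun b => by simp [hGB, hFB]))
  have hFH' : ∀ x, F (jH x) = jH' x := hFH
  have hcomul : (Algebra.TensorProduct.map (e : A →ₐ[k] A') (e : A →ₐ[k] A')).comp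
      (Bialgebra.comulAlgHom k A) = (Bialgebra.comulAlgHom k A').comp (e : A →ₐ[k] A') := by
    change (Algebra.TensorProduct.map F F).comp (Bialgebra.comulAlgHom k A) =
      (Bialgebra.comulAlgHom k A').comp F
    refine IsCrossRep.algHom_ext_comatrix hB hC hbij.2 (fun m d t ht i j => ?_) (fun a => ?_)
      (fun m p s hs a b => ?_)
    · rw [AlgHom.comp_apply, AlgHom.comp_apply, hFC, Bialgebra.comulAlgHom_apply,
        Bialgebra.comulAlgHom_apply, h.comul_C_comatrix ht, h'.comul_C_comatrix ht, map_sum]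
      simp only [Algebra.TensorProduct.map_tmul, map_mul, hFC, hFH']
    · have h1 := CoalgHomClass.map_comp_comul_apply jH (gpow k a)
      have h2 := CoalgHomClass.map_comp_comul_apply jH' (gpow k a)
      rw [comul_gpow] at h1 h2
      rw [AlgHom.comp_apply, AlgHom.comp_apply, hFH, Bialgebra.comulAlgHom_apply,
        Bialgebra.comulAlgHom_apply]
      refine (congrArg (Algebra.TensorProduct.map F F) h1.symm).trans (Eq.trans ?_ h2)
      change F (jH _) ⊗ₜ F (jH _) = jH' _ ⊗ₜ jH' _
      rw [hFH']
    · rw [AlgHom.comp_apply, AlgHom.comp_apply, hFB, Bialgebra.comulAlgHom_apply,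
        Bialgebra.comulAlgHom_apply, h.comul_B_comatrix hs, h'.comul_B_comatrix hs, map_sum]
      simp only [Algebra.TensorProduct.map_tmul, map_mul, hFB, hFH']
  refine ⟨BialgEquiv.ofAlgEquiv e (AlgHom.ext fun a => counit_algEquiv_apply e hcomul a) hcomul,
    ⟨hFC, hFH', hFB⟩, ?_⟩
  rintro e' ⟨h1, h2, h3⟩
  have hF : ((e' : A ≃ₐ[k] A') : A →ₐ[k] A') = F :=
    IsCrossRep.algHom_ext hbij.2 (fun c => (h1 c).trans (hFC c).symm)
      (fun a => (h2 _).trans (hFH _).symm) (fun b => (h3 b).trans (hFB b).symm)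
  exact BialgEquiv.ext fun a => AlgHom.congr_fun hF a

/-- The double-bosonisation exists. -/
theorem exists_isAnyonicDoubleBosonisation (hq : q ^ n = 1)
    (hB : IsAnyonicBraidedGroup q 𝒜 SB) (hC : IsAnyonicBraidedGroup q 𝒞 SC)
    (hSC : Function.Bijective SC) (hev : IsDualPairing 𝒜 𝒞 ev) :
    ∃ (A : Type (max u v w)) (_ : Ring A) (_ : HopfAlgebra k A)
      (jC : Cᵐᵒᵖ →ₐ[k] A) (jH : AnyonGen k n →ₐc[k] A) (jB : B →ₐ[k] A),
      IsAnyonicDoubleBosonisation q 𝒜 𝒞 ev jC jH jB := by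
  obtain ⟨A, _, _, jC, jH, jB, h, hbij⟩ := hev.exists_crossRep_bijective hq hB hC hSC
  obtain ⟨Δ, ε, hΔ⟩ := h.exists_coproduct hq hB hC hSC hev hbij
  obtain ⟨S, hS₁, hS₂⟩ := h.exists_antipode hq hB hC hSC hbij hΔ
  let bialg : Bialgebra k A := Bialgebra.ofAlgHom Δ ε (hΔ.coassoc hB hC hbij.2)
    (hΔ.rTensor hB hC hbij.2) (hΔ.lTensor hB hC hbij.2)
  let hopf : HopfAlgebra k A :=
    { bialg with
      antipode := S
      mul_antipode_rTensor_comul := hS₁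
      mul_antipode_lTensor_comul := hS₂ }
  -- The inclusion of `H` preserves counit and coproduct because it does so on the powers of `g`.
  let jH' : AnyonGen k n →ₐc[k] A := BialgHom.ofAlgHom jH
    (AlgHom.toLinearMap_injective (anyonGen_linearMap_ext fun a =>
      (hΔ.counit_H a).trans (counit_gpow a).symm))
    (AlgHom.toLinearMap_injective (anyonGen_linearMap_ext fun a =>
      (congrArg (Algebra.TensorProduct.map jH jH) (comul_gpow a)).trans (hΔ.comul_H a).symm))
  exact ⟨A, _, hopf, jC, jH', jB, IsCrossRep.isAnyonicDoubleBosonisation hB hC h hbij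
    hΔ.comul_C hΔ.comul_B⟩

end Main

end Anyonic

end

theorem proposition4p1 {k : Type u} [Field k] (n : ℕ) [NeZero n] (q : k) (hq : q ^ n = 1)
    -- the anyonic braided group `B`, with braided antipode `SB`
    {B : Type v} [Ring B] [Algebra k B] [Coalgebra k B]
    (𝒜 : ZMod n → Submodule k B) [GradedAlgebra 𝒜] (SB : B →ₗ[k] B)
    (hB : Anyonic.IsAnyonicBraidedGroup q 𝒜 SB)
    -- its dual `C = B⋆`, with invertible braided antipode `SC`
    {C : Type w} [Ring C] [Algebra k C] [Coalgebra k C]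
    (𝒞 : ZMod n → Submodule k C) [GradedAlgebra 𝒞] (SC : C →ₗ[k] C)
    (hC : Anyonic.IsAnyonicBraidedGroup q 𝒞 SC) (hSC : Function.Bijective SC)
    (ev : C →ₗ[k] B →ₗ[k] k) (hev : Anyonic.IsDualPairing 𝒜 𝒞 ev) :
    -- there is a Hopf algebra `Cᵒᵖ ⋊ k[ℤ/nℤ] ⋉ B` with the explicit relations and coproducts
    (∃ (A : Type (max u v w)) (_ : Ring A) (_ : HopfAlgebra k A)
      (jC : Cᵐᵒᵖ →ₐ[k] A) (jH : Anyonic.AnyonGen k n →ₐc[k] A) (jB : B →ₐ[k] A),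
      Anyonic.IsAnyonicDoubleBosonisation q 𝒜 𝒞 ev jC jH jB) ∧
    -- it is unique
    (∀ (A : Type x) [Ring A] [HopfAlgebra k A]
      (jC : Cᵐᵒᵖ →ₐ[k] A) (jH : Anyonic.AnyonGen k n →ₐc[k] A) (jB : B →ₐ[k] A)
      (A' : Type x) [Ring A'] [HopfAlgebra k A']
      (jC' : Cᵐᵒᵖ →ₐ[k] A') (jH' : Anyonic.AnyonGen k n →ₐc[k] A') (jB' : B →ₐ[k] A'),
      Anyonic.IsAnyonicDoubleBosonisation q 𝒜 𝒞 ev jC jH jB →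
      Anyonic.IsAnyonicDoubleBosonisation q 𝒜 𝒞 ev jC' jH' jB' →
      ∃! e : A ≃ₐc[k] A',
        (∀ c, e (jC c) = jC' c) ∧ (∀ h, e (jH h) = jH' h) ∧ (∀ b, e (jB b) = jB' b)) ∧
    -- for a primitive root `q` it is the double-bosonisation for the anyonic universal R-matrix
    (IsPrimitiveRoot q n → ∀ (A : Type x) [Ring A] [HopfAlgebra k A]
      (jC : Cᵐᵒᵖ →ₐ[k] A) (jH : Anyonic.AnyonGen k n →ₐc[k] A) (jB : B →ₐ[k] A),
      Anyonic.IsDoubleBosonisation (Anyonic.anyonR₁ q) (Anyonic.anyonR₂ (n := n))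
          (Anyonic.act q 𝒜) (Anyonic.act q 𝒞) ev jC jH jB ↔
        Anyonic.IsAnyonicDoubleBosonisation q 𝒜 𝒞 ev jC jH jB) := ⟨Anyonic.exists_isAnyonicDoubleBosonisation hq hB hC hSC hev,
    fun _ _ _ _ _ _ _ _ _ _ _ _ h h' => h.existsUnique_equiv hq hB hC hSC hev h',
    fun hq' _ _ _ jC jH jB => Anyonic.isDoubleBosonisation_iff hq' jC jH jB⟩
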